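/- Let $d\ge 1$, let $\Omega\subset\mathbb{R}^d$ be a bounded Lipschitz domain, and let $\mathcal{T}_h$ be a conforming simplicial triangulation of $\Omega$ (so $\overline\Omega=\bigcup_{T\in\mathcal{T}_h}T$). Let $\Gamma_D\subset\partial\Omega$ be a (possibly empty) union of boundary sides of $\mathcal{T}_h$, and put $\Gamma_N=\partial\Omega\setminus\Gamma_D$. Write $\|\cdot\|$ for the norm of $L^2(\Omega)$, and let $\Pi_h$ be the projection onto elementwise constant functions or vector fields, i.e. $\Pi_hf|_T$ is the mean value of $f$ over $T$. Let $\alpha>0$, $g\in L^2(\Omega)$ and $g_h=\Pi_hg$. For $f\in L^2(\Omega)$ and $v\in BV(\Omega)\cap L^2(\Omega)$ let \[ I_f(v)=|Dv|(\Omega)+\frac{\alpha}{2}\|f-v\|^2 . \] Let $u$ be a minimizer of the Rudin--Osher--Fatemi (ROF) functional $I=I_g$ over all $v\in BV(\Omega)\cap L^2(\Omega)$ with trace $v=0$ on $\Gamma_D$ (there is no boundary condition if $\Gamma_D=\emptyset$). Let $u_h$ be a continuous function on $\overline\Omega$ that is affine on each $T\in\mathcal{T}_h$ and vanishes at all vertices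 of $\mathcal{T}_h$ on $\Gamma_D$. Let $q\in W^2_N(\operatorname{div};\Omega)$, i.e. $q\in L^2(\Omega;\mathbb{R}^d)$ has a weak divergence $\operatorname{div}q\in L^2(\Omega)$ and $q\cdot n=0$ on $\Gamma_N$ in the weak sense, and assume that $|q|\le 1$ almost everywhere in $\Omega$. For $T\in\mathcal{T}_h$ put \[ \eta_{h,T}^2(u_h,q)=\int_T|\nabla u_h|-\nabla u_h\cdot\Pi_hq\,dx+\frac{1}{2\alpha}\int_T\big(\operatorname{div}q-\alpha(u_h-g_h)\big)^2dx, \] and let $\eta_h^2(u_h,q)$ be the same expression with $T$ replaced by $\Omega$. Then the following holds. 1. $\displaystyle \|u-u_h\|\le(2/\alpha)^{1/2}\,\eta_h(u_h,q)+\|g-\Pi_hg\|$. 2. $\eta_h^2(u_h,q)$ is the primal--dual gap for the data $g_h$: $\ \eta_h^2(u_h,q)=I_{g_h}(u_h)-D_{g_h}(q)$, where $D_{g_h}(q)=-\frac{1}{2\alpha}\|\operatorname{div}q+\alpha g_h\|^2+\frac{\alpha}{2}\|g_h\|^2-I_{K_1(0)}(q)$, and $I_{K_1(0)}(q)$ is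 $0$ if $|q|\le1$ almost everywhere in $\Omega$ and $+\infty$ otherwise. 3. $\eta_h^2(u_h,q)=\sum_{T\in\mathcal{T}_h}\eta_{h,T}^2(u_h,q)$, with $\eta_{h,T}^2(u_h,q)\ge0$ for every $T\in\mathcal{T}_h$. -/

import Mathlib

open MeasureTheory Set Filter Topology TopologicalSpace Metric
open scoped Distributions Gradient ENNReal NNReal RealInnerProductSpace

noncomputable section

namespace ROF

/-- The Euclidean space `ℝ^d`. -/
abbrev E (d : ℕ) : Type := EuclideanSpace ℝ (Fin d)

variable {d : ℕ}

/-! ### Bounded Lipschitz domains -/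

/-- `Ω` is a bounded Lipschitz domain: open, bounded, connected (and nonempty), and near each
boundary point it is, for some unit vector `e`, the strict epigraph in direction `e` of a Lipschitz
function `γ` of the components orthogonal to `e`. -/
structure IsBoundedLipschitzDomain (Ω : Opens (E d)) : Prop where
  bounded : Bornology.IsBounded (Ω : Set (E d))
  connected : IsConnected (Ω : Set (E d))
  lipschitz_boundary : ∀ x ∈ frontier (Ω : Set (E d)),
    ∃ (U : Set (E d)) (e : E d) (γ : E d → ℝ) (C : ℝ≥0),
      IsOpen U ∧ x ∈ U ∧ ‖e‖ = 1 ∧ LipschitzWith C γ ∧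
      ∀ y ∈ U, y ∈ (Ω : Set (E d)) ↔ γ (y - ⟪e, y⟫ • e) < ⟪e, y⟫

/-! ### Functions of bounded variation -/

/-- The (classical) divergence of a vector field. -/
def divergence (φ : E d → E d) (x : E d) : ℝ :=
  ∑ i : Fin d, (fderiv ℝ φ x (EuclideanSpace.single i 1)) i

/-- The total variation `|Du|(Ω)`: the supremum of `-∫_Ω u div φ` over all
`φ ∈ C_c^∞(Ω; ℝ^d)` with `|φ| ≤ 1`. Taking `ENNReal.ofReal` of the competing values is harmless,
since `φ = 0` competes. -/
def totalVariation (Ω : Opens (E d)) (u : E d → ℝ) : ℝ≥0∞ :=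
  ⨆ (φ : 𝓓(Ω, E d)) (_ : ∀ x, ‖φ x‖ ≤ 1),
    ENNReal.ofReal (-∫ x in (Ω : Set (E d)), u x * divergence φ x)

/-- `u ∈ BV(Ω)`. -/
def MemBV (Ω : Opens (E d)) (u : E d → ℝ) : Prop :=
  Integrable u (volume.restrict (Ω : Set (E d))) ∧ totalVariation Ω u < ∞

/-- The boundary condition `u = 0` on `Γ ⊆ ∂Ω`, in the sense of traces of `BV` functions: for
`H^{d-1}`-almost every `x ∈ Γ`, `r^{-d} ∫_{B_r(x) ∩ Ω} |u(y) - 0| dy → 0` as `r → 0`. -/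
def HasZeroTraceOn (Ω : Opens (E d)) (Γ : Set (E d)) (u : E d → ℝ) : Prop :=
  ∀ᵐ x ∂((Measure.hausdorffMeasure ((d : ℝ) - 1) : Measure (E d)).restrict Γ),
    Tendsto (fun r : ℝ => (r ^ d)⁻¹ * ∫ y in ball x r ∩ (Ω : Set (E d)), |u y|)
      (𝓝[>] 0) (𝓝 0)

/-! ### The ROF functional and its dual -/

/-- The norm of `L²(Ω)`. -/
def l2Norm (Ω : Opens (E d)) (f : E d → ℝ) : ℝ :=
  lpNorm f 2 (volume.restrict (Ω : Set (E d)))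

/-- The ROF functional `I(v) = |Dv|(Ω) + (α/2) ‖g - v‖²`. -/
def rofEnergy (Ω : Opens (E d)) (α : ℝ) (g v : E d → ℝ) : EReal :=
  ((totalVariation Ω v : ℝ≥0∞) : EReal)
    + ((α / 2 * l2Norm Ω (fun x => g x - v x) ^ 2 : ℝ) : EReal)

/-- `v ∈ BV(Ω) ∩ L²(Ω)` with `v = 0` on `ΓD`. For `ΓD = ∅` this is `BV(Ω) ∩ L²(Ω)`. -/
structure IsAdmissible (Ω : Opens (E d)) (ΓD : Set (E d)) (v : E d → ℝ) : Prop where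
  memBV : MemBV Ω v
  memL2 : MemLp v 2 (volume.restrict (Ω : Set (E d)))
  zeroTrace : HasZeroTraceOn Ω ΓD v

/-- `u` minimizes the ROF functional over `BV(Ω) ∩ L²(Ω)` subject to `u = 0` on `ΓD`. -/
structure IsROFMinimizer (Ω : Opens (E d)) (ΓD : Set (E d)) (α : ℝ) (g u : E d → ℝ) : Prop where
  admissible : IsAdmissible Ω ΓD u
  le : ∀ v : E d → ℝ, IsAdmissible Ω ΓD v → rofEnergy Ω α g u ≤ rofEnergy Ω α g v

/-- `p` is the weak divergence of `q` in `Ω`. -/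
def HasWeakDivergence (Ω : Opens (E d)) (q : E d → E d) (p : E d → ℝ) : Prop :=
  ∀ φ : 𝓓(Ω, ℝ),
    ∫ x in (Ω : Set (E d)), ⟪q x, ∇ φ x⟫ = -∫ x in (Ω : Set (E d)), p x * φ x

/-- `q · n = 0` on `∂Ω \ ΓD` in the weak sense, where `div q = p`: Green's formula holds without
boundary term for all smooth functions on `closure Ω` that vanish near `ΓD`. -/
def HasZeroNormalTraceOff (Ω : Opens (E d)) (ΓD : Set (E d)) (q : E d → E d) (p : E d → ℝ) :
    Prop :=
  ∀ φ : 𝓓((⊤ : Opens (E d)), ℝ), Disjoint (tsupport φ) ΓD →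
    ∫ x in (Ω : Set (E d)), ⟪q x, ∇ φ x⟫ = -∫ x in (Ω : Set (E d)), p x * φ x

/-- `q ∈ W²_N(div; Ω)` with weak divergence `div q = p`, where `Γ_N = ∂Ω \ ΓD`. -/
structure MemWDivN (Ω : Opens (E d)) (ΓD : Set (E d)) (q : E d → E d) (p : E d → ℝ) : Prop where
  memL2 : MemLp q 2 (volume.restrict (Ω : Set (E d)))
  div_memL2 : MemLp p 2 (volume.restrict (Ω : Set (E d)))
  weakDiv : HasWeakDivergence Ω q p
  normalTrace : HasZeroNormalTraceOff Ω ΓD q p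

open Classical in
/-- The dual functional `D(q) = -(1/(2α)) ‖div q + α g‖² + (α/2) ‖g‖² - I_{K_1(0)}(q)`, where
`p = div q` and `I_{K_1(0)}(q)` is `0` if `|q| ≤ 1` almost everywhere in `Ω` and `+∞` otherwise. -/
def rofDual (Ω : Opens (E d)) (α : ℝ) (g : E d → ℝ) (q : E d → E d) (p : E d → ℝ) : EReal :=
  if ∀ᵐ x ∂(volume.restrict (Ω : Set (E d))), ‖q x‖ ≤ 1 then
    ((-(1 / (2 * α)) * l2Norm Ω (fun x => p x + α * g x) ^ 2
      + α / 2 * l2Norm Ω g ^ 2 : ℝ) : EReal)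
  else ⊥

/-! ### Triangulations and finite element spaces -/

/-- A conforming triangulation of `Ω`: a finite simplicial complex whose underlying space is the
closure of `Ω` and in which every simplex is a face of a `d`-dimensional one. -/
structure Triangulation (Ω : Opens (E d)) where
  complex : Geometry.SimplicialComplex ℝ (E d)
  finite : complex.faces.Finite
  space_eq : complex.space = closure (Ω : Set (E d))
  pure : ∀ s ∈ complex.faces, ∃ t ∈ complex.faces, s ⊆ t ∧ t.card = d + 1

namespace Triangulation

variable {Ω : Opens (E d)} (𝒯 : Triangulation Ω)

/-- The elements, each given by its `d + 1` vertices. -/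
def elements : Finset (Finset (E d)) :=
  (𝒯.finite.subset (sep_subset 𝒯.complex.faces (fun s => s.card = d + 1))).toFinset

/-- The sides contained in `∂Ω`, each given by its `d` vertices. -/
def boundarySides : Set (Finset (E d)) :=
  {s ∈ 𝒯.complex.faces | s.card = d ∧ convexHull ℝ (s : Set (E d)) ⊆ frontier (Ω : Set (E d))}

/-- The projection `Π_h` onto elementwise constant functions or vector fields: on each element,
the mean value over that element (and, on the null set of points interior to no element, `0`). -/
def proj {F : Type*} [NormedAddCommGroup F] [NormedSpace ℝ F] (f : E d → F) : E d → F :=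
  fun x => ∑ T ∈ 𝒯.elements,
    (interior (convexHull ℝ (T : Set (E d)))).indicator
      (fun _ => ⨍ y in convexHull ℝ (T : Set (E d)), f y) x

/-- The `P1` finite element space `S¹_D(𝒯)`: continuous on `closure Ω`, affine on each element,
and zero at all vertices on `ΓD`. -/
structure MemP1 (ΓD : Set (E d)) (v : E d → ℝ) : Prop where
  continuousOn : ContinuousOn v (closure (Ω : Set (E d)))
  affine : ∀ T ∈ 𝒯.elements, ∃ A : E d →ᵃ[ℝ] ℝ,
    EqOn v A (convexHull ℝ (T : Set (E d)))
  dirichlet : ∀ z ∈ 𝒯.complex.vertices, z ∈ ΓD → v z = 0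

/-- The contribution of a set `S` to the squared estimator, where `p = div q` and `g_h = Π_h g`:
`∫_S |∇u_h| - ∇u_h · Π_h q dx + (1/(2α)) ∫_S (div q - α (u_h - g_h))² dx`. -/
def estimatorSqOn (S : Set (E d)) (α : ℝ) (g uh : E d → ℝ) (q : E d → E d) (p : E d → ℝ) : ℝ :=
  (∫ x in S, (‖∇ uh x‖ - ⟪∇ uh x, 𝒯.proj q x⟫))
    + 1 / (2 * α) * ∫ x in S, (p x - α * (uh x - 𝒯.proj g x)) ^ 2

/-- `η_h²(u_h, q)`. -/
def etaSq (α : ℝ) (g uh : E d → ℝ) (q : E d → E d) (p : E d → ℝ) : ℝ :=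
  𝒯.estimatorSqOn (Ω : Set (E d)) α g uh q p

/-- The element contribution `η_T²(u_h, q)`. -/
def etaSqElem (T : Finset (E d)) (α : ℝ) (g uh : E d → ℝ) (q : E d → E d) (p : E d → ℝ) : ℝ :=
  𝒯.estimatorSqOn (convexHull ℝ (T : Set (E d))) α g uh q p

/-- The estimator `η_h(u_h, q)`. -/
def eta (α : ℝ) (g uh : E d → ℝ) (q : E d → E d) (p : E d → ℝ) : ℝ :=
  √(𝒯.etaSq α g uh q p)

end Triangulation

end ROF

end

open ROF

namespace ROF

variable {d : ℕ} {Ω : Opens (E d)}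

/-! ### Geometry of the domain and of the triangulation -/

/-! Write `v = u_h`, `p = div q`, `g_h = Π_h g`, and let `a` be the gradient part of `η²`. Comparing
`u` with points of the segment from `u` to `v` gives the variational inequality `α ∫ (g - u)(v - u)
≤ |Dv|(Ω) - |Du|(Ω)`. Weak duality gives `-∫ u p ≤ |Du|(Ω)`, and Green's formula for `v` gives `a =
|Dv|(Ω) + ∫ v p`, because `∇v` is elementwise constant and so `Π_h q` may be replaced by `q`.
Together with Cauchy-Schwarz these yield `α x² ≤ a + R x + α G x` for `x = ‖v - u‖`, `R = ‖p - α (v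
- g_h)‖`, `G = ‖g - g_h‖`. Since `η² = a + R²/(2α)`, an elementary estimate
(`le_add_of_quadratic_le`) finishes; no minimizer for the data `g_h` is needed. The gap identity is
the same Green formula plus the expansion of a square. Nonnegativity on elements holds because
averaging preserves `|q| ≤ 1`.

The analytic core is weak duality (`neg_integral_mul_le_totalVariation`): `q` is only an `L²` field
with `L²` divergence, whereas `|Du|(Ω)` is tested with smooth compactly supported fields. A field
with zero normal trace on all of `∂Ω`, extended by zero, has a divergence without boundary part.
Localizing it, translating the pieces into `Ω` and mollifying gives test fields of norm at most `1 +
ε` (`exists_testFunction_approx`).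

On `Γ_D` the field `q` has no vanishing normal trace; there the zero trace of the scalar function
must help. `exists_cutoff` supplies `χ`, zero near `Γ_D`, with `∫ |w| |∇χ|` small for bounded `w` of
zero trace. Then `χ q` falls under the first case, and the extra term `∇χ · q` in its divergence is
harmless against `w` (`exists_testFunction_approx_of_zeroTrace`). Boundedness is removed by smooth
truncation, which does not increase the total variation (`totalVariation_comp_le`). The same
approximation proves Green's formula for `v` and `q`; `totalVariation_eq` identifies `|Dv|(Ω)` with
`∫ |∇v|`. -/

lemma IsBoundedLipschitzDomain.interior_closure (hΩ : IsBoundedLipschitzDomain Ω) :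
    interior (closure (Ω : Set (E d))) = Ω := by
  refine Subset.antisymm (fun x hx => ?_) (Ω.isOpen.subset_interior_iff.2 subset_closure)
  by_contra hxΩ
  have hfr : x ∈ frontier (Ω : Set (E d)) := by
    rw [Ω.isOpen.frontier_eq]
    exact ⟨interior_subset hx, hxΩ⟩
  obtain ⟨U, e, γ, C, hU, hxU, he, hγ, hUΩ⟩ := hΩ.lipschitz_boundary x hfr
  have hee : ⟪e, e⟫ = 1 := by rw [real_inner_self_eq_norm_sq, he]; norm_num
  have hx1 : ⟪e, x⟫ ≤ γ (x - ⟪e, x⟫ • e) := not_lt.1 fun h => hxΩ ((hUΩ x hxU).2 h)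
  have hcont : Continuous fun t : ℝ => x - t • e := by fun_prop
  have h0 : ∀ᶠ t in 𝓝 (0 : ℝ), x - t • e ∈ U ∩ interior (closure (Ω : Set (E d))) := by
    refine hcont.continuousAt.eventually_mem ?_
    simpa using (hU.inter isOpen_interior).mem_nhds ⟨hxU, hx⟩
  obtain ⟨ε, hε, hball⟩ := Metric.eventually_nhds_iff.1 h0
  have ht : x - (ε / 2) • e ∈ U ∩ interior (closure (Ω : Set (E d))) := by
    apply hball
    simp [abs_of_pos hε, hε]
  -- The strict subgraph is open and misses `Ω`, hence also misses `closure Ω`. Moving `x` against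
  -- `e` lands in it without leaving the interior of the closure. So a Lipschitz boundary has no
  -- slits.
  have hV : IsOpen (U ∩ {y | ⟪e, y⟫ < γ (y - ⟪e, y⟫ • e)}) :=
    hU.inter (isOpen_lt (by fun_prop) (hγ.continuous.comp (by fun_prop)))
  have hyV : x - (ε / 2) • e ∈ U ∩ {y | ⟪e, y⟫ < γ (y - ⟪e, y⟫ • e)} := by
    refine ⟨ht.1, ?_⟩
    have h1 : ⟪e, x - (ε / 2) • e⟫ = ⟪e, x⟫ - ε / 2 := by
      rw [inner_sub_right, inner_smul_right, hee, mul_one]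
    have h2 : x - (ε / 2) • e - ⟪e, x - (ε / 2) • e⟫ • e = x - ⟪e, x⟫ • e := by
      rw [h1]; module
    rw [mem_ofPred_eq, h2, h1]; linarith
  obtain ⟨z, ⟨hzU, hz⟩, hzΩ⟩ := mem_closure_iff.1 (interior_subset ht.2) _ hV hyV
  exact lt_asymm hz ((hUΩ z hzU).1 hzΩ)

namespace Triangulation

variable (𝒯 : Triangulation Ω) {T T' : Finset (E d)}

lemma mem_elements : T ∈ 𝒯.elements ↔ T ∈ 𝒯.complex.faces ∧ T.card = d + 1 := by
  simp [elements]

lemma closure_eq_biUnion :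
    closure (Ω : Set (E d)) = ⋃ T ∈ 𝒯.elements, convexHull ℝ (T : Set (E d)) := by
  rw [← 𝒯.space_eq]
  refine Subset.antisymm (fun x hx => ?_) (iUnion₂_subset fun T hT =>
    Geometry.SimplicialComplex.convexHull_subset_space ((𝒯.mem_elements).1 hT).1)
  obtain ⟨s, hs, hxs⟩ := Geometry.SimplicialComplex.mem_space_iff.1 hx
  obtain ⟨t, ht, hst, hcard⟩ := 𝒯.pure s hs
  exact mem_iUnion₂.2 ⟨t, (𝒯.mem_elements).2 ⟨ht, hcard⟩,
    convexHull_mono (Finset.coe_subset.2 hst) hxs⟩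

lemma convexHull_subset_closure (hT : T ∈ 𝒯.elements) :
    convexHull ℝ (T : Set (E d)) ⊆ closure (Ω : Set (E d)) := by
  rw [𝒯.closure_eq_biUnion]
  exact subset_biUnion_of_mem (u := fun T : Finset (E d) => convexHull ℝ (T : Set (E d))) hT

lemma isCompact_convexHull (T : Finset (E d)) : IsCompact (convexHull ℝ (T : Set (E d))) :=
  T.finite_toSet.isCompact_convexHull ℝ

lemma interior_subset_domain (hΩ : IsBoundedLipschitzDomain Ω) (hT : T ∈ 𝒯.elements) :
    interior (convexHull ℝ (T : Set (E d))) ⊆ Ω := by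
  rw [← hΩ.interior_closure]
  exact interior_mono (𝒯.convexHull_subset_closure hT)

lemma volume_convexHull_eq_zero {s : Finset (E d)} (hs : s.card ≤ d) :
    volume (convexHull ℝ (s : Set (E d))) = 0 := by
  refine measure_mono_null (convexHull_subset_affineSpan _)
    (Measure.addHaar_affineSubspace _ _ fun htop => ?_)
  have hne : s.Nonempty := by
    by_contra h
    rw [Finset.not_nonempty_iff_eq_empty] at h
    subst h
    simp at htop
  have h1 := finrank_vectorSpan_image_finset_le ℝ (id : E d → E d) s (n := s.card - 1)
    (by have := hne.card_pos; omega)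
  have h2 : vectorSpan ℝ (s : Set (E d)) = ⊤ := by
    rw [← direction_affineSpan, htop, AffineSubspace.direction_top]
  rw [Finset.image_id] at h1
  rw [h2, finrank_top, finrank_euclideanSpace_fin] at h1
  have := hne.card_pos
  omega

lemma interior_ae_eq (T : Finset (E d)) :
    (interior (convexHull ℝ (T : Set (E d))) : Set (E d)) =ᵐ[volume]
      convexHull ℝ (T : Set (E d)) :=
  interior_ae_eq_of_null_frontier ((convex_convexHull ℝ _).addHaar_frontier _)

/-- By conformity two distinct elements meet within the hull of their common vertices. There are at
most `d` of these, so the intersection of the interiors is an open null set and therefore empty. -/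
lemma disjoint_interior (hT : T ∈ 𝒯.elements) (hT' : T' ∈ 𝒯.elements) (hne : T ≠ T') :
    Disjoint (interior (convexHull ℝ (T : Set (E d))))
      (interior (convexHull ℝ (T' : Set (E d)))) := by
  classical
  rw [mem_elements] at hT hT'
  rw [Set.disjoint_iff_inter_eq_empty]
  refine ((isOpen_interior.inter isOpen_interior).measure_eq_zero_iff (volume : Measure (E d))).1
    (measure_mono_null (inter_subset_inter interior_subset interior_subset) ?_)
  refine measure_mono_null (𝒯.complex.inter_subset_convexHull hT.1 hT'.1) ?_
  rw [← Finset.coe_inter]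
  refine volume_convexHull_eq_zero (Nat.lt_succ_iff.1 ?_)
  rw [Nat.succ_eq_add_one, ← hT.2]
  refine Finset.card_lt_card (Finset.ssubset_iff_subset_ne.2 ⟨Finset.inter_subset_left, fun h => ?_⟩)
  exact hne (Finset.eq_of_subset_of_card_le (Finset.inter_eq_left.1 h) (by rw [hT.2, hT'.2]))

lemma ae_eq_biUnion_interior (hΩ : IsBoundedLipschitzDomain Ω) :
    (Ω : Set (E d)) =ᵐ[volume]
      (⋃ T ∈ 𝒯.elements, interior (convexHull ℝ (T : Set (E d))) : Set (E d)) := by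
  have hle : (⋃ T ∈ 𝒯.elements, interior (convexHull ℝ (T : Set (E d))) : Set (E d)) ⊆ Ω :=
    iUnion₂_subset fun T hT => 𝒯.interior_subset_domain hΩ hT
  have h0 : volume (⋃ T ∈ 𝒯.elements, frontier (convexHull ℝ (T : Set (E d)))) = 0 :=
    (measure_biUnion_null_iff (s := fun T : Finset (E d) => frontier (convexHull ℝ (T : Set (E d))))
      𝒯.elements.countable_toSet).2 fun T _ => (convex_convexHull ℝ _).addHaar_frontier _
  refine (ae_eq_set.2 ⟨measure_mono_null (fun x hx => ?_) h0, ?_⟩)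
  · have hx' := subset_closure hx.1
    rw [𝒯.closure_eq_biUnion] at hx'
    obtain ⟨T, hT, hxT⟩ := mem_iUnion₂.1 hx'
    refine mem_iUnion₂.2 ⟨T, hT, subset_closure hxT, fun h => hx.2 (mem_iUnion₂.2 ⟨T, hT, h⟩)⟩
  · rw [sdiff_eq_empty.2 hle, measure_empty]

/-- Elements overlap only in frontiers, which are null by convexity; passing to interiors makes the
union disjoint. -/
lemma integral_eq_sum {F : Type*} [NormedAddCommGroup F] [NormedSpace ℝ F]
    (hΩ : IsBoundedLipschitzDomain Ω) {f : E d → F} (hf : IntegrableOn f Ω) :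
    ∫ x in (Ω : Set (E d)), f x = ∑ T ∈ 𝒯.elements, ∫ x in convexHull ℝ (T : Set (E d)), f x := by
  rw [setIntegral_congr_set (𝒯.ae_eq_biUnion_interior hΩ), integral_biUnion_finset]
  · exact Finset.sum_congr rfl fun T _ => setIntegral_congr_set (interior_ae_eq T)
  · exact fun T _ => measurableSet_interior
  · exact fun T hT T' hT' hne => 𝒯.disjoint_interior hT hT' hne
  · exact fun T hT => hf.mono_set (𝒯.interior_subset_domain hΩ hT)

lemma ae_mem_interior (hΩ : IsBoundedLipschitzDomain Ω) :
    ∀ᵐ x ∂(volume.restrict (Ω : Set (E d))),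
      ∃ T ∈ 𝒯.elements, x ∈ interior (convexHull ℝ (T : Set (E d))) := by
  rw [Measure.restrict_congr_set (𝒯.ae_eq_biUnion_interior hΩ)]
  have hm : MeasurableSet (⋃ T ∈ 𝒯.elements, interior (convexHull ℝ (T : Set (E d)))) :=
    𝒯.elements.measurableSet_biUnion fun T _ => measurableSet_interior
  filter_upwards [ae_restrict_mem hm] with x hx
  simpa using hx

lemma proj_apply {F : Type*} [NormedAddCommGroup F] [NormedSpace ℝ F] (f : E d → F)
    (hT : T ∈ 𝒯.elements) {x : E d} (hx : x ∈ interior (convexHull ℝ (T : Set (E d)))) :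
    𝒯.proj f x = ⨍ y in convexHull ℝ (T : Set (E d)), f y := by
  rw [proj, Finset.sum_eq_single_of_mem T hT, indicator_of_mem hx]
  exact fun T' hT' hne => indicator_of_notMem
    (fun hx' => (𝒯.disjoint_interior hT' hT hne).ne_of_mem hx' hx rfl) _

end Triangulation

end ROF

section

open ContinuousLinearMap
open scoped Convolution

namespace ROF

variable {d : ℕ} {F : Type*} [NormedAddCommGroup F] [NormedSpace ℝ F]

/-! ### Mollification -/

/-- `k` is a smoothing kernel, supported in a ball of radius `δ` about the origin. -/
structure IsMollifier (k : E d → ℝ) (δ : ℝ) : Prop where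
  contDiff : ContDiff ℝ (⊤ : ℕ∞) k
  nonneg : ∀ x, 0 ≤ k x
  integral_eq_one : ∫ x, k x = 1
  support_subset : Function.support k ⊆ ball 0 δ

/-- The mollification `k ⋆ f`. -/
noncomputable def mollify (k : E d → ℝ) (f : E d → F) : E d → F := k ⋆[lsmul ℝ ℝ, volume] f

lemma mollify_apply (k : E d → ℝ) (f : E d → F) (x : E d) :
    mollify k f x = ∫ y, k (x - y) • f y := convolution_lsmul_swap

variable {k : E d → ℝ} {δ : ℝ} {f : E d → F}

namespace IsMollifier

/-- The centre `c` may differ from the origin: an off-centre kernel translates and mollifies at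
once, and this is how supports are later pushed into `Ω`. -/
lemma normed {c : E d} (b : ContDiffBump c) (h : ‖c‖ + b.rOut ≤ δ) :
    IsMollifier (b.normed volume) δ where
  contDiff := b.contDiff_normed
  nonneg := b.nonneg_normed
  integral_eq_one := b.integral_normed
  support_subset := by
    rw [b.support_normed_eq]
    exact ball_subset_ball' (by rw [dist_zero_right]; linarith)

lemma hasCompactSupport (hk : IsMollifier k δ) : HasCompactSupport k :=
  HasCompactSupport.of_support_subset_isCompact (isCompact_closedBall 0 δ)
    (hk.support_subset.trans ball_subset_closedBall)

lemma continuous (hk : IsMollifier k δ) : Continuous k := hk.contDiff.continuous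

lemma integrable (hk : IsMollifier k δ) : Integrable k :=
  hk.continuous.integrable_of_hasCompactSupport hk.hasCompactSupport

lemma contDiff_mollify (hk : IsMollifier k δ) (hf : LocallyIntegrable f) : ContDiff ℝ (⊤ : ℕ∞) (mollify k f) :=
  hk.hasCompactSupport.contDiff_convolution_left _ hk.contDiff hf

lemma integrable_mollify (hk : IsMollifier k δ) (hf : Integrable f) : Integrable (mollify k f) :=
  hk.integrable.integrable_convolution _ hf

lemma integrable_smul (hk : IsMollifier k δ) (hf : LocallyIntegrable f) (x : E d) :
    Integrable fun y => k (x - y) • f y := by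
  have := (hk.hasCompactSupport.convolutionExists_left (lsmul ℝ ℝ) hk.continuous hf) x
  exact this.integrable_swap

lemma mollify_sub (hk : IsMollifier k δ) {g : E d → F} (hf : LocallyIntegrable f) (hg : LocallyIntegrable g) :
    mollify k (f - g) = mollify k f - mollify k g := by
  ext x
  simp only [mollify_apply, Pi.sub_apply, smul_sub]
  exact integral_sub (hk.integrable_smul hf x) (hk.integrable_smul hg x)

lemma norm_mollify_le (hk : IsMollifier k δ) {h : E d → ℝ} (hh : LocallyIntegrable h) (hfh : ∀ᵐ y, ‖f y‖ ≤ h y)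
    (x : E d) : ‖mollify k f x‖ ≤ mollify k h x := by
  rw [mollify_apply, mollify_apply]
  refine norm_integral_le_of_norm_le (hk.integrable_smul hh x) (hfh.mono fun y hy => ?_)
  rw [norm_smul, Real.norm_of_nonneg (hk.nonneg _), smul_eq_mul]
  exact mul_le_mul_of_nonneg_left hy (hk.nonneg _)

lemma integral_norm_mollify_le (hk : IsMollifier k δ) (hf : Integrable f) : ∫ x, ‖mollify k f x‖ ≤ ∫ x, ‖f x‖ := by
  calc ∫ x, ‖mollify k f x‖ ≤ ∫ x, mollify k (fun y => ‖f y‖) x :=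
        integral_mono (hk.integrable_mollify hf).norm (hk.integrable_mollify hf.norm)
          fun x => hk.norm_mollify_le hf.norm.locallyIntegrable (Eventually.of_forall fun _ => le_rfl) x
    _ = ∫ x, ‖f x‖ := by
        rw [mollify, integral_convolution _ hk.integrable hf.norm, hk.integral_eq_one]
        simp

lemma norm_mollify_sub_le (hk : IsMollifier k δ) [CompleteSpace F] {ε : ℝ} (hε : 0 ≤ ε) (hf : AEStronglyMeasurable f) {x : E d}
    (h : ∀ y ∈ ball x δ, ‖f y - f x‖ ≤ ε) : ‖mollify k f x - f x‖ ≤ ε := by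
  have := dist_convolution_le (μ := (volume : Measure (E d))) hε hk.support_subset hk.nonneg
    hk.integral_eq_one hf (x₀ := x) (z₀ := f x) (fun y hy => by simpa [dist_eq_norm] using h y hy)
  simpa [dist_eq_norm, mollify] using this

lemma mollify_eq_zero (hk : IsMollifier k δ) {x : E d} (h : ∀ y ∈ ball x δ, f y = 0) : mollify k f x = 0 := by
  rw [mollify_apply]
  refine integral_eq_zero_of_ae (Eventually.of_forall fun y => ?_)
  by_cases hy : y ∈ ball x δ
  · simp [h y hy]
  · have : k (x - y) = 0 := by
      by_contra hne
      have := hk.support_subset hne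
      exact hy (by rwa [mem_ball_zero_iff, ← dist_eq_norm, dist_comm] at this)
    simp [this]

end IsMollifier

/-- Mollification contracts `L¹`, so it is enough to treat a continuous compactly supported `g`,
where uniform continuity gives the estimate. The radius `δ` serves every kernel supported in the
ball, so kernels can be chosen after it. -/
lemma exists_integral_mollify_sub_le [CompleteSpace F] (hf : Integrable f) {ε : ℝ} (hε : 0 < ε) :
    ∃ δ > 0, ∀ k : E d → ℝ, IsMollifier k δ → ∫ x, ‖mollify k f x - f x‖ ≤ ε := by
  obtain ⟨g, hgc, hfg, hg, hgi⟩ := hf.exists_hasCompactSupport_integral_sub_le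
    (show (0 : ℝ) < ε / 3 by positivity)
  -- Off this set both `g` and its mollification vanish, provided that the radius is at most `1`.
  set K : Set (E d) := cthickening 1 (tsupport g) with hK
  have hKc : IsCompact K := hgc.isCompact.cthickening
  set V : ℝ := volume.real K
  have hV : 0 ≤ V := measureReal_nonneg
  have hη : 0 < ε / 3 / (V + 1) := by positivity
  obtain ⟨δ, hδ, hunif⟩ := Metric.uniformContinuous_iff.1
    (hgc.uniformContinuous_of_continuous hg) _ hη
  refine ⟨min δ 1, by positivity, fun k hk => ?_⟩
  have h1 : ∀ x, ‖mollify k g x - g x‖ ≤ K.indicator (fun _ => ε / 3 / (V + 1)) x := by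
    intro x
    by_cases hx : x ∈ K
    · rw [indicator_of_mem hx]
      refine hk.norm_mollify_sub_le hη.le hg.aestronglyMeasurable fun y hy => ?_
      rw [← dist_eq_norm]
      exact (hunif (lt_of_lt_of_le (mem_ball.1 hy) (min_le_left _ _))).le
    · rw [indicator_of_notMem hx]
      have h0 : ∀ y ∈ ball x (min δ 1), g y = 0 := by
        intro y hy
        by_contra hne
        refine hx (mem_cthickening_of_dist_le x y 1 _ (subset_tsupport _ hne) ?_)
        rw [dist_comm]
        exact ((mem_ball.1 hy).trans_le (min_le_right _ _)).le
      rw [hk.mollify_eq_zero h0, h0 x (mem_ball_self (by positivity))]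
      simp
  have h2 : ∫ x, ‖mollify k g x - g x‖ ≤ ε / 3 := by
    calc _ ≤ ∫ x, K.indicator (fun _ => ε / 3 / (V + 1)) x :=
          integral_mono ((hk.integrable_mollify hgi).sub hgi).norm
            ((integrable_indicator_iff hKc.measurableSet).2
              (integrableOn_const hKc.measure_lt_top.ne)) h1
      _ = V * (ε / 3 / (V + 1)) := by
          rw [integral_indicator_const _ hKc.measurableSet, smul_eq_mul]
      _ ≤ ε / 3 := by
          rw [mul_div_assoc', div_le_iff₀ (by positivity)]
          nlinarith
  have h3 : ∫ x, ‖mollify k (f - g) x‖ ≤ ε / 3 :=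
    (hk.integral_norm_mollify_le (hf.sub hgi)).trans hfg
  have i1 := (hk.integrable_mollify (hf.sub hgi)).norm
  have i2 : Integrable fun x => ‖mollify k g x - g x‖ := ((hk.integrable_mollify hgi).sub hgi).norm
  have i3 : Integrable fun x => ‖f x - g x‖ := (hf.sub hgi).norm
  calc ∫ x, ‖mollify k f x - f x‖
      ≤ ∫ x, (‖mollify k (f - g) x‖ + ‖mollify k g x - g x‖ + ‖f x - g x‖) := by
        refine integral_mono ((hk.integrable_mollify hf).sub hf).norm ((i1.add i2).add i3)
          fun x => ?_
        rw [hk.mollify_sub hf.locallyIntegrable hgi.locallyIntegrable]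
        have : mollify k f x - f x = (mollify k f - mollify k g) x + (mollify k g x - g x)
          - (f x - g x) := by simp
        simp only [this]
        exact (norm_sub_le _ _).trans (by gcongr; exact norm_add_le _ _)
    _ = (∫ x, ‖mollify k (f - g) x‖) + (∫ x, ‖mollify k g x - g x‖) + ∫ x, ‖f x - g x‖ := by
        exact (integral_add (i1.add i2) i3).trans (congrArg (· + _) (integral_add i1 i2))
    _ ≤ ε := by linarith

lemma IsMollifier.fderiv_mollify_apply [CompleteSpace F] (hk : IsMollifier k δ)
    (hf : LocallyIntegrable f) (x v : E d) :
    Integrable (fun y => (fderiv ℝ k (x - y) v) • f y) ∧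
      fderiv ℝ (mollify k f) x v = ∫ y, (fderiv ℝ k (x - y) v) • f y := by
  have hcs : HasCompactSupport (fderiv ℝ k) := hk.hasCompactSupport.fderiv (𝕜 := ℝ)
  have hcont : Continuous (fderiv ℝ k) := hk.contDiff.continuous_fderiv (by simp)
  have hder := hk.hasCompactSupport.hasFDerivAt_convolution_left (lsmul ℝ ℝ)
    (hk.contDiff.of_le (by norm_cast)) hf x
  have hint : Integrable fun y => (lsmul ℝ ℝ).precompL (E d) (fderiv ℝ k (x - y)) (f y) :=
    ((hcs.convolutionExists_left ((lsmul ℝ ℝ : ℝ →L[ℝ] F →L[ℝ] F).precompL (E d)) hcont hf)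
      x).integrable_swap
  constructor
  · exact (ContinuousLinearMap.apply ℝ F v).integrable_comp hint
  · rw [mollify, hder.fderiv, convolution_eq_swap, ContinuousLinearMap.integral_apply hint]
    simp only [precompL_apply, lsmul_apply]

lemma gradient_apply (f : E d → ℝ) (x : E d) (i : Fin d) :
    (∇ f x) i = fderiv ℝ f x (EuclideanSpace.single i 1) := by
  rw [← inner_gradient_left, EuclideanSpace.inner_single_right]
  simp

/-- All derivatives fall on the kernel, so `q` needs no regularity; the right-hand side is what a
weak divergence can be tested against. -/
lemma IsMollifier.divergence_mollify (hk : IsMollifier k δ) {q : E d → E d}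
    (hq : LocallyIntegrable q) (x : E d) :
    divergence (mollify k q) x = ∫ y, ⟪q y, ∇ k (x - y)⟫ := by
  have hint : ∀ i : Fin d, Integrable fun y =>
      (fderiv ℝ k (x - y) (EuclideanSpace.single i 1)) * q y i := fun i =>
    (EuclideanSpace.proj (𝕜 := ℝ) i).integrable_comp (hk.fderiv_mollify_apply hq x _).1
  have hcomp : ∀ i : Fin d, (fderiv ℝ (mollify k q) x (EuclideanSpace.single i 1)) i
      = ∫ y, (fderiv ℝ k (x - y) (EuclideanSpace.single i 1)) * q y i := by
    intro i
    rw [(hk.fderiv_mollify_apply hq x _).2]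
    exact ((EuclideanSpace.proj (𝕜 := ℝ) i).integral_comp_comm
      (hk.fderiv_mollify_apply hq x _).1).symm
  simp_rw [divergence, hcomp]
  rw [← integral_finsetSum _ fun i _ => hint i]
  congr 1
  ext y
  rw [PiLp.inner_apply]
  refine Finset.sum_congr rfl fun i _ => ?_
  rw [gradient_apply]
  simp

end ROF

end

namespace ROF

variable {d : ℕ} {Ω : Opens (E d)}

/-! ### Pushing the closure of a Lipschitz domain inward -/

lemma IsBoundedLipschitzDomain.exists_inward_direction (hΩ : IsBoundedLipschitzDomain Ω) {x : E d}
    (hx : x ∈ closure (Ω : Set (E d))) :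
    ∃ (U : Set (E d)) (e : E d), IsOpen U ∧ x ∈ U ∧ ∀ K ⊆ U, IsCompact K →
      ∃ t₀ > 0, ∀ t ∈ Ioo (0 : ℝ) t₀, ∀ y ∈ K ∩ closure (Ω : Set (E d)), y + t • e ∈ Ω := by
  by_cases hxΩ : x ∈ Ω
  -- Points of `Ω` need no translation.
  · exact ⟨Ω, 0, Ω.isOpen, hxΩ, fun K hK _ => ⟨1, one_pos, fun t _ y hy => by simpa using hK hy.1⟩⟩
  have hfr : x ∈ frontier (Ω : Set (E d)) := by
    rw [Ω.isOpen.frontier_eq]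
    exact ⟨hx, hxΩ⟩
  obtain ⟨U, e, γ, C, hU, hxU, he, hγ, hUΩ⟩ := hΩ.lipschitz_boundary x hfr
  have hee : ⟪e, e⟫ = 1 := by rw [real_inner_self_eq_norm_sq, he]; norm_num
  -- The region strictly below the graph is open and misses `Ω`, so `closure Ω` lies on or above the
  -- graph; any positive shift along `e` then lands strictly above it.
  have hle : ∀ y ∈ U ∩ closure (Ω : Set (E d)), γ (y - ⟪e, y⟫ • e) ≤ ⟪e, y⟫ := by
    rintro y ⟨hyU, hyΩ⟩
    by_contra hlt
    have hV : IsOpen (U ∩ {y | ⟪e, y⟫ < γ (y - ⟪e, y⟫ • e)}) :=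
      hU.inter (isOpen_lt (by fun_prop) (hγ.continuous.comp (by fun_prop)))
    obtain ⟨z, ⟨hzU, hz⟩, hzΩ⟩ := mem_closure_iff.1 hyΩ _ hV ⟨hyU, not_le.1 hlt⟩
    exact lt_asymm hz ((hUΩ z hzU).1 hzΩ)
  refine ⟨U, e, hU, hxU, fun K hKU hK => ?_⟩
  obtain ⟨δ, hδ, hKδ⟩ := hK.exists_thickening_subset_open hU hKU
  refine ⟨δ, hδ, fun t ht y hy => ?_⟩
  have hyU : y + t • e ∈ U := by
    refine hKδ (mem_thickening_iff.2 ⟨y, hy.1, ?_⟩)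
    rw [dist_eq_norm, add_sub_cancel_left, norm_smul, he, mul_one, Real.norm_of_nonneg ht.1.le]
    exact ht.2
  refine (hUΩ _ hyU).2 ?_
  have h1 : ⟪e, y + t • e⟫ = ⟪e, y⟫ + t := by
    rw [inner_add_right, inner_smul_right, hee, mul_one]
  have h2 : y + t • e - ⟪e, y + t • e⟫ • e = y - ⟪e, y⟫ • e := by rw [h1]; module
  rw [h2, h1]
  have := hle y ⟨hKU hy.1, hy.2⟩
  have := ht.1
  linarith

/-- A smooth partition of unity on `closure Ω` together with directions pushing the supports into
`Ω`. -/
lemma IsBoundedLipschitzDomain.exists_partition (hΩ : IsBoundedLipschitzDomain Ω) :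
    ∃ (ι : Type) (_ : Fintype ι) (ψ : ι → E d → ℝ) (e : ι → E d),
      (∀ i, ContDiff ℝ (⊤ : ℕ∞) (ψ i)) ∧ (∀ i, HasCompactSupport (ψ i)) ∧ (∀ i x, 0 ≤ ψ i x) ∧
      (∀ x, ∑ i, ψ i x ≤ 1) ∧ (∀ x ∈ closure (Ω : Set (E d)), ∑ i, ψ i x = 1) ∧
      ∃ t₀ > 0, ∀ t ∈ Ioo (0 : ℝ) t₀, ∀ i, ∀ y ∈ tsupport (ψ i) ∩ closure (Ω : Set (E d)),
        y + t • e i ∈ Ω := by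
  have hc : IsCompact (closure (Ω : Set (E d))) := hΩ.bounded.isCompact_closure
  choose! U e hU hxU hpush using fun x (hx : x ∈ closure (Ω : Set (E d))) =>
    hΩ.exists_inward_direction hx
  -- The unit balls only serve to make the supports of the partition compact.
  obtain ⟨s, hs, hcov⟩ := hc.elim_nhds_subcover (fun x => U x ∩ ball x 1) fun x hx =>
    ((hU x hx).inter isOpen_ball).mem_nhds ⟨hxU x hx, mem_ball_self one_pos⟩
  let g : Fin s.card → E d := fun i => (s.equivFin.symm i : E d)
  have hg : ∀ i, g i ∈ closure (Ω : Set (E d)) := fun i => hs _ (s.equivFin.symm i).2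
  obtain ⟨ψ, hψ⟩ := SmoothPartitionOfUnity.exists_isSubordinate (modelWithCornersSelf ℝ (E d))
    hc.isClosed (fun i : Fin s.card => U (g i) ∩ ball (g i) 1)
    (fun i => (hU _ (hg i)).inter isOpen_ball) (fun x hx => by
      obtain ⟨z, hz, hxz⟩ := mem_iUnion₂.1 (hcov hx)
      refine mem_iUnion.2 ⟨s.equivFin ⟨z, hz⟩, ?_⟩
      simpa [g] using hxz)
  have hcs : ∀ i, HasCompactSupport (ψ i) := fun i =>
    HasCompactSupport.of_support_subset_isCompact (isCompact_closedBall (g i) 1)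
      ((subset_tsupport _).trans ((hψ i).trans (inter_subset_right.trans ball_subset_closedBall)))
  refine ⟨Fin s.card, inferInstance, fun i => ψ i, fun i => e (g i), fun i => (ψ i).contMDiff.contDiff,
    hcs, fun i x => ψ.nonneg i x, fun x => ?_, fun x hx => ?_, ?_⟩
  · simpa [finsum_eq_sum_of_fintype] using ψ.sum_le_one x
  · simpa [finsum_eq_sum_of_fintype] using ψ.sum_eq_one hx
  · choose t₀ ht₀ ht using fun i => hpush (g i) (hg i) (tsupport (ψ i))
      ((hψ i).trans inter_subset_left) (hcs i).isCompact
    have hev : ∀ᶠ t in 𝓝[>] (0 : ℝ), ∀ i, t < t₀ i :=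
      eventually_all.2 fun i => (eventually_lt_nhds (ht₀ i)).filter_mono nhdsWithin_le_nhds
    obtain ⟨τ, hτ, hτ'⟩ := (mem_nhdsGT_iff_exists_Ioo_subset).1 hev
    exact ⟨τ, hτ, fun t h i => ht i t ⟨h.1, hτ' h i⟩⟩

/-! ### Calculus of divergences -/

lemma divergence_sum {ι : Type*} (s : Finset ι) {f : ι → E d → E d} {x : E d}
    (hf : ∀ i ∈ s, DifferentiableAt ℝ (f i) x) :
    divergence (fun y => ∑ i ∈ s, f i y) x = ∑ i ∈ s, divergence (f i) x := by
  simp only [divergence]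
  rw [Finset.sum_comm, fderiv_fun_sum hf]
  simp

lemma divergence_const_smul (c : ℝ) (f : E d → E d) (x : E d) :
    divergence (fun y => c • f y) x = c * divergence f x := by
  simp only [divergence, Finset.mul_sum]
  rw [show (fun y => c • f y) = c • f from rfl, fderiv_const_smul_field]
  simp

lemma gradient_mul {f g : E d → ℝ} {x : E d} (hf : DifferentiableAt ℝ f x)
    (hg : DifferentiableAt ℝ g x) :
    ∇ (fun y => f y * g y) x = f x • ∇ g x + g x • ∇ f x := by
  refine ext_inner_right ℝ fun v => ?_
  rw [inner_gradient_left, inner_add_left, real_inner_smul_left, real_inner_smul_left,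
    inner_gradient_left, inner_gradient_left, fderiv_fun_mul hf hg]
  simp

lemma gradient_comp_sub_left {k : E d → ℝ} {x y : E d} (hk : DifferentiableAt ℝ k (x - y)) :
    ∇ (fun z => k (x - z)) y = - ∇ k (x - y) := by
  have h : HasFDerivAt (fun z => k (x - z)) _ y :=
    hk.hasFDerivAt.comp y ((hasFDerivAt_id y).const_sub x)
  refine ext_inner_right ℝ fun v => ?_
  rw [inner_gradient_left, inner_neg_left, inner_gradient_left, h.fderiv]
  simp

lemma continuous_gradient {f : E d → ℝ} (hf : ContDiff ℝ (⊤ : ℕ∞) f) : Continuous (∇ f) :=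
  (InnerProductSpace.toDual ℝ (E d)).symm.continuous.comp (hf.continuous_fderiv (by simp))

lemma continuous_divergence {f : E d → E d} (hf : ContDiff ℝ (⊤ : ℕ∞) f) :
    Continuous (divergence f) := by
  have := hf.continuous_fderiv (by simp)
  unfold divergence
  fun_prop

lemma support_gradient_subset (f : E d → ℝ) : Function.support (∇ f) ⊆ tsupport f := by
  intro x hx
  refine support_fderiv_subset ℝ (f := f) fun h => hx ?_
  simp [gradient, h]

lemma support_divergence_subset (f : E d → E d) : Function.support (divergence f) ⊆ tsupport f := by
  intro x hx
  refine support_fderiv_subset ℝ (f := f) fun h => hx ?_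
  simp [divergence, h]

end ROF

namespace ROF

variable {d : ℕ} {Ω : Opens (E d)}

/-! ### Approximation of fields with vanishing normal trace -/

/-- Green's formula is tested with `y ↦ k (x - y) * ψ y`, which need not vanish on `∂Ω`. Thus the
zero extension of `ψ q` has the distributional divergence `ψ p + ∇ψ · q` on `Ω` and no boundary
part. -/
lemma IsMollifier.divergence_mollify_localized {k : E d → ℝ} {δ : ℝ} (hk : IsMollifier k δ)
    {q : E d → E d} {p : E d → ℝ} (hq : IntegrableOn q Ω) (hp : IntegrableOn p Ω)
    (hgreen : ∀ φ : 𝓓((⊤ : Opens (E d)), ℝ),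
      ∫ x in (Ω : Set (E d)), ⟪q x, ∇ φ x⟫ = -∫ x in (Ω : Set (E d)), p x * φ x)
    {ψ : E d → ℝ} (hψ : ContDiff ℝ (⊤ : ℕ∞) ψ) (hψc : HasCompactSupport ψ) (x : E d) :
    divergence (mollify k ((Ω : Set (E d)).indicator fun y => ψ y • q y)) x =
      mollify k ((Ω : Set (E d)).indicator fun y => ψ y * p y + ⟪∇ ψ y, q y⟫) x := by
  have hΩm : MeasurableSet (Ω : Set (E d)) := Ω.isOpen.measurableSet
  have hkd : ∀ y, DifferentiableAt ℝ k y := hk.contDiff.differentiable (by simp)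
  have hψd : ∀ y, DifferentiableAt ℝ ψ y := hψ.differentiable (by simp)
  obtain ⟨C, hC⟩ := hψ.continuous.bounded_above_of_compact_support hψc
  obtain ⟨C', hC'⟩ := (continuous_gradient hψ).bounded_above_of_compact_support
    (hψc.of_isClosed_subset (isClosed_tsupport _)
      (closure_minimal (support_gradient_subset ψ) (isClosed_tsupport _)))
  have hkx : Continuous fun y => k (x - y) := hk.continuous.comp (by fun_prop)
  obtain ⟨D, hD⟩ := hk.continuous.bounded_above_of_compact_support hk.hasCompactSupport
  have hgk : Continuous fun y => ∇ k (x - y) := (continuous_gradient hk.contDiff).comp (by fun_prop)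
  let φ : 𝓓((⊤ : Opens (E d)), ℝ) :=
    { toFun := fun y => k (x - y) * ψ y
      contDiff' := (hk.contDiff.comp (by fun_prop)).mul hψ
      hasCompactSupport' := hψc.mul_left
      tsupport_subset' := subset_univ _ }
  have hφ : ∀ y, ∇ φ y = k (x - y) • ∇ ψ y - ψ y • ∇ k (x - y) := by
    intro y
    change ∇ (fun y => k (x - y) * ψ y) y = _
    rw [gradient_mul (f := fun y => k (x - y)) ((hkd _).comp y (by fun_prop)) (hψd y),
      gradient_comp_sub_left (hkd _), smul_neg, ← sub_eq_add_neg]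
  have i0 : IntegrableOn (fun y => ψ y • q y) Ω :=
    Integrable.bdd_smul hq C hψ.continuous.aestronglyMeasurable (Eventually.of_forall hC)
  have i1 : IntegrableOn (fun y => ⟪∇ ψ y, q y⟫) Ω := by
    refine (hq.norm.const_mul C').mono'
      ((continuous_gradient hψ).aestronglyMeasurable.inner hq.aestronglyMeasurable)
      (Eventually.of_forall fun y => ?_)
    exact (norm_inner_le_norm _ _).trans (mul_le_mul_of_nonneg_right (hC' y) (norm_nonneg _))
  have i2 : IntegrableOn (fun y => ψ y * p y) Ω :=
    Integrable.bdd_mul hp hψ.continuous.aestronglyMeasurable (Eventually.of_forall hC)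
  have i3 : IntegrableOn (fun y => k (x - y) * ⟪∇ ψ y, q y⟫) Ω :=
    Integrable.bdd_mul i1 hkx.aestronglyMeasurable (Eventually.of_forall fun y => hD (x - y))
  have i4 : IntegrableOn (fun y => k (x - y) * (ψ y * p y)) Ω :=
    Integrable.bdd_mul i2 hkx.aestronglyMeasurable (Eventually.of_forall fun y => hD (x - y))
  obtain ⟨D', hD'⟩ := (continuous_gradient hk.contDiff).bounded_above_of_compact_support
    (hk.hasCompactSupport.of_isClosed_subset (isClosed_tsupport _)
      (closure_minimal (support_gradient_subset k) (isClosed_tsupport _)))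
  have i5 : IntegrableOn (fun y => ⟪ψ y • q y, ∇ k (x - y)⟫) Ω := by
    refine (i0.norm.const_mul D').mono'
      (i0.aestronglyMeasurable.inner hgk.aestronglyMeasurable)
      (Eventually.of_forall fun y => ?_)
    refine (norm_inner_le_norm _ _).trans ?_
    rw [mul_comm]
    exact mul_le_mul_of_nonneg_right (hD' _) (norm_nonneg _)
  rw [hk.divergence_mollify ((integrable_indicator_iff hΩm).2 i0).locallyIntegrable, mollify_apply]
  have e1 : (fun y => ⟪(Ω : Set (E d)).indicator (fun y => ψ y • q y) y, ∇ k (x - y)⟫) =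
      (Ω : Set (E d)).indicator fun y => ⟪ψ y • q y, ∇ k (x - y)⟫ := by
    ext y
    by_cases hy : y ∈ (Ω : Set (E d)) <;> simp [hy]
  have e2 : (fun y => k (x - y) •
        (Ω : Set (E d)).indicator (fun y => ψ y * p y + ⟪∇ ψ y, q y⟫) y) =
      (Ω : Set (E d)).indicator fun y => k (x - y) * (ψ y * p y) + k (x - y) * ⟪∇ ψ y, q y⟫ := by
    ext y
    by_cases hy : y ∈ (Ω : Set (E d)) <;> simp [hy, mul_add]
  rw [e1, e2, integral_indicator hΩm, integral_indicator hΩm, integral_add i4 i3]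
  have h := hgreen φ
  simp_rw [hφ, inner_sub_right, inner_smul_right] at h
  have e3 : ∀ y, ψ y * ⟪q y, ∇ k (x - y)⟫ = ⟪ψ y • q y, ∇ k (x - y)⟫ := fun y => by
    rw [real_inner_smul_left]
  have e4 : ∀ y, k (x - y) * ⟪q y, ∇ ψ y⟫ = k (x - y) * ⟪∇ ψ y, q y⟫ := fun y => by
    rw [real_inner_comm]
  have e5 : ∀ y, p y * φ y = k (x - y) * (ψ y * p y) := fun y => by
    change p y * (k (x - y) * ψ y) = _
    ring
  simp_rw [e3, e4, e5] at h
  rw [integral_sub i3 i5] at h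
  linarith

/-- Each localized piece is convolved with a kernel centred at `t • e i`, which moves its support
into `Ω`. The norm stays below `1 + ε` because the mollified weights `ψ i` exceed the original ones
only slightly and these sum to at most `1`. -/
theorem exists_testFunction_approx (hΩ : IsBoundedLipschitzDomain Ω)
    {q : E d → E d} {p : E d → ℝ} (hq : IntegrableOn q Ω) (hp : IntegrableOn p Ω)
    (hq1 : ∀ᵐ x ∂(volume.restrict (Ω : Set (E d))), ‖q x‖ ≤ 1)
    (hgreen : ∀ φ : 𝓓((⊤ : Opens (E d)), ℝ),
      ∫ x in (Ω : Set (E d)), ⟪q x, ∇ φ x⟫ = -∫ x in (Ω : Set (E d)), p x * φ x)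
    {ε : ℝ} (hε : 0 < ε) :
    ∃ φ : 𝓓(Ω, E d), (∀ x, ‖φ x‖ ≤ 1 + ε) ∧ ∫ x in (Ω : Set (E d)), ‖φ x - q x‖ ≤ ε ∧
      ∫ x in (Ω : Set (E d)), ‖divergence φ x - p x‖ ≤ ε := by
  have hΩm : MeasurableSet (Ω : Set (E d)) := Ω.isOpen.measurableSet
  obtain ⟨ι, _, ψ, e, hψ, hψc, hψ0, hψ1, hψs, t₀, ht₀, hpush⟩ := hΩ.exists_partition
  set F : ι → E d → E d := fun i => (Ω : Set (E d)).indicator fun y => ψ i y • q y with hF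
  set G : ι → E d → ℝ := fun i => (Ω : Set (E d)).indicator
    fun y => ψ i y * p y + ⟪∇ (ψ i) y, q y⟫ with hG
  have hFi : ∀ i, Integrable (F i) := by
    intro i
    obtain ⟨C, hC⟩ := (hψ i).continuous.bounded_above_of_compact_support (hψc i)
    exact (integrable_indicator_iff hΩm).2
      (Integrable.bdd_smul hq C (hψ i).continuous.aestronglyMeasurable (Eventually.of_forall hC))
  have hGi : ∀ i, Integrable (G i) := by
    intro i
    obtain ⟨C, hC⟩ := (hψ i).continuous.bounded_above_of_compact_support (hψc i)
    obtain ⟨C', hC'⟩ := (continuous_gradient (hψ i)).bounded_above_of_compact_support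
      ((hψc i).of_isClosed_subset (isClosed_tsupport _)
        (closure_minimal (support_gradient_subset _) (isClosed_tsupport _)))
    refine (integrable_indicator_iff hΩm).2 (Integrable.add
      (Integrable.bdd_mul hp (hψ i).continuous.aestronglyMeasurable (Eventually.of_forall hC)) ?_)
    refine (hq.norm.const_mul C').mono'
      ((continuous_gradient (hψ i)).aestronglyMeasurable.inner hq.aestronglyMeasurable)
      (Eventually.of_forall fun y => ?_)
    exact (norm_inner_le_norm _ _).trans (mul_le_mul_of_nonneg_right (hC' y) (norm_nonneg _))
  set η : ℝ := ε / (Fintype.card ι + 1) with hη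
  have hη0 : 0 < η := by positivity
  have hηε : Fintype.card ι * η ≤ ε := by
    rw [hη, mul_div_assoc', div_le_iff₀ (by positivity)]
    nlinarith
  -- The three radii control the `L¹` error of the fields, that of their divergences, and the
  -- uniform error of the weights.
  choose δ₁ hδ₁ h₁ using fun i => exists_integral_mollify_sub_le (hFi i) hη0
  choose δ₂ hδ₂ h₂ using fun i => exists_integral_mollify_sub_le (hGi i) hη0
  choose δ₃ hδ₃ h₃ using fun i => Metric.uniformContinuous_iff.1
    ((hψc i).uniformContinuous_of_continuous (hψ i).continuous) η hη0
  have hev : ∀ᶠ t in 𝓝[>] (0 : ℝ), ∀ i, ‖t • e i‖ < min (δ₁ i) (min (δ₂ i) (δ₃ i)) := by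
    refine eventually_all.2 fun i => Eventually.filter_mono nhdsWithin_le_nhds ?_
    have hc : Continuous fun t : ℝ => ‖t • e i‖ := by fun_prop
    refine hc.continuousAt.eventually_lt continuousAt_const ?_
    simp [hδ₁, hδ₂, hδ₃]
  obtain ⟨t, ht, htI⟩ := (hev.and (Ioo_mem_nhdsGT ht₀)).exists
  -- The shift `t` is fixed before the mollification radius `s`: the shifted supports form a compact
  -- subset of `Ω`, and `s` must stay below its distance to the complement.
  set K : Set (E d) := ⋃ i, (fun y => y + t • e i) '' (tsupport (ψ i) ∩ closure (Ω : Set (E d)))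
    with hK
  have hKc : IsCompact K := isCompact_iUnion fun i =>
    ((hψc i).isCompact.inter_right isClosed_closure).image (by fun_prop)
  have hKΩ : K ⊆ Ω := by
    refine iUnion_subset fun i => ?_
    rintro _ ⟨y, hy, rfl⟩
    exact hpush t htI i y hy
  obtain ⟨s₀, hs₀, hsK⟩ := hKc.exists_cthickening_subset_open Ω.isOpen hKΩ
  have hev2 : ∀ᶠ s in 𝓝[>] (0 : ℝ), ∀ i, ‖t • e i‖ + s < min (δ₁ i) (min (δ₂ i) (δ₃ i)) := by
    refine eventually_all.2 fun i => Eventually.filter_mono nhdsWithin_le_nhds ?_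
    have hc : Continuous fun s : ℝ => ‖t • e i‖ + s := by fun_prop
    refine hc.continuousAt.eventually_lt continuousAt_const ?_
    simpa using ht i
  obtain ⟨s, hs, hsI⟩ := (hev2.and (Ioo_mem_nhdsGT hs₀)).exists
  let b : ∀ i, ContDiffBump (t • e i) := fun i => ⟨s / 2, s, half_pos hsI.1, half_lt_self hsI.1⟩
  set k : ι → E d → ℝ := fun i => (b i).normed volume with hkdef
  have hks : ∀ i, Function.support (k i) = ball (t • e i) s := fun i => (b i).support_normed_eq
  have hk : ∀ i r, min (δ₁ i) (min (δ₂ i) (δ₃ i)) ≤ r → IsMollifier (k i) r := fun i r hr =>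
    IsMollifier.normed (b i) ((hs i).le.trans hr)
  have hk₁ : ∀ i, IsMollifier (k i) (δ₁ i) := fun i => hk i _ (min_le_left _ _)
  have hk₂ : ∀ i, IsMollifier (k i) (δ₂ i) := fun i =>
    hk i _ ((min_le_right _ _).trans (min_le_left _ _))
  have hk₃ : ∀ i, IsMollifier (k i) (δ₃ i) := fun i =>
    hk i _ ((min_le_right _ _).trans (min_le_right _ _))
  have hsupp : ∀ i, Function.support (mollify (k i) (F i)) ⊆ cthickening s K := by
    intro i x hx
    by_contra hxK
    refine hx ?_
    rw [mollify_apply]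
    refine integral_eq_zero_of_ae (Eventually.of_forall fun y => ?_)
    by_contra hne
    have hky : k i (x - y) ≠ 0 := fun h => hne (by simp [h])
    have hFy : F i y ≠ 0 := fun h => hne (by simp [h])
    have hyΩ : y ∈ (Ω : Set (E d)) := mem_of_indicator_ne_zero hFy
    have hψy : ψ i y ≠ 0 := fun h => hFy (by simp [hF, h])
    -- The kernel lives near `t • e i`, so `x` is within `s` of the shifted point `y + t • e i` of
    -- `K`.
    have hdist : x - y ∈ ball (t • e i) s := by rw [← hks]; exact hky
    refine hxK (mem_cthickening_of_dist_le x (y + t • e i) s K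
      (mem_iUnion.2 ⟨i, y, ⟨subset_tsupport _ hψy, subset_closure hyΩ⟩, rfl⟩) ?_)
    rw [mem_ball, dist_eq_norm] at hdist
    rw [dist_eq_norm, show x - (y + t • e i) = x - y - t • e i by abel]
    exact hdist.le
  have hKs : IsCompact (cthickening s K) := hKc.cthickening
  have hcd : ∀ i, ContDiff ℝ (⊤ : ℕ∞) (mollify (k i) (F i)) := fun i =>
    (hk₁ i).contDiff_mollify (hFi i).locallyIntegrable
  have hsupp' : Function.support (fun x => ∑ i, mollify (k i) (F i) x) ⊆ cthickening s K := by
    intro x hx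
    obtain ⟨i, -, hi⟩ := Finset.exists_ne_zero_of_sum_ne_zero hx
    exact hsupp i hi
  let φ : 𝓓(Ω, E d) :=
    { toFun := fun x => ∑ i, mollify (k i) (F i) x
      contDiff' := ContDiff.sum fun i _ => hcd i
      hasCompactSupport' := HasCompactSupport.of_support_subset_isCompact hKs hsupp'
      tsupport_subset' := (closure_minimal hsupp' hKs.isClosed).trans
        ((cthickening_mono hsI.2.le K).trans hsK) }
  have hφ : ∀ x, φ x = ∑ i, mollify (k i) (F i) x := fun x => rfl
  refine ⟨φ, fun x => ?_, ?_, ?_⟩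
  · have hFψ : ∀ i, ∀ᵐ y, ‖F i y‖ ≤ ψ i y := by
      intro i
      filter_upwards [(ae_restrict_iff' hΩm).1 hq1] with y hy
      by_cases hyΩ : y ∈ (Ω : Set (E d))
      · simp only [hF, indicator_of_mem hyΩ, norm_smul, Real.norm_of_nonneg (hψ0 i y)]
        exact mul_le_of_le_one_right (hψ0 i y) (hy hyΩ)
      · simpa [hF, hyΩ] using hψ0 i y
    calc ‖φ x‖ ≤ ∑ i, ‖mollify (k i) (F i) x‖ := norm_sum_le _ _
      _ ≤ ∑ i, (ψ i x + η) := by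
          refine Finset.sum_le_sum fun i _ => ?_
          refine ((hk₃ i).norm_mollify_le (hψ i).continuous.locallyIntegrable (hFψ i) x).trans ?_
          have := (hk₃ i).norm_mollify_sub_le hη0.le (hψ i).continuous.aestronglyMeasurable
            (x := x) fun y hy => (h₃ i (mem_ball.1 hy)).le
          rw [Real.norm_eq_abs, abs_le] at this
          linarith
      _ ≤ 1 + ε := by
          rw [Finset.sum_add_distrib, Finset.sum_const, Finset.card_univ, nsmul_eq_mul]
          exact add_le_add (hψ1 x) hηε
  · have hsum : ∀ x ∈ (Ω : Set (E d)), φ x - q x = ∑ i, (mollify (k i) (F i) x - F i x) := by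
      intro x hx
      rw [Finset.sum_sub_distrib, hφ]
      simp only [hF, indicator_of_mem hx, ← Finset.sum_smul, hψs x (subset_closure hx), one_smul]
    have hi : ∀ i, Integrable fun x => ‖mollify (k i) (F i) x - F i x‖ := fun i =>
      (((hk₁ i).integrable_mollify (hFi i)).sub (hFi i)).norm
    calc ∫ x in (Ω : Set (E d)), ‖φ x - q x‖
        ≤ ∫ x in (Ω : Set (E d)), ∑ i, ‖mollify (k i) (F i) x - F i x‖ := by
          refine integral_mono_of_nonneg (Eventually.of_forall fun _ => norm_nonneg _)
            (integrable_finsetSum _ fun i _ => (hi i).integrableOn) ?_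
          filter_upwards [ae_restrict_mem hΩm] with x hx
          rw [hsum x hx]
          exact norm_sum_le _ _
      _ ≤ ∫ x, ∑ i, ‖mollify (k i) (F i) x - F i x‖ :=
          setIntegral_le_integral (integrable_finsetSum _ fun i _ => hi i)
            (Eventually.of_forall fun x => Finset.sum_nonneg fun i _ => norm_nonneg _)
      _ = ∑ i, ∫ x, ‖mollify (k i) (F i) x - F i x‖ := integral_finsetSum _ fun i _ => hi i
      _ ≤ ∑ i : ι, η := Finset.sum_le_sum fun i _ => h₁ i _ (hk₁ i)
      _ ≤ ε := by rwa [Finset.sum_const, Finset.card_univ, nsmul_eq_mul]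
  · have hdiv : ∀ x, divergence φ x = ∑ i, mollify (k i) (G i) x := by
      intro x
      change divergence (fun x => ∑ i, mollify (k i) (F i) x) x = _
      rw [divergence_sum _ fun i _ => (hcd i).differentiable (by simp) x]
      exact Finset.sum_congr rfl fun i _ =>
        (hk₁ i).divergence_mollify_localized hq hp hgreen (hψ i) (hψc i) x
    -- The weights sum to `1` on the open set `Ω`, so the terms `∇ψ · q` cancel and the localized
    -- divergences add up to `p`.
    have hgrad : ∀ x ∈ (Ω : Set (E d)), ∑ i, ∇ (ψ i) x = 0 := by
      intro x hx
      refine ext_inner_right ℝ fun v => ?_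
      rw [sum_inner, inner_zero_left]
      simp only [inner_gradient_left]
      have h1 : fderiv ℝ (fun y => ∑ i, ψ i y) x = 0 := by
        have : (fun y => ∑ i, ψ i y) =ᶠ[𝓝 x] fun _ => 1 := by
          filter_upwards [Ω.isOpen.mem_nhds hx] with y hy using hψs y (subset_closure hy)
        rw [this.fderiv_eq]
        simp
      rw [fderiv_fun_sum fun i _ => (hψ i).differentiable (by simp) x] at h1
      simpa using congrArg (fun L => L v) h1
    have hsum : ∀ x ∈ (Ω : Set (E d)),
        divergence φ x - p x = ∑ i, (mollify (k i) (G i) x - G i x) := by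
      intro x hx
      rw [Finset.sum_sub_distrib, hdiv]
      simp only [hG, indicator_of_mem hx, Finset.sum_add_distrib, ← Finset.sum_mul,
        hψs x (subset_closure hx), one_mul, ← sum_inner, hgrad x hx, inner_zero_left, add_zero]
    have hi : ∀ i, Integrable fun x => ‖mollify (k i) (G i) x - G i x‖ := fun i =>
      (((hk₂ i).integrable_mollify (hGi i)).sub (hGi i)).norm
    calc ∫ x in (Ω : Set (E d)), ‖divergence φ x - p x‖
        ≤ ∫ x in (Ω : Set (E d)), ∑ i, ‖mollify (k i) (G i) x - G i x‖ := by
          refine integral_mono_of_nonneg (Eventually.of_forall fun _ => norm_nonneg _)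
            (integrable_finsetSum _ fun i _ => (hi i).integrableOn) ?_
          filter_upwards [ae_restrict_mem hΩm] with x hx
          rw [hsum x hx]
          exact norm_sum_le _ _
      _ ≤ ∫ x, ∑ i, ‖mollify (k i) (G i) x - G i x‖ :=
          setIntegral_le_integral (integrable_finsetSum _ fun i _ => hi i)
            (Eventually.of_forall fun x => Finset.sum_nonneg fun i _ => norm_nonneg _)
      _ = ∑ i, ∫ x, ‖mollify (k i) (G i) x - G i x‖ := integral_finsetSum _ fun i _ => hi i
      _ ≤ ∑ i : ι, η := Finset.sum_le_sum fun i _ => h₂ i _ (hk₂ i)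
      _ ≤ ε := by rwa [Finset.sum_const, Finset.card_univ, nsmul_eq_mul]

end ROF

namespace ROF

variable {d : ℕ} {Ω : Opens (E d)}

/-! ### The total variation -/

lemma neg_integral_le_totalVariation {v : E d → ℝ} (hv : totalVariation Ω v < ∞) (φ : 𝓓(Ω, E d))
    {c : ℝ} (hc : 0 < c) (hφ : ∀ x, ‖φ x‖ ≤ c) :
    -∫ x in (Ω : Set (E d)), v x * divergence φ x ≤ c * (totalVariation Ω v).toReal := by
  have h1 : ∀ x, ‖(c⁻¹ • φ) x‖ ≤ 1 := by
    intro x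
    rw [show (c⁻¹ • φ) x = c⁻¹ • φ x from rfl, norm_smul, Real.norm_of_nonneg (by positivity), inv_mul_le_one₀ hc]
    exact hφ x
  have h2 : ENNReal.ofReal (-∫ x in (Ω : Set (E d)), v x * divergence (c⁻¹ • φ) x) ≤
      totalVariation Ω v :=
    le_iSup₂_of_le (f := fun (φ : 𝓓(Ω, E d)) (_ : ∀ x, ‖φ x‖ ≤ 1) =>
      ENNReal.ofReal (-∫ x in (Ω : Set (E d)), v x * divergence φ x)) (c⁻¹ • φ) h1 le_rfl
  have h3 : ∀ x, v x * divergence (c⁻¹ • φ) x = c⁻¹ * (v x * divergence φ x) := by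
    intro x
    have : divergence (c⁻¹ • φ) x = c⁻¹ * divergence φ x := divergence_const_smul _ _ _
    rw [this]; ring
  simp_rw [h3] at h2
  rw [integral_const_mul, ENNReal.ofReal_le_iff_le_toReal hv.ne] at h2
  rw [← mul_neg, inv_mul_le_iff₀ hc] at h2
  exact h2

lemma totalVariation_le_ofReal {v : E d → ℝ} {C : ℝ}
    (h : ∀ φ : 𝓓(Ω, E d), (∀ x, ‖φ x‖ ≤ 1) →
      -∫ x in (Ω : Set (E d)), v x * divergence φ x ≤ C) :
    totalVariation Ω v ≤ ENNReal.ofReal C :=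
  iSup₂_le fun φ hφ => ENNReal.ofReal_le_ofReal (h φ hφ)

lemma integrable_divergence {φ : E d → E d} (hφ : ContDiff ℝ (⊤ : ℕ∞) φ)
    (hφc : HasCompactSupport φ) : HasCompactSupport (divergence φ) ∧ Integrable (divergence φ) := by
  have h : HasCompactSupport (divergence φ) := hφc.of_isClosed_subset (isClosed_tsupport _)
    (closure_minimal (support_divergence_subset φ) (isClosed_tsupport _))
  exact ⟨h, (continuous_divergence hφ).integrable_of_hasCompactSupport h⟩

lemma integral_mul_divergence {f : E d → ℝ} (hf : ContDiff ℝ (⊤ : ℕ∞) f) {φ : E d → E d}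
    (hφ : ContDiff ℝ (⊤ : ℕ∞) φ) (hφc : HasCompactSupport φ) :
    ∫ x, f x * divergence φ x = -∫ x, ⟪∇ f x, φ x⟫ := by
  have hφi : ∀ i : Fin d, ContDiff ℝ (⊤ : ℕ∞) fun x => φ x i := fun i =>
    (EuclideanSpace.proj (𝕜 := ℝ) i).contDiff.comp hφ
  have hφic : ∀ i : Fin d, HasCompactSupport fun x => φ x i := fun i =>
    hφc.comp_left (g := fun y : E d => y i) rfl
  have hder : ∀ (i : Fin d) x v, fderiv ℝ (fun x => φ x i) x v = (fderiv ℝ φ x v) i := by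
    intro i x v
    have h : HasFDerivAt (fun x => φ x i) _ x :=
      (EuclideanSpace.proj (𝕜 := ℝ) i).hasFDerivAt.comp x
        (hφ.differentiable (by simp) x).hasFDerivAt
    rw [h.fderiv]; rfl
  have c1 : ∀ (i : Fin d), Continuous fun x => fderiv ℝ (fun x => φ x i) x
      (EuclideanSpace.single i 1) := fun i =>
    ((hφi i).continuous_fderiv (by simp)).clm_apply continuous_const
  have c2 : ∀ (i : Fin d), Continuous fun x => fderiv ℝ f x (EuclideanSpace.single i 1) := fun i =>
    (hf.continuous_fderiv (by simp)).clm_apply continuous_const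
  have s1 : ∀ (i : Fin d), HasCompactSupport fun x => fderiv ℝ (fun x => φ x i) x
      (EuclideanSpace.single i 1) := fun i => (hφic i).fderiv_apply (𝕜 := ℝ) _
  have i1 : ∀ i : Fin d, Integrable fun x => f x * fderiv ℝ (fun x => φ x i) x
      (EuclideanSpace.single i 1) := fun i =>
    (hf.continuous.mul (c1 i)).integrable_of_hasCompactSupport (s1 i).mul_left
  have i2 : ∀ i : Fin d, Integrable fun x =>
      fderiv ℝ f x (EuclideanSpace.single i 1) * φ x i := fun i =>
    ((c2 i).mul (hφi i).continuous).integrable_of_hasCompactSupport (hφic i).mul_left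
  have i3 : ∀ i : Fin d, Integrable fun x => f x * φ x i := fun i =>
    (hf.continuous.mul (hφi i).continuous).integrable_of_hasCompactSupport (hφic i).mul_left
  have key : ∀ i : Fin d, ∫ x, f x * fderiv ℝ (fun x => φ x i) x (EuclideanSpace.single i 1)
      = -∫ x, fderiv ℝ f x (EuclideanSpace.single i 1) * φ x i := fun i =>
    integral_mul_fderiv_eq_neg_fderiv_mul_of_integrable (i2 i) (i1 i) (i3 i)
      (fun x _ => hf.differentiable (by simp) x)
      (fun x _ => (hφi i).differentiable (by simp) x)
  have e1 : ∀ x, f x * divergence φ x = ∑ i : Fin d, f x * fderiv ℝ (fun x => φ x i) x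
      (EuclideanSpace.single i 1) := fun x => by
    rw [divergence, Finset.mul_sum]
    exact Finset.sum_congr rfl fun i _ => by rw [hder]
  have e2 : ∀ x, ⟪∇ f x, φ x⟫ = ∑ i : Fin d, fderiv ℝ f x (EuclideanSpace.single i 1) * φ x i :=
    fun x => by
    rw [PiLp.inner_apply]
    exact Finset.sum_congr rfl fun i _ => by rw [gradient_apply]; simp [mul_comm]
  simp_rw [e1, e2]
  rw [integral_finsetSum _ fun i _ => i1 i, integral_finsetSum _ fun i _ => i2 i,
    ← Finset.sum_neg_distrib]
  exact Finset.sum_congr rfl fun i _ => key i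

/-- Fubini; evenness of `k` makes mollification self-adjoint. -/
lemma IsMollifier.integral_mollify_mul {k : E d → ℝ} {δ : ℝ} (hk : IsMollifier k δ)
    (hke : ∀ x, k (-x) = k x) {f g : E d → ℝ} (hf : Integrable f) (hg : Continuous g)
    (hgc : HasCompactSupport g) :
    ∫ x, mollify k f x * g x = ∫ x, f x * mollify k g x := by
  obtain ⟨C, hC⟩ := hg.bounded_above_of_compact_support hgc
  have hint : Integrable (fun z : E d × E d => k (z.1 - z.2) * f z.2 * g z.1)
      (volume.prod volume) := by
    have h1 := hf.convolution_integrand (ContinuousLinearMap.mul ℝ ℝ) hk.integrable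
    have h2 := h1.mul_bdd (c := C) (hg.comp continuous_fst).aestronglyMeasurable
      (Eventually.of_forall fun z => hC z.1)
    refine h2.congr (Eventually.of_forall fun z => ?_)
    simp [mul_comm]
  calc ∫ x, mollify k f x * g x = ∫ x, ∫ y, k (x - y) * f y * g x := by
        refine integral_congr_ae (Eventually.of_forall fun x => ?_)
        simp only [mollify_apply, smul_eq_mul]
        rw [integral_mul_const]
    _ = ∫ y, ∫ x, k (x - y) * f y * g x := integral_integral_swap hint
    _ = ∫ y, f y * mollify k g y := by
        refine integral_congr_ae (Eventually.of_forall fun y => ?_)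
        simp only [mollify_apply, smul_eq_mul]
        rw [← integral_const_mul]
        refine integral_congr_ae (Eventually.of_forall fun x => ?_)
        simp only
        rw [← hke (x - y), neg_sub]
        ring

lemma IsMollifier.mollify_divergence {k : E d → ℝ} {δ : ℝ} (hk : IsMollifier k δ)
    {φ : E d → E d} (hφ : ContDiff ℝ (⊤ : ℕ∞) φ) (hφc : HasCompactSupport φ) (x : E d) :
    mollify k (divergence φ) x = divergence (mollify k φ) x := by
  have hkd : ∀ y, DifferentiableAt ℝ k y := hk.contDiff.differentiable (by simp)
  rw [hk.divergence_mollify hφ.continuous.locallyIntegrable, mollify_apply]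
  simp_rw [smul_eq_mul]
  rw [integral_mul_divergence (f := fun y => k (x - y)) (hk.contDiff.comp (by fun_prop)) hφ hφc,
    ← integral_neg]
  refine integral_congr_ae (Eventually.of_forall fun y => ?_)
  simp only
  rw [gradient_comp_sub_left (hkd _), inner_neg_left, neg_neg, real_inner_comm]

/-- The chain rule is applied to a mollification `g` of the zero extension of `v`. Integrating by
parts twice moves `H' (g)` onto the test field, and self-adjointness moves the mollification there
too. The result is a competitor for `totalVariation Ω v`, still bounded by `1` and supported in `Ω`;
no approximation of `v` in variation is needed. -/
theorem totalVariation_comp_le {v : E d → ℝ} (hv : IntegrableOn v Ω) {H : ℝ → ℝ}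
    (hH : ContDiff ℝ (⊤ : ℕ∞) H) (hH1 : ∀ s, |deriv H s| ≤ 1) (hH0 : H 0 = 0) :
    totalVariation Ω (fun x => H (v x)) ≤ totalVariation Ω v := by
  rcases eq_or_ne (totalVariation Ω v) ∞ with htop | htop
  · rw [htop]; exact le_top
  rw [← ENNReal.ofReal_toReal htop]
  refine totalVariation_le_ofReal fun φ hφ => le_of_forall_pos_le_add fun ε hε => ?_
  have hΩm : MeasurableSet (Ω : Set (E d)) := Ω.isOpen.measurableSet
  have hLip : ∀ a b, |H a - H b| ≤ |a - b| := by
    intro a b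
    have := (lipschitzWith_of_nnnorm_deriv_le (C := 1) (hH.differentiable (by simp))
      fun s => by simpa [← NNReal.coe_le_coe] using hH1 s).dist_le_mul a b
    simpa [Real.dist_eq] using this
  set w : E d → ℝ := (Ω : Set (E d)).indicator v with hw
  have hwi : Integrable w := (integrable_indicator_iff hΩm).2 hv
  obtain ⟨C, hC⟩ := (continuous_divergence φ.contDiff).bounded_above_of_compact_support
    (integrable_divergence φ.contDiff φ.hasCompactSupport).1
  have hC0 : 0 ≤ C := (norm_nonneg _).trans (hC 0)
  obtain ⟨δ₁, hδ₁, h₁⟩ := exists_integral_mollify_sub_le hwi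
    (show 0 < ε / (C + 1) by positivity)
  -- This radius keeps the mollified field compactly supported in `Ω`, so that the artificial jump
  -- of the zero extension across `∂Ω` is not seen.
  obtain ⟨δ₂, hδ₂, h₂⟩ := φ.hasCompactSupport.isCompact.exists_cthickening_subset_open Ω.isOpen
    φ.tsupport_subset
  set δ := min δ₁ δ₂ with hδ
  have hδ0 : 0 < δ := lt_min hδ₁ hδ₂
  let b : ContDiffBump (0 : E d) := ⟨δ / 2, δ, half_pos hδ0, half_lt_self hδ0⟩
  set k : E d → ℝ := b.normed volume with hk_def
  have hk : ∀ r, δ ≤ r → IsMollifier k r := fun r hr => IsMollifier.normed b (by simpa [b] using hr)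
  have hk₁ := hk δ₁ (min_le_left _ _)
  have hk₂ := hk δ₂ (min_le_right _ _)
  set g := mollify k w with hg
  have hgs : ContDiff ℝ (⊤ : ℕ∞) g := hk₁.contDiff_mollify hwi.locallyIntegrable
  set ψ : E d → E d := fun x => deriv H (g x) • φ x with hψ
  have hH' : ContDiff ℝ (⊤ : ℕ∞) (deriv H) :=
    (contDiff_infty_iff_deriv.1 hH).2
  have hψs : ContDiff ℝ (⊤ : ℕ∞) ψ := (hH'.comp hgs).smul φ.contDiff
  have hψc : HasCompactSupport ψ :=
    φ.hasCompactSupport.mono fun x hx h => hx (by simp [hψ, h])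
  have hψsupp : Function.support ψ ⊆ tsupport φ := fun x hx =>
    subset_tsupport _ fun h => hx (by simp [hψ, h])
  have hψ1 : ∀ x, ‖ψ x‖ ≤ 1 := fun x => by
    rw [hψ, norm_smul]
    exact mul_le_one₀ (hH1 _) (norm_nonneg _) (hφ x)
  have hsupp : Function.support (mollify k ψ) ⊆ cthickening δ₂ (tsupport φ) := by
    intro x hx
    by_contra hxK
    refine hx (hk₂.mollify_eq_zero fun y hy => ?_)
    by_contra hne
    refine hxK (mem_cthickening_of_dist_le x y _ _ (hψsupp hne) ?_)
    rw [dist_comm]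
    exact (mem_ball.1 hy).le
  have hKc : IsCompact (cthickening δ₂ (tsupport φ)) := φ.hasCompactSupport.isCompact.cthickening
  let Φ : 𝓓(Ω, E d) :=
    { toFun := mollify k ψ
      contDiff' := hk₁.contDiff_mollify hψs.continuous.locallyIntegrable
      hasCompactSupport' := HasCompactSupport.of_support_subset_isCompact hKc hsupp
      tsupport_subset' := (closure_minimal hsupp hKc.isClosed).trans h₂ }
  have hΦ1 : ∀ x, ‖Φ x‖ ≤ 1 := by
    intro x
    refine (hk₁.norm_mollify_le (h := fun _ => 1) continuous_const.locallyIntegrable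
      (Eventually.of_forall hψ1) x).trans_eq ?_
    rw [mollify_apply]
    simp only [smul_eq_mul, mul_one]
    rw [integral_sub_left_eq_self k volume x, hk₁.integral_eq_one]
  have hdiff : ∀ x, ∇ (fun y => H (g y)) x = deriv H (g x) • ∇ g x := by
    intro x
    have h : HasFDerivAt (fun y => H (g y)) _ x :=
      (hH.differentiable (by simp) (g x)).hasDerivAt.comp_hasFDerivAt x
        (hgs.differentiable (by simp) x).hasFDerivAt
    refine ext_inner_right ℝ fun v => ?_
    rw [inner_gradient_left, real_inner_smul_left, inner_gradient_left, h.fderiv]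
    simp
  have key : ∫ x, H (g x) * divergence φ x =
      ∫ x in (Ω : Set (E d)), v x * divergence Φ x := by
    rw [integral_mul_divergence (f := fun x => H (g x)) (hH.comp hgs) φ.contDiff φ.hasCompactSupport]
    have e1 : ∀ x, ⟪∇ (fun y => H (g y)) x, φ x⟫ = ⟪∇ g x, ψ x⟫ := fun x => by
      rw [hdiff, real_inner_smul_left, hψ,
        real_inner_smul_right]
    simp_rw [e1]
    rw [← integral_mul_divergence hgs hψs hψc,
      hk₁.integral_mollify_mul (fun x => b.normed_neg x) hwi (continuous_divergence hψs)
        (integrable_divergence hψs hψc).1, ← integral_indicator hΩm]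
    refine integral_congr_ae (Eventually.of_forall fun x => ?_)
    simp only
    rw [hk₁.mollify_divergence hψs hψc]
    by_cases hx : x ∈ (Ω : Set (E d))
    · simp only [hw, indicator_of_mem hx]; rfl
    · simp [hw, hx]
  have hTV := neg_integral_le_totalVariation (lt_top_iff_ne_top.2 htop) Φ one_pos hΦ1
  rw [← key, one_mul] at hTV
  have hzero : ∀ x ∉ (Ω : Set (E d)), H (g x) * divergence φ x = 0 := by
    intro x hx
    have : divergence φ x = 0 := by
      by_contra hne
      exact hx (φ.tsupport_subset (support_divergence_subset _ hne))
    rw [this, mul_zero]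
  rw [← setIntegral_eq_integral_of_forall_compl_eq_zero hzero] at hTV
  have hm : AEStronglyMeasurable (divergence φ) (volume.restrict (Ω : Set (E d))) :=
    (continuous_divergence φ.contDiff).aestronglyMeasurable
  have hgi : IntegrableOn g Ω := (hk₁.integrable_mollify hwi).integrableOn
  have hHi : ∀ {f : E d → ℝ}, IntegrableOn f Ω →
      IntegrableOn (fun x => H (f x) * divergence φ x) Ω := by
    intro f hf
    refine Integrable.mul_bdd (c := C) (hf.norm.mono'
      (hH.continuous.comp_aestronglyMeasurable hf.aestronglyMeasurable)
      (Eventually.of_forall fun x => ?_)) hm (Eventually.of_forall hC)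
    simpa [hH0] using hLip (f x) 0
  have hgw : Integrable fun x => C * ‖g x - w x‖ :=
    ((hk₁.integrable_mollify hwi).sub hwi).norm.const_mul C
  -- `H` is `1`-Lipschitz, so replacing `g` by `v` costs at most `C` times the `L¹` mollification
  -- error.
  have hclose : |(∫ x in (Ω : Set (E d)), H (g x) * divergence φ x)
      - ∫ x in (Ω : Set (E d)), H (v x) * divergence φ x| ≤ ε := by
    rw [← integral_sub (hHi hgi) (hHi hv)]
    calc _ ≤ ∫ x in (Ω : Set (E d)), C * ‖g x - w x‖ := by
          rw [← Real.norm_eq_abs]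
          refine norm_integral_le_of_norm_le hgw.integrableOn ?_
          filter_upwards [ae_restrict_mem hΩm] with x hx
          rw [hw, indicator_of_mem hx, ← sub_mul, norm_mul, mul_comm]
          exact mul_le_mul (hC x) (hLip _ _) (norm_nonneg _) hC0
      _ ≤ ∫ x, C * ‖g x - w x‖ := setIntegral_le_integral hgw
            (Eventually.of_forall fun x => by positivity)
      _ ≤ C * (ε / (C + 1)) := by
          rw [integral_const_mul]
          exact mul_le_mul_of_nonneg_left (h₁ k hk₁) hC0
      _ ≤ ε := by
          rw [mul_div_assoc', div_le_iff₀ (by positivity)]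
          nlinarith
  rw [abs_le] at hclose
  linarith

end ROF

namespace ROF

variable {d : ℕ} {Ω : Opens (E d)}

/-! ### Coverings by balls and Hausdorff measure -/

/-- Each set of an almost optimal cover is enlarged to a ball centred at one of its points in `A`,
with radius just above its diameter. The measure here is built from powers of diameters, so no
constant is lost. -/
lemma exists_ball_cover {A : Set (E d)} {s : ℝ} (hs : 0 ≤ s) {c : ℝ≥0∞} (hc : c ≠ ∞)
    (hA : (Measure.hausdorffMeasure s : Measure (E d)) A < c) {r : ℝ} (hr : 0 < r) :
    ∃ P : Set (E d × ℝ), (∀ p ∈ P, p.1 ∈ A ∧ 0 < p.2 ∧ p.2 < r) ∧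
      A ⊆ (⋃ p ∈ P, ball p.1 p.2) ∧
      ∀ J : Finset (E d × ℝ), (J : Set (E d × ℝ)) ⊆ P → ∑ p ∈ J, p.2 ^ s ≤ c.toReal := by
  classical
  rw [Measure.hausdorffMeasure_apply] at hA
  have hA' := lt_of_le_of_lt (le_iSup₂ (f := fun (r : ℝ≥0∞) (_ : 0 < r) =>
    ⨅ (t : ℕ → Set (E d)) (_ : A ⊆ ⋃ n, t n) (_ : ∀ n, ediam (t n) ≤ r),
      ∑' n, ⨆ _ : (t n).Nonempty, ediam (t n) ^ s) (ENNReal.ofReal (r / 2)) (by simpa using hr)) hA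
  simp only [iInf_lt_iff] at hA'
  obtain ⟨t, hAt, htr, hsum⟩ := hA'
  -- The slack between the cover sum and `c` is shared among the radii; they must exceed the
  -- diameters strictly for open balls to cover, even when a diameter is zero.
  obtain ⟨η, hη, hηsum⟩ := ENNReal.exists_pos_sum_of_countable (tsub_pos_iff_lt.2 hsum).ne' ℕ
  have hfin : ∀ n, ediam (t n) ≠ ∞ := fun n => ((htr n).trans_lt ENNReal.ofReal_lt_top).ne
  have hD : ∀ n, (ediam (t n)).toReal < r := fun n =>
    (ENNReal.toReal_le_of_le_ofReal (by positivity) (htr n)).trans_lt (by linarith)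
  have hρ : ∀ n, ∃ ρ : ℝ, (ediam (t n)).toReal < ρ ∧ ρ < r ∧
      ρ ^ s < (ediam (t n)).toReal ^ s + η n := by
    intro n
    have h1 : ∀ᶠ ρ in 𝓝[>] (ediam (t n)).toReal, ρ ^ s < (ediam (t n)).toReal ^ s + η n :=
      Eventually.filter_mono nhdsWithin_le_nhds
        ((Real.continuous_rpow_const hs).continuousAt.eventually_lt continuousAt_const
          (by simpa using hη n))
    obtain ⟨ρ, h2, h3⟩ := (h1.and (Ioo_mem_nhdsGT (hD n))).exists
    exact ⟨ρ, h3.1, h3.2, h2⟩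
  choose ρ hDρ hρr hρs using hρ
  have hx : ∀ n, ∃ x, (t n ∩ A).Nonempty → x ∈ t n ∩ A := fun n => by
    by_cases h : (t n ∩ A).Nonempty
    · exact ⟨h.some, fun _ => h.some_mem⟩
    · exact ⟨0, fun h' => (h h').elim⟩
  choose x hx using hx
  refine ⟨(fun n => (x n, ρ n)) '' {n | (t n ∩ A).Nonempty}, ?_, fun y hy => ?_, fun J hJ => ?_⟩
  · rintro _ ⟨n, hn, rfl⟩
    exact ⟨(hx n hn).2, ENNReal.toReal_nonneg.trans_lt (hDρ n), hρr n⟩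
  · obtain ⟨n, hn⟩ := mem_iUnion.1 (hAt hy)
    have hI : (t n ∩ A).Nonempty := ⟨y, hn, hy⟩
    refine mem_iUnion₂.2 ⟨(x n, ρ n), ⟨n, hI, rfl⟩, ?_⟩
    rw [mem_ball, dist_edist]
    exact (ENNReal.toReal_mono (hfin n) (edist_le_ediam_of_mem hn (hx n hI).1)).trans_lt (hDρ n)
  · obtain ⟨s', hs', rfl⟩ := Finset.subset_set_image_iff.1 hJ
    have hρ0 : ∀ n, 0 ≤ ρ n := fun n => ENNReal.toReal_nonneg.trans (hDρ n).le
    have h1 : ∑ p ∈ s'.image (fun n => (x n, ρ n)), p.2 ^ s ≤ ∑ n ∈ s', ρ n ^ s :=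
      Finset.sum_image_le_of_nonneg (f := fun p : E d × ℝ => p.2 ^ s)
        fun p hp => by
          obtain ⟨n, -, rfl⟩ := Finset.mem_image.1 hp
          exact Real.rpow_nonneg (hρ0 n) s
    refine h1.trans ?_
    rw [← ENNReal.ofReal_le_iff_le_toReal hc, ENNReal.ofReal_sum_of_nonneg
      fun n _ => Real.rpow_nonneg (hρ0 n) s]
    calc ∑ n ∈ s', ENNReal.ofReal (ρ n ^ s)
        ≤ ∑ n ∈ s', ((⨆ _ : (t n).Nonempty, ediam (t n) ^ s) + η n) := by
          refine Finset.sum_le_sum fun n hn => ?_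
          have hne : (t n).Nonempty := (hs' hn).mono inter_subset_left
          rw [iSup_pos hne]
          refine (ENNReal.ofReal_le_ofReal (hρs n).le).trans ?_
          rw [ENNReal.ofReal_add (by positivity) (by positivity), ENNReal.ofReal_coe_nnreal,
            ← ENNReal.ofReal_rpow_of_nonneg ENNReal.toReal_nonneg hs,
            ENNReal.ofReal_toReal (hfin n)]
      _ ≤ (∑' n, ⨆ _ : (t n).Nonempty, ediam (t n) ^ s) + ∑' n, (η n : ℝ≥0∞) := by
          rw [Finset.sum_add_distrib]
          exact add_le_add (ENNReal.sum_le_tsum _) (ENNReal.sum_le_tsum _)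
      _ ≤ c := by
          rw [add_comm]
          exact (lt_tsub_iff_right.1 hηsum).le

/-! ### Cut-off functions -/

lemma norm_gradient_prod_le {ι : Type*} (s : Finset ι) {f : ι → E d → ℝ}
    (hf : ∀ i x, DifferentiableAt ℝ (f i) x) (h0 : ∀ i x, 0 ≤ f i x) (h1 : ∀ i x, f i x ≤ 1)
    (x : E d) : ‖∇ (fun y => ∏ i ∈ s, f i y) x‖ ≤ ∑ i ∈ s, ‖∇ (f i) x‖ := by
  classical
  induction s using Finset.induction_on with
  | empty =>
    simp [gradient]
  | insert a s ha ih =>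
    simp only [Finset.prod_insert ha, Finset.sum_insert ha]
    have hd : DifferentiableAt ℝ (fun y => ∏ i ∈ s, f i y) x :=
      (HasFDerivAt.finsetProd fun i _ => (hf i x).hasFDerivAt).differentiableAt
    rw [gradient_mul (hf a x) hd, add_comm]
    refine (norm_add_le _ _).trans (add_le_add ?_ ?_)
    · rw [norm_smul, Real.norm_of_nonneg (Finset.prod_nonneg fun i _ => h0 i x)]
      exact mul_le_of_le_one_left (norm_nonneg _)
        (Finset.prod_le_one (fun i _ => h0 i x) fun i _ => h1 i x)
    · rw [norm_smul, Real.norm_of_nonneg (h0 a x)]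
      exact (mul_le_of_le_one_left (norm_nonneg _) (h1 a x)).trans ih

/-- There is a constant `L` such that all balls admit cut-off functions with gradient bounded by
`L / ρ`, vanishing in the ball of radius `ρ` and equal to `1` off the ball of radius `3 ρ`. -/
lemma exists_ball_cutoff (d : ℕ) : ∃ L : ℝ, 0 ≤ L ∧ ∀ (z : E d) (ρ : ℝ), 0 < ρ →
    ∃ χ : E d → ℝ, ContDiff ℝ (⊤ : ℕ∞) χ ∧ (∀ x, 0 ≤ χ x) ∧ (∀ x, χ x ≤ 1) ∧
      (∀ x ∈ ball z ρ, χ x = 0) ∧ (∀ x ∉ ball z (3 * ρ), χ x = 1) ∧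
      ∀ x, ‖∇ χ x‖ ≤ (ball z (3 * ρ)).indicator (fun _ => L / ρ) x := by
  let β : ContDiffBump (0 : E d) := ⟨1, 2, one_pos, one_lt_two⟩
  have hβ : ContDiff ℝ (⊤ : ℕ∞) β := β.contDiff
  obtain ⟨L, hL⟩ := (hβ.continuous_fderiv (by simp)).bounded_above_of_compact_support
    (β.hasCompactSupport.fderiv (𝕜 := ℝ))
  have hL0 : 0 ≤ L := (norm_nonneg _).trans (hL 0)
  refine ⟨L, hL0, fun z ρ hρ => ⟨fun x => 1 - β (ρ⁻¹ • (x - z)), ?_, fun x => ?_, fun x => ?_,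
    fun x hx => ?_, fun x hx => ?_, fun x => ?_⟩⟩
  · exact contDiff_const.sub (hβ.comp (by fun_prop))
  · linarith [β.le_one (x := ρ⁻¹ • (x - z))]
  · linarith [β.nonneg (x := ρ⁻¹ • (x - z))]
  · dsimp only
    rw [β.one_of_mem_closedBall, sub_self]
    rw [mem_closedBall_zero_iff, norm_smul, norm_inv, Real.norm_of_nonneg hρ.le,
      inv_mul_le_iff₀ hρ]
    rw [mem_ball, dist_eq_norm] at hx
    simpa [β] using hx.le
  · dsimp only
    rw [β.zero_of_le_dist, sub_zero]
    rw [dist_zero_right, norm_smul, norm_inv, Real.norm_of_nonneg hρ.le, le_inv_mul_iff₀ hρ]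
    rw [mem_ball, dist_eq_norm, not_lt] at hx
    change ρ * 2 ≤ _
    linarith
  · have hd : HasFDerivAt (fun x => 1 - β (ρ⁻¹ • (x - z))) _ x :=
      (((hβ.differentiable (by simp) _).hasFDerivAt.comp x
        (((hasFDerivAt_id x).sub_const z).const_smul ρ⁻¹))).const_sub 1
    have hn : ∀ y, ‖∇ (fun x => 1 - β (ρ⁻¹ • (x - z))) y‖ =
        ‖fderiv ℝ (fun x => 1 - β (ρ⁻¹ • (x - z))) y‖ := fun y => by
      rw [gradient, LinearIsometryEquiv.norm_map]
    rw [hn]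
    by_cases hx : x ∈ ball z (3 * ρ)
    · rw [indicator_of_mem hx, hd.fderiv, norm_neg]
      refine (ContinuousLinearMap.opNorm_comp_le _ _).trans ?_
      rw [div_eq_mul_inv]
      refine mul_le_mul (hL _) ?_ (norm_nonneg _) hL0
      rw [norm_smul, norm_inv, Real.norm_of_nonneg hρ.le]
      exact mul_le_of_le_one_right (by positivity) ContinuousLinearMap.norm_id_le
    · rw [indicator_of_notMem hx]
      rw [mem_ball, dist_eq_norm, not_lt] at hx
      have hev : (fun x => 1 - β (ρ⁻¹ • (x - z))) =ᶠ[𝓝 x] fun _ => 1 := by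
        have hopen : IsOpen {y : E d | 2 * ρ < ‖y - z‖} := isOpen_lt (by fun_prop) (by fun_prop)
        filter_upwards [hopen.mem_nhds (show 2 * ρ < ‖x - z‖ by linarith)] with y (hy : 2 * ρ < ‖y - z‖)
        rw [β.zero_of_le_dist, sub_zero]
        rw [dist_zero_right, norm_smul, norm_inv, Real.norm_of_nonneg hρ.le, le_inv_mul_iff₀ hρ]
        change ρ * 2 ≤ _
        linarith
      rw [hev.fderiv_eq]
      simp

end ROF

/-! ### Cut-off functions adapted to a zero trace -/

namespace ROF

variable {d : ℕ} {Ω : Opens (E d)}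

/-- Egorov's theorem requires measurability in the centre. The balls are the sections of the
measurable set `dist z.2 z.1 < r`, and `w` is replaced by a measurable representative. -/
lemma stronglyMeasurable_integral_ball {w : E d → ℝ} (hw : IntegrableOn w Ω) (r : ℝ) :
    StronglyMeasurable fun x : E d => ∫ y in ball x r ∩ (Ω : Set (E d)), |w y| := by
  have hg := hw.aestronglyMeasurable.stronglyMeasurable_mk
  set g := hw.aestronglyMeasurable.mk w with hgdef
  have h1 : ∀ x : E d, ∫ y in ball x r ∩ (Ω : Set (E d)), |w y| =
      ∫ y in (Ω : Set (E d)), {z : E d × E d | dist z.2 z.1 < r}.indicator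
        (fun z => |g z.2|) (x, y) := by
    intro x
    rw [← Measure.restrict_restrict measurableSet_ball, ← integral_indicator measurableSet_ball]
    refine integral_congr_ae (hw.aestronglyMeasurable.ae_eq_mk.mono fun y hy => ?_)
    by_cases h : y ∈ ball x r
    · have h' : dist y x < r := h
      simp [h, h', hy, hgdef]
    · have h' : ¬ dist y x < r := h
      simp [h, h']
  simp_rw [h1]
  refine StronglyMeasurable.integral_prod_right' (f := {z : E d × E d | dist z.2 z.1 < r}.indicator
        (fun z => |g z.2|)) (StronglyMeasurable.indicator ?_ ?_)
  · exact (hg.comp_measurable measurable_snd).norm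
  · exact measurableSet_lt (by fun_prop) measurable_const

/-- Egorov's theorem treats sequences, hence the radii `2⁻ⁿ`. A general radius lies between two of
them, at the price of a factor `2 ^ d`. -/
lemma integral_ball_le_of_dyadic {w : E d → ℝ} (hw : IntegrableOn w Ω) {κ : ℝ} (hκ : 0 ≤ κ) {N : ℕ}
    {x : E d}
    (h : ∀ n ≥ N, (((1 / 2 : ℝ) ^ n) ^ d)⁻¹ * ∫ y in ball x ((1 / 2 : ℝ) ^ n) ∩ (Ω : Set (E d)),
      |w y| ≤ κ) {ρ : ℝ} (hρ : 0 < ρ) (hρN : ρ < (1 / 2 : ℝ) ^ N) :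
    ∫ y in ball x ρ ∩ (Ω : Set (E d)), |w y| ≤ κ * (2 * ρ) ^ d := by
  obtain ⟨n, hn1, hn2⟩ := exists_nat_pow_near_of_lt_one hρ
    (hρN.le.trans (pow_le_one₀ (by norm_num) (by norm_num))) (show (0 : ℝ) < 1 / 2 by norm_num)
    (by norm_num)
  have hnN : N ≤ n := by
    by_contra hlt
    have : (1 / 2 : ℝ) ^ N ≤ (1 / 2 : ℝ) ^ (n + 1) :=
      pow_le_pow_of_le_one (by norm_num) (by norm_num) (by omega)
    linarith
  have h1 := h n hnN
  rw [inv_mul_le_iff₀ (by positivity), mul_comm] at h1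
  have h2 : (1 / 2 : ℝ) ^ n ≤ 2 * ρ := by
    rw [pow_succ] at hn1
    linarith
  calc ∫ y in ball x ρ ∩ (Ω : Set (E d)), |w y|
      ≤ ∫ y in ball x ((1 / 2 : ℝ) ^ n) ∩ (Ω : Set (E d)), |w y| :=
        setIntegral_mono_set (IntegrableOn.mono_set (show IntegrableOn (fun y => |w y|) Ω volume from hw.abs) inter_subset_right)
          (Eventually.of_forall fun _ => abs_nonneg _)
          (inter_subset_inter_left _ (ball_subset_ball hn2)).eventuallyLE
    _ ≤ κ * ((1 / 2 : ℝ) ^ n) ^ d := h1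
    _ ≤ κ * (2 * ρ) ^ d := by gcongr

lemma integral_ball_le_of_bound (hd : 1 ≤ d) {w : E d → ℝ} {M : ℝ} (hM0 : 0 ≤ M) {x : E d}
    {ρ : ℝ} (hρ : 0 < ρ) (hM : ∀ y ∈ ball x ρ ∩ (Ω : Set (E d)), |w y| ≤ M) :
    ∫ y in ball x ρ ∩ (Ω : Set (E d)), |w y| ≤
      M * volume.real (ball (0 : E d) 1) * ρ ^ d := by
  have : Nontrivial (E d) := by
    have : Nonempty (Fin d) := ⟨⟨0, hd⟩⟩
    infer_instance
  have hvol : volume.real (ball x ρ) = ρ ^ d * volume.real (ball (0 : E d) 1) := by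
    rw [measureReal_def, Measure.addHaar_ball _ _ hρ.le, ENNReal.toReal_mul,
      ENNReal.toReal_ofReal (by positivity), finrank_euclideanSpace_fin, measureReal_def]
  have hfin : volume (ball x ρ ∩ (Ω : Set (E d))) < ∞ :=
    (measure_mono inter_subset_left).trans_lt measure_ball_lt_top
  have h1 := norm_setIntegral_le_of_norm_le_const (f := fun y => |w y|) (C := M) hfin
    fun y hy => by simpa using hM y hy
  calc ∫ y in ball x ρ ∩ (Ω : Set (E d)), |w y|
      ≤ M * volume.real (ball x ρ ∩ (Ω : Set (E d))) := (le_abs_self _).trans h1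
    _ ≤ M * volume.real (ball x ρ) := by
        gcongr
        · exact measure_ball_lt_top.ne
        · exact inter_subset_left
    _ = M * volume.real (ball (0 : E d) 1) * ρ ^ d := by rw [hvol]; ring

/-- A function with zero trace on `Γ` admits cut-off functions near `Γ` whose gradients it
makes negligible. -/
theorem exists_cutoff (hd : 1 ≤ d) {Γ : Set (E d)} (hΓ : IsCompact Γ)
    (hΓμ : (Measure.hausdorffMeasure ((d : ℝ) - 1) : Measure (E d)) Γ < ∞) {w : E d → ℝ}
    (hwi : IntegrableOn w Ω) {M : ℝ} (hM0 : 0 ≤ M) (hM : ∀ x ∈ (Ω : Set (E d)), |w x| ≤ M)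
    (hw : HasZeroTraceOn Ω Γ w) {ε r : ℝ} (hε : 0 < ε) (hr : 0 < r) :
    ∃ χ : E d → ℝ, ContDiff ℝ (⊤ : ℕ∞) χ ∧ (∀ x, 0 ≤ χ x) ∧ (∀ x, χ x ≤ 1) ∧
      Disjoint (tsupport χ) Γ ∧ (∀ x, (∀ z ∈ Γ, r ≤ dist x z) → χ x = 1) ∧
      ∫ x in (Ω : Set (E d)), |w x| * ‖∇ χ x‖ ≤ ε := by
  classical
  set μ : Measure (E d) := Measure.hausdorffMeasure ((d : ℝ) - 1) with hμ
  have hs : (0 : ℝ) ≤ (d : ℝ) - 1 := by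
    have : (1 : ℝ) ≤ d := by exact_mod_cast hd
    linarith
  have hΩm : MeasurableSet (Ω : Set (E d)) := Ω.isOpen.measurableSet
  obtain ⟨L, hL0, hL⟩ := exists_ball_cutoff d
  set V : ℝ := volume.real (ball (0 : E d) 1) with hV
  have hV0 : 0 ≤ V := measureReal_nonneg
  set m : ℝ := (μ Γ + 1).toReal with hm
  have hm0 : 0 ≤ m := ENNReal.toReal_nonneg
  -- `κ` bounds the scaled means on good balls, and `2 τ` the total of `ρ ^ (d - 1)` over bad balls.
  -- They are chosen so that each family contributes at most `ε / 2`; the added `1` avoids division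
  -- by zero.
  set κ : ℝ := ε / 2 / (L * 6 ^ d * m + 1) with hκ
  have hκ0 : 0 < κ := by positivity
  set τ : ℝ := ε / 2 / (2 * (L * (M * V * 3 ^ d)) + 1) with hτ
  have hτ0 : 0 < τ := by positivity
  have : IsFiniteMeasure (μ.restrict Γ) := ⟨by rwa [Measure.restrict_apply_univ]⟩
  have hlim : Tendsto (fun n : ℕ => (1 / 2 : ℝ) ^ n) atTop (𝓝[>] 0) :=
    tendsto_nhdsWithin_iff.2 ⟨tendsto_pow_atTop_nhds_zero_of_lt_one (by norm_num) (by norm_num),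
      Eventually.of_forall fun n => by simp⟩
  -- Egorov's theorem on `Γ`: outside a set `B` of surface measure at most `τ`, the means tend to
  -- zero uniformly.
  obtain ⟨B, hBm, hB, hunif⟩ := tendstoUniformlyOn_of_ae_tendsto' (μ := μ.restrict Γ)
    (f := fun (n : ℕ) (x : E d) => (((1 / 2 : ℝ) ^ n) ^ d)⁻¹ *
      ∫ y in ball x ((1 / 2 : ℝ) ^ n) ∩ (Ω : Set (E d)), |w y|) (g := fun _ => 0)
    (fun n => (stronglyMeasurable_integral_ball hwi _).const_mul _) stronglyMeasurable_const
    (hw.mono fun x hx => hx.comp hlim) hτ0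
  obtain ⟨N, hN⟩ := eventually_atTop.1 (Metric.tendstoUniformlyOn_iff.1 hunif κ hκ0)
  have hgood : ∀ x ∈ Bᶜ, ∀ ρ : ℝ, 0 < ρ → ρ < (1 / 2 : ℝ) ^ N →
      ∫ y in ball x ρ ∩ (Ω : Set (E d)), |w y| ≤ κ * (2 * ρ) ^ d := fun x hx ρ hρ hρN =>
    integral_ball_le_of_dyadic hwi hκ0.le (fun n hn => by
      have := hN n hn x hx
      rw [dist_zero_left] at this
      exact (le_abs_self _).trans this.le) hρ hρN
  -- The cut-offs act on triple balls, whence the thirds: `3 ρ < r` keeps `χ = 1` away from `Γ`, and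
  -- `3 ρ < 2⁻ᴺ` lets the uniform estimate apply.
  set r' : ℝ := min (r / 3) ((1 / 2 : ℝ) ^ N / 3) with hr'
  have hr'0 : 0 < r' := by positivity
  obtain ⟨P, hP, hPcov, hPsum⟩ := exists_ball_cover (A := Γ ∩ Bᶜ) hs
    (c := μ Γ + 1) (by simpa using hΓμ.ne)
    ((measure_mono inter_subset_left).trans_lt (ENNReal.lt_add_right hΓμ.ne one_ne_zero)) hr'0
  obtain ⟨Q, hQ, hQcov, hQsum⟩ := exists_ball_cover (A := Γ ∩ B) hs
    (c := ENNReal.ofReal (2 * τ)) ENNReal.ofReal_ne_top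
    (by
      rw [inter_comm, ← Measure.restrict_apply hBm]
      exact hB.trans_lt (by rw [ENNReal.ofReal_lt_ofReal_iff] <;> linarith)) hr'0
  rw [ENNReal.toReal_ofReal (by positivity)] at hQsum
  obtain ⟨J', hJ', hJfin, hJcov⟩ := hΓ.elim_finite_subcover_image (b := P ∪ Q)
    (c := fun p => ball p.1 p.2) (fun _ _ => isOpen_ball) (by
      intro x hx
      rw [biUnion_union]
      by_cases h : x ∈ B
      · exact Or.inr (hQcov ⟨hx, h⟩)
      · exact Or.inl (hPcov ⟨hx, h⟩))
  obtain ⟨J, rfl⟩ := hJfin.exists_finset_coe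
  have hpos : ∀ p ∈ J, p.1 ∈ Γ ∧ 0 < p.2 ∧ p.2 < r' := by
    intro p hp
    rcases hJ' hp with h | h
    · exact ⟨(hP p h).1.1, (hP p h).2⟩
    · exact ⟨(hQ p h).1.1, (hQ p h).2⟩
  have hχ' : ∀ p : J, ∃ χ : E d → ℝ, ContDiff ℝ (⊤ : ℕ∞) χ ∧ (∀ x, 0 ≤ χ x) ∧ (∀ x, χ x ≤ 1) ∧
      (∀ x ∈ ball p.1.1 p.1.2, χ x = 0) ∧ (∀ x ∉ ball p.1.1 (3 * p.1.2), χ x = 1) ∧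
      ∀ x, ‖∇ χ x‖ ≤ (ball p.1.1 (3 * p.1.2)).indicator (fun _ => L / p.1.2) x :=
    fun p => hL p.1.1 p.1.2 (hpos p p.2).2.1
  choose χ hχs hχ0 hχ1 hχz hχo hχg using hχ'
  -- The gradient bound `L / ρ` turns a volume `ρ ^ d` into a surface term `ρ ^ (d - 1)`. Good balls
  -- bring the small factor `κ`; on bad balls only `|w| ≤ M` is used, since their surface total is
  -- small.
  have hball : ∀ p : J, L / p.1.2 * ∫ y in ball p.1.1 (3 * p.1.2) ∩ (Ω : Set (E d)), |w y| ≤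
      (if p.1 ∈ P then L * 6 ^ d * κ else L * (M * V * 3 ^ d)) * p.1.2 ^ ((d : ℝ) - 1) := by
    intro p
    obtain ⟨-, hp0, hpr⟩ := hpos p p.2
    have hpow : p.1.2 ^ d / p.1.2 = p.1.2 ^ ((d : ℝ) - 1) := by
      rw [Real.rpow_sub_one hp0.ne', Real.rpow_natCast]
    split_ifs with hpP
    · have h1 := hgood p.1.1 (hP _ hpP).1.2 (3 * p.1.2) (by positivity) (by
        have := hpr.trans_le (min_le_right _ _)
        linarith)
      calc _ ≤ L / p.1.2 * (κ * (2 * (3 * p.1.2)) ^ d) :=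
            mul_le_mul_of_nonneg_left h1 (by positivity)
        _ = L * 6 ^ d * κ * (p.1.2 ^ d / p.1.2) := by
            rw [show 2 * (3 * p.1.2) = 6 * p.1.2 by ring, mul_pow]; ring
        _ = _ := by rw [hpow]
    · have h1 := integral_ball_le_of_bound (x := p.1.1) hd hM0
        (show 0 < 3 * p.1.2 by positivity) fun y hy => hM y hy.2
      calc _ ≤ L / p.1.2 * (M * V * (3 * p.1.2) ^ d) :=
            mul_le_mul_of_nonneg_left h1 (by positivity)
        _ = L * (M * V * 3 ^ d) * (p.1.2 ^ d / p.1.2) := by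
            rw [mul_pow]; ring
        _ = _ := by rw [hpow]
  refine ⟨fun x => ∏ p, χ p x, contDiff_prod fun p _ => hχs p,
    fun x => Finset.prod_nonneg fun p _ => hχ0 p x,
    fun x => Finset.prod_le_one (fun p _ => hχ0 p x) fun p _ => hχ1 p x, ?_, fun x hx => ?_, ?_⟩
  · have hopen : IsOpen (⋃ p ∈ J, ball p.1 p.2) := isOpen_biUnion fun _ _ => isOpen_ball
    refine Set.disjoint_left.2 fun x hx hxΓ => ?_
    have hsub : tsupport (fun x => ∏ p, χ p x) ⊆ (⋃ p ∈ J, ball p.1 p.2)ᶜ := by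
      refine closure_minimal (fun y hy hy' => hy ?_) hopen.isClosed_compl
      obtain ⟨p, hp, hyp⟩ := mem_iUnion₂.1 hy'
      exact Finset.prod_eq_zero (Finset.mem_univ ⟨p, hp⟩) (hχz ⟨p, hp⟩ y hyp)
    exact hsub hx (by simpa using hJcov hxΓ)
  · refine Finset.prod_eq_one fun p _ => hχo p x fun hxp => ?_
    obtain ⟨hpΓ, hp0, hpr⟩ := hpos p p.2
    have h1 := hx p.1.1 hpΓ
    have h2 := mem_ball.1 hxp
    have h3 := hpr.trans_le (min_le_left _ _)
    linarith
  · have hint : ∀ p : J, Integrable (fun x => L / p.1.2 *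
        (ball p.1.1 (3 * p.1.2)).indicator (fun y => |w y|) x)
        (volume.restrict (Ω : Set (E d))) := fun p =>
      (hwi.abs.indicator measurableSet_ball).const_mul _
    calc ∫ x in (Ω : Set (E d)), |w x| * ‖∇ (fun x => ∏ p, χ p x) x‖
        ≤ ∫ x in (Ω : Set (E d)), ∑ p : J, L / p.1.2 *
            (ball p.1.1 (3 * p.1.2)).indicator (fun y => |w y|) x := by
          refine integral_mono_of_nonneg (Eventually.of_forall fun x => by positivity)
            (integrable_finsetSum _ fun p _ => hint p) (Eventually.of_forall fun x => ?_)
          have h1 := norm_gradient_prod_le (Finset.univ : Finset J) (f := χ)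
            (fun p x => (hχs p).differentiable (by simp) x) hχ0 hχ1 x
          refine (mul_le_mul_of_nonneg_left h1 (abs_nonneg _)).trans ?_
          rw [Finset.mul_sum]
          refine Finset.sum_le_sum fun p _ => ?_
          refine (mul_le_mul_of_nonneg_left (hχg p x) (abs_nonneg _)).trans_eq ?_
          by_cases hx : x ∈ ball p.1.1 (3 * p.1.2)
          · simp only [indicator_of_mem hx]; ring
          · simp only [indicator_of_notMem hx]; ring
      _ = ∑ p : J, L / p.1.2 * ∫ y in ball p.1.1 (3 * p.1.2) ∩ (Ω : Set (E d)), |w y| := by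
          rw [integral_finsetSum _ fun p _ => hint p]
          refine Finset.sum_congr rfl fun p _ => ?_
          rw [integral_const_mul, integral_indicator measurableSet_ball,
            Measure.restrict_restrict measurableSet_ball]
      _ ≤ ∑ p : J, (if p.1 ∈ P then L * 6 ^ d * κ else L * (M * V * 3 ^ d)) *
            p.1.2 ^ ((d : ℝ) - 1) := Finset.sum_le_sum fun p _ => hball p
      _ = ∑ p ∈ J, (if p ∈ P then L * 6 ^ d * κ else L * (M * V * 3 ^ d)) *
            p.2 ^ ((d : ℝ) - 1) := Finset.sum_coe_sort J fun p =>
          (if p ∈ P then L * 6 ^ d * κ else L * (M * V * 3 ^ d)) * p.2 ^ ((d : ℝ) - 1)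
      _ = L * 6 ^ d * κ * ∑ p ∈ J with p ∈ P, p.2 ^ ((d : ℝ) - 1) +
            L * (M * V * 3 ^ d) * ∑ p ∈ J with p ∉ P, p.2 ^ ((d : ℝ) - 1) := by
          simp only [ite_mul]
          rw [Finset.sum_ite, Finset.mul_sum, Finset.mul_sum]
      _ ≤ L * 6 ^ d * κ * m + L * (M * V * 3 ^ d) * (2 * τ) := by
          refine add_le_add (mul_le_mul_of_nonneg_left (hPsum _ ?_) (by positivity))
            (mul_le_mul_of_nonneg_left (hQsum _ ?_) (by positivity))
          · intro p hp
            exact (Finset.mem_filter.1 hp).2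
          · intro p hp
            have := Finset.mem_filter.1 hp
            exact (hJ' this.1).resolve_left this.2
      _ ≤ ε / 2 + ε / 2 := by
          refine add_le_add ?_ ?_
          · calc L * 6 ^ d * κ * m = (ε / 2) * (L * 6 ^ d * m) / (L * 6 ^ d * m + 1) := by
                  rw [hκ]; ring
              _ ≤ ε / 2 := by
                  rw [div_le_iff₀ (by positivity)]
                  exact mul_le_mul_of_nonneg_left (by linarith) (by positivity)
          · calc L * (M * V * 3 ^ d) * (2 * τ) = (ε / 2) * (2 * (L * (M * V * 3 ^ d))) /
                    (2 * (L * (M * V * 3 ^ d)) + 1) := by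
                  rw [hτ]; ring
              _ ≤ ε / 2 := by
                  rw [div_le_iff₀ (by positivity)]
                  exact mul_le_mul_of_nonneg_left (by linarith) (by positivity)
      _ = ε := add_halves ε

end ROF

/-! ### Dirichlet boundary and approximation under mixed boundary conditions -/

namespace ROF

variable {d : ℕ} {Ω : Opens (E d)}

/-- A simplex with `n + 1 = d` vertices lies in an affine, hence Lipschitz, image of the unit cube
of `ℝⁿ`, whose `n`-dimensional Hausdorff measure is its Lebesgue measure. -/
lemma hausdorffMeasure_convexHull_lt_top {s : Finset (E d)} (hd : 1 ≤ d) (hs : s.card = d) :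
    (Measure.hausdorffMeasure ((d : ℝ) - 1) : Measure (E d)) (convexHull ℝ (s : Set (E d))) < ∞ := by
  obtain ⟨n, hn⟩ : ∃ n, d = n + 1 := ⟨d - 1, by omega⟩
  have hsn : s.card = n + 1 := hs.trans hn
  let v : Fin (n + 1) → E d := fun i => (s.equivFinOfCardEq hsn).symm i
  let A : (Fin n → ℝ) →ₗ[ℝ] E d := Fintype.linearCombination ℝ fun i => v i.succ - v 0
  let Q : Set (Fin n → ℝ) := Icc 0 1
  have hsub : convexHull ℝ (s : Set (E d)) ⊆ (fun x => v 0 + x) '' (A '' Q) := by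
    refine convexHull_min (fun x hx => ?_) (((convex_Icc 0 1).linear_image A).translate _)
    obtain ⟨i, rfl⟩ : ∃ i, v i = x := ⟨s.equivFinOfCardEq hsn ⟨x, hx⟩, by simp [v]⟩
    refine Fin.cases ?_ (fun j => ?_) i
    · exact ⟨0, ⟨0, ⟨le_rfl, zero_le_one⟩, map_zero A⟩, add_zero _⟩
    · refine ⟨v j.succ - v 0, ⟨Pi.single j 1, ⟨?_, ?_⟩, ?_⟩, add_sub_cancel _ _⟩
      · exact Pi.single_nonneg.2 zero_le_one
      · intro k
        by_cases h : k = j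
        · subst h; simp
        · simp [h]
      · simp [A]
  have hLip : LipschitzWith ‖LinearMap.toContinuousLinearMap A‖₊ A :=
    (LinearMap.toContinuousLinearMap A).lipschitz
  have hdn : (d : ℝ) - 1 = (Fintype.card (Fin n) : ℝ) := by
    rw [Fintype.card_fin, hn]; push_cast; ring
  refine (measure_mono hsub).trans_lt ?_
  rw [(isometry_add_left (v 0)).hausdorffMeasure_image (Or.inl (by rw [hdn]; positivity)), hdn]
  refine (hLip.hausdorffMeasure_image_le (by positivity) Q).trans_lt ?_
  rw [hausdorffMeasure_pi_real]
  exact ENNReal.mul_lt_top (ENNReal.rpow_lt_top_of_nonneg (by positivity) ENNReal.coe_ne_top)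
    isCompact_Icc.measure_lt_top

/-- The Dirichlet boundary is compact, has finite surface measure and does not meet `Ω`. -/
lemma Triangulation.dirichlet_boundary (𝒯 : Triangulation Ω) (hd : 1 ≤ d) {ΓD : Set (E d)}
    (hΓD : ∃ 𝒮 ⊆ 𝒯.boundarySides, ΓD = ⋃ S ∈ 𝒮, convexHull ℝ (S : Set (E d))) :
    IsCompact ΓD ∧ (Measure.hausdorffMeasure ((d : ℝ) - 1) : Measure (E d)) ΓD < ∞ ∧
      Disjoint ΓD Ω := by
  obtain ⟨𝒮, h𝒮, rfl⟩ := hΓD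
  have hfin : 𝒮.Finite := 𝒯.finite.subset (h𝒮.trans (sep_subset _ _))
  refine ⟨hfin.isCompact_biUnion fun S _ => Triangulation.isCompact_convexHull S, ?_, ?_⟩
  · exact measure_biUnion_lt_top hfin fun S hS =>
      hausdorffMeasure_convexHull_lt_top hd (h𝒮 hS).2.1
  · refine Set.disjoint_left.2 fun x hx hxΩ => ?_
    obtain ⟨S, hS, hxS⟩ := mem_iUnion₂.1 hx
    have := (h𝒮 hS).2.2 hxS
    rw [Ω.isOpen.frontier_eq] at this
    exact this.2 hxΩ

/-- The field actually approximated is `χ q`, with `χ` a cut-off near `Γ`. Its divergence `χ p + ∇χ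
· q` tends to `p` when tested with `w`, since `∫ |w| |∇χ|` is small. Without `w` the divergences
need not converge, so the estimate is stated only in integrated form. -/
theorem exists_testFunction_approx_of_zeroTrace (hd : 1 ≤ d) (hΩ : IsBoundedLipschitzDomain Ω)
    {Γ : Set (E d)} (hΓ : IsCompact Γ)
    (hΓμ : (Measure.hausdorffMeasure ((d : ℝ) - 1) : Measure (E d)) Γ < ∞)
    (hΓΩ : Disjoint Γ Ω) {q : E d → E d} {p : E d → ℝ} (hq : MemWDivN Ω Γ q p)
    (hq1 : ∀ᵐ x ∂(volume.restrict (Ω : Set (E d))), ‖q x‖ ≤ 1) {w : E d → ℝ}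
    (hwi : IntegrableOn w Ω) {M : ℝ} (hM0 : 0 ≤ M) (hM : ∀ x ∈ (Ω : Set (E d)), |w x| ≤ M)
    (hw : HasZeroTraceOn Ω Γ w) {ε : ℝ} (hε : 0 < ε) :
    ∃ φ : 𝓓(Ω, E d), (∀ x, ‖φ x‖ ≤ 1 + ε) ∧ ∫ x in (Ω : Set (E d)), ‖φ x - q x‖ ≤ ε ∧
      |(∫ x in (Ω : Set (E d)), w x * divergence φ x) - ∫ x in (Ω : Set (E d)), w x * p x| ≤ ε := by
  have hΩm : MeasurableSet (Ω : Set (E d)) := Ω.isOpen.measurableSet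
  have : IsFiniteMeasure (volume.restrict (Ω : Set (E d))) :=
    ⟨by rw [Measure.restrict_apply_univ]; exact hΩ.bounded.measure_lt_top⟩
  have hqi : IntegrableOn q Ω := hq.memL2.integrable (by norm_num)
  have hpi : IntegrableOn p Ω := hq.div_memL2.integrable (by norm_num)
  have hwM : ∀ᵐ x ∂(volume.restrict (Ω : Set (E d))), ‖w x‖ ≤ M :=
    (ae_restrict_mem hΩm).mono hM
  have hpos : ∀ n : ℕ, (0 : ℝ) < 1 / (n + 1) := fun n => Nat.one_div_pos_of_nat
  choose χ hχs hχ0 hχ1 hχΓ hχ hχw using fun n : ℕ =>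
    exists_cutoff hd hΓ hΓμ hwi hM0 hM hw (hpos n) (hpos n)
  have hχc : ∀ n, Continuous (χ n) := fun n => (hχs n).continuous
  have hχn : ∀ n x, ‖χ n x‖ ≤ 1 := fun n x => by
    rw [Real.norm_of_nonneg (hχ0 n x)]; exact hχ1 n x
  -- `Γ` is closed and misses `Ω`, so each point of `Ω` eventually lies outside the shrinking
  -- neighbourhood where `χ n` may differ from `1`.
  have hχlim : ∀ x ∈ (Ω : Set (E d)), ∀ᶠ n in atTop, χ n x = 1 := by
    intro x hx
    have hxΓ : x ∈ Γᶜ := fun h => Set.disjoint_left.1 hΓΩ h hx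
    obtain ⟨r, hr, hball⟩ := Metric.isOpen_iff.1 hΓ.isClosed.isOpen_compl x hxΓ
    filter_upwards [tendsto_one_div_add_atTop_nhds_zero_nat.eventually_lt_const hr] with n hn
    refine hχ n x fun z hz => ?_
    by_contra hlt
    refine hball (mem_ball.2 ?_) hz
    rw [dist_comm]
    linarith
  have T1 : Tendsto (fun n => ∫ x in (Ω : Set (E d)), ‖χ n x • q x - q x‖) atTop (𝓝 0) := by
    have := tendsto_integral_of_dominated_convergence (μ := volume.restrict (Ω : Set (E d)))
      (F := fun n x => ‖χ n x • q x - q x‖) (f := fun _ => 0) (fun x => ‖q x‖ + ‖q x‖)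
      (fun n => (((hχc n).aestronglyMeasurable.smul hqi.1).sub hqi.1).norm)
      (hqi.norm.add hqi.norm) (fun n => Eventually.of_forall fun x => by
        rw [norm_norm]
        refine (norm_sub_le _ _).trans (add_le_add ?_ le_rfl)
        rw [norm_smul]
        exact mul_le_of_le_one_left (norm_nonneg _) (hχn n x))
      ((ae_restrict_mem hΩm).mono fun x hx => tendsto_const_nhds.congr'
        ((hχlim x hx).mono fun n hn => by simp [hn]))
    simpa using this
  have T2 : Tendsto (fun n => ∫ x in (Ω : Set (E d)), w x * (χ n x * p x)) atTop
      (𝓝 (∫ x in (Ω : Set (E d)), w x * p x)) := by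
    refine tendsto_integral_of_dominated_convergence (fun x => M * ‖p x‖)
      (fun n => hwi.1.mul ((hχc n).aestronglyMeasurable.mul hpi.1)) (hpi.norm.const_mul M)
      (fun n => hwM.mono fun x hx => ?_)
      ((ae_restrict_mem hΩm).mono fun x hx => tendsto_const_nhds.congr'
        ((hχlim x hx).mono fun n hn => by simp [hn]))
    rw [norm_mul, norm_mul]
    exact mul_le_mul hx (mul_le_of_le_one_left (norm_nonneg _) (hχn n x)) (by positivity) hM0
  have hε3 : 0 < ε / 3 := by positivity
  obtain ⟨n, hn1, hn2, hn3⟩ := ((T1.eventually_lt_const hε3).and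
    ((Metric.tendsto_nhds.1 T2 _ hε3).and
      (tendsto_one_div_add_atTop_nhds_zero_nat.eventually_lt_const hε3))).exists
  obtain ⟨C, hC⟩ := hΩ.bounded.isCompact_closure.exists_bound_of_continuousOn
    (continuous_gradient (hχs n)).continuousOn
  have hC' : ∀ᵐ x ∂(volume.restrict (Ω : Set (E d))), ‖∇ (χ n) x‖ ≤ C :=
    (ae_restrict_mem hΩm).mono fun x hx => hC x (subset_closure hx)
  have hgm : AEStronglyMeasurable (∇ (χ n)) (volume.restrict (Ω : Set (E d))) :=
    (continuous_gradient (hχs n)).aestronglyMeasurable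
  have hgq : IntegrableOn (fun x => ⟪∇ (χ n) x, q x⟫) Ω := by
    refine (hqi.norm.const_mul C).mono' (hgm.inner hqi.1) (hC'.mono fun x hx => ?_)
    exact (norm_inner_le_norm _ _).trans (mul_le_mul_of_nonneg_right hx (norm_nonneg _))
  have hχq : IntegrableOn (fun x => χ n x • q x) Ω :=
    Integrable.bdd_smul hqi 1 (hχc n).aestronglyMeasurable (Eventually.of_forall (hχn n))
  have hχp : IntegrableOn (fun x => χ n x * p x) Ω :=
    Integrable.bdd_mul hpi (hχc n).aestronglyMeasurable (Eventually.of_forall (hχn n))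
  have hp' : IntegrableOn (fun x => χ n x * p x + ⟪∇ (χ n) x, q x⟫) Ω := hχp.add hgq
  -- For arbitrary smooth `φ`, the product `χ n * φ` vanishes near `Γ` and is admissible in the weak
  -- normal trace condition. So `χ n • q` has zero normal trace on the whole boundary.
  have hgreen : ∀ φ : 𝓓((⊤ : Opens (E d)), ℝ),
      ∫ x in (Ω : Set (E d)), ⟪χ n x • q x, ∇ φ x⟫ =
        -∫ x in (Ω : Set (E d)), (χ n x * p x + ⟪∇ (χ n) x, q x⟫) * φ x := by
    intro φ
    let Φ : 𝓓((⊤ : Opens (E d)), ℝ) :=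
      { toFun := fun x => χ n x * φ x
        contDiff' := (hχs n).mul φ.contDiff
        hasCompactSupport' := φ.hasCompactSupport.mul_left
        tsupport_subset' := subset_univ _ }
    have h := hq.normalTrace Φ ((hχΓ n).mono_left (tsupport_mul_subset_left (f := χ n) (g := φ)))
    have hgrad : ∀ x, ∇ Φ x = χ n x • ∇ φ x + φ x • ∇ (χ n) x := fun x =>
      gradient_mul ((hχs n).differentiable (by simp) x) (φ.contDiff.differentiable (by simp) x)
    obtain ⟨D, hD⟩ := φ.continuous.bounded_above_of_compact_support φ.hasCompactSupport
    obtain ⟨D', hD'⟩ := (continuous_gradient φ.contDiff).bounded_above_of_compact_support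
      (φ.hasCompactSupport.of_isClosed_subset (isClosed_tsupport _)
        (closure_minimal (support_gradient_subset φ) (isClosed_tsupport _)))
    have j1 : IntegrableOn (fun x => ⟪χ n x • q x, ∇ φ x⟫) Ω := by
      refine (hχq.norm.mul_const D').mono' (hχq.1.inner
        (continuous_gradient φ.contDiff).aestronglyMeasurable) (Eventually.of_forall fun x => ?_)
      exact (norm_inner_le_norm _ _).trans (mul_le_mul_of_nonneg_left (hD' x) (norm_nonneg _))
    have j2 : IntegrableOn (fun x => ⟪∇ (χ n) x, q x⟫ * φ x) Ω :=
      hgq.mul_bdd φ.continuous.aestronglyMeasurable (Eventually.of_forall hD)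
    have j3 : IntegrableOn (fun x => χ n x * p x * φ x) Ω :=
      hχp.mul_bdd φ.continuous.aestronglyMeasurable (Eventually.of_forall hD)
    have e1 : ∀ x, ⟪q x, ∇ Φ x⟫ = ⟪χ n x • q x, ∇ φ x⟫ + ⟪∇ (χ n) x, q x⟫ * φ x := fun x => by
      rw [hgrad, inner_add_right, inner_smul_right, inner_smul_right, real_inner_smul_left,
        real_inner_comm (∇ (χ n) x), mul_comm (φ x)]
    have e2 : ∀ x, p x * Φ x = χ n x * p x * φ x := fun x => by
      change p x * (χ n x * φ x) = _
      ring
    simp_rw [e1, e2] at h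
    rw [integral_add j1 j2] at h
    simp_rw [add_mul]
    rw [integral_add j3 j2]
    linarith
  -- The `L¹` error of the divergence is multiplied by `|w| ≤ M`; this tolerance leaves at most `ε /
  -- 3`.
  have hε' : 0 < ε / (3 * (M + 1)) := by positivity
  have hε'le : ε / (3 * (M + 1)) ≤ ε / 3 :=
    div_le_div_of_nonneg_left hε.le (by norm_num) (by linarith)
  obtain ⟨φ, hφ1, hφq, hφp⟩ := exists_testFunction_approx hΩ hχq hp'
    (hq1.mono fun x hx => by
      rw [norm_smul]
      exact mul_le_one₀ (hχn n x) (norm_nonneg _) hx) hgreen hε'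
  obtain ⟨D, hD⟩ := φ.continuous.bounded_above_of_compact_support φ.hasCompactSupport
  have hφi : IntegrableOn φ Ω :=
    (φ.continuous.integrable_of_hasCompactSupport φ.hasCompactSupport).integrableOn
  have hdi : IntegrableOn (divergence φ) Ω :=
    (integrable_divergence φ.contDiff φ.hasCompactSupport).2.integrableOn
  refine ⟨φ, fun x => (hφ1 x).trans (by linarith), ?_, ?_⟩
  · calc ∫ x in (Ω : Set (E d)), ‖φ x - q x‖
        ≤ ∫ x in (Ω : Set (E d)), (‖φ x - χ n x • q x‖ + ‖χ n x • q x - q x‖) :=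
          integral_mono (hφi.sub hqi).norm ((hφi.sub hχq).norm.add (hχq.sub hqi).norm)
            fun x => norm_sub_le_norm_sub_add_norm_sub _ _ _
      _ = (∫ x in (Ω : Set (E d)), ‖φ x - χ n x • q x‖) +
            ∫ x in (Ω : Set (E d)), ‖χ n x • q x - q x‖ :=
          integral_add (hφi.sub hχq).norm (hχq.sub hqi).norm
      _ ≤ ε := by linarith
  · have k1 : IntegrableOn (fun x => w x * divergence φ x) Ω :=
      Integrable.bdd_mul hdi hwi.1 hwM
    have k2 : IntegrableOn (fun x => w x * (χ n x * p x)) Ω := Integrable.bdd_mul hχp hwi.1 hwM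
    have k3 : IntegrableOn (fun x => w x * ⟪∇ (χ n) x, q x⟫) Ω :=
      Integrable.bdd_mul hgq hwi.1 hwM
    have k4 : IntegrableOn (fun x => divergence φ x - (χ n x * p x + ⟪∇ (χ n) x, q x⟫)) Ω :=
      hdi.sub hp'
    have e : (∫ x in (Ω : Set (E d)), w x * divergence φ x) - ∫ x in (Ω : Set (E d)), w x * p x =
        (∫ x in (Ω : Set (E d)), w x * (divergence φ x - (χ n x * p x + ⟪∇ (χ n) x, q x⟫))) +
        ((∫ x in (Ω : Set (E d)), w x * (χ n x * p x)) - ∫ x in (Ω : Set (E d)), w x * p x) +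
        ∫ x in (Ω : Set (E d)), w x * ⟪∇ (χ n) x, q x⟫ := by
      have : ∫ x in (Ω : Set (E d)),
          w x * (divergence φ x - (χ n x * p x + ⟪∇ (χ n) x, q x⟫)) =
          (∫ x in (Ω : Set (E d)), w x * divergence φ x) -
          ((∫ x in (Ω : Set (E d)), w x * (χ n x * p x)) +
            ∫ x in (Ω : Set (E d)), w x * ⟪∇ (χ n) x, q x⟫) := by
        have k23 : IntegrableOn (fun x => w x * (χ n x * p x) + w x * ⟪∇ (χ n) x, q x⟫) Ω :=
          k2.add k3
        rw [← integral_add k2 k3, ← integral_sub k1 k23]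
        congr 1
        ext x
        ring
      rw [this]; ring
    have b1 : |∫ x in (Ω : Set (E d)),
        w x * (divergence φ x - (χ n x * p x + ⟪∇ (χ n) x, q x⟫))| ≤ M * (ε / (3 * (M + 1))) := by
      rw [← Real.norm_eq_abs]
      refine (norm_integral_le_of_norm_le (k4.norm.const_mul M) (hwM.mono fun x hx => ?_)).trans ?_
      · rw [norm_mul]
        exact mul_le_mul_of_nonneg_right hx (norm_nonneg _)
      · rw [integral_const_mul]
        exact mul_le_mul_of_nonneg_left hφp hM0
    have b2 : |∫ x in (Ω : Set (E d)), w x * ⟪∇ (χ n) x, q x⟫| ≤ ε / 3 := by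
      have hwg : IntegrableOn (fun x => |w x| * ‖∇ (χ n) x‖) Ω :=
        Integrable.mul_bdd hwi.abs hgm.norm (hC'.mono fun x hx => by rwa [norm_norm])
      rw [← Real.norm_eq_abs]
      refine (norm_integral_le_of_norm_le hwg (hq1.mono fun x hx => ?_)).trans
        ((hχw n).trans hn3.le)
      rw [norm_mul]
      refine mul_le_mul_of_nonneg_left ?_ (abs_nonneg _)
      exact (norm_inner_le_norm _ _).trans (mul_le_of_le_one_right (norm_nonneg _) hx)
    have b3 : M * (ε / (3 * (M + 1))) ≤ ε / 3 := by
      rw [mul_div_assoc', div_le_div_iff₀ (by positivity) (by norm_num)]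
      nlinarith
    rw [Real.dist_eq] at hn2
    rw [e]
    refine (abs_add_three _ _ _).trans ?_
    linarith

end ROF

namespace ROF

variable {d : ℕ} {Ω : Opens (E d)}

/-! ### Weak duality -/

lemma HasZeroTraceOn.mono {Γ : Set (E d)} {v w : E d → ℝ} (hv : HasZeroTraceOn Ω Γ v)
    (hvi : IntegrableOn v Ω) (hwv : ∀ x, |w x| ≤ |v x|) : HasZeroTraceOn Ω Γ w := by
  refine Eventually.mono hv fun x hx => squeeze_zero' ?_ ?_ hx
  · filter_upwards [self_mem_nhdsWithin] with r (hr : 0 < r)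
    exact mul_nonneg (by positivity) (integral_nonneg fun _ => abs_nonneg _)
  · filter_upwards [self_mem_nhdsWithin] with r (hr : 0 < r)
    refine mul_le_mul_of_nonneg_left ?_ (by positivity)
    refine integral_mono_of_nonneg (Eventually.of_forall fun _ => abs_nonneg _)
      (IntegrableOn.mono_set (show IntegrableOn (fun y => |v y|) Ω volume from hvi.abs)
        inter_subset_right) (Eventually.of_forall hwv)

/-- For bounded functions the approximating test fields give the bound up to the factor `1 + η`. In
general `v` is replaced by smooth bounded truncations, which keep the zero trace and do not increase
the variation; dominated convergence removes them. -/
theorem neg_integral_mul_le_totalVariation (hd : 1 ≤ d) (hΩ : IsBoundedLipschitzDomain Ω)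
    {Γ : Set (E d)} (hΓ : IsCompact Γ)
    (hΓμ : (Measure.hausdorffMeasure ((d : ℝ) - 1) : Measure (E d)) Γ < ∞)
    (hΓΩ : Disjoint Γ Ω) {q : E d → E d} {p : E d → ℝ} (hq : MemWDivN Ω Γ q p)
    (hq1 : ∀ᵐ x ∂(volume.restrict (Ω : Set (E d))), ‖q x‖ ≤ 1) {v : E d → ℝ}
    (hv : IsAdmissible Ω Γ v) :
    -∫ x in (Ω : Set (E d)), v x * p x ≤ (totalVariation Ω v).toReal := by
  have hvi : IntegrableOn v Ω := hv.memBV.1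
  have hlip : ∀ a b : ℝ, |Real.sin a - Real.sin b| ≤ |a - b| := by
    intro a b
    have := (lipschitzWith_of_nnnorm_deriv_le (C := 1) Real.differentiable_sin
      fun s => by simpa [← NNReal.coe_le_coe] using Real.abs_cos_le_one s).dist_le_mul a b
    simpa [Real.dist_eq] using this
  -- A scaled sine is a smooth truncation: it is bounded by `n + 1`, has slope in `[-1, 1]`,
  -- vanishes at `0`, is dominated by `|s|`, and tends to `s`.
  let H : ℕ → ℝ → ℝ := fun n s => ((n : ℝ) + 1) * Real.sin (((n : ℝ) + 1)⁻¹ * s)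
  have hn : ∀ n : ℕ, (0 : ℝ) < (n : ℝ) + 1 := fun n => by positivity
  have hHs : ∀ n, ContDiff ℝ (⊤ : ℕ∞) (H n) := fun n =>
    contDiff_const.mul (Real.contDiff_sin.comp (contDiff_const.mul contDiff_id))
  have hHd : ∀ n s, deriv (H n) s = Real.cos (((n : ℝ) + 1)⁻¹ * s) := by
    intro n s
    have h : HasDerivAt (H n) _ s :=
      (((hasDerivAt_id s).const_mul ((n : ℝ) + 1)⁻¹).sin).const_mul ((n : ℝ) + 1)
    rw [h.deriv]
    field_simp [(hn n).ne']
    simp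
  have hHv : ∀ n s, |H n s| ≤ |s| := by
    intro n s
    simp only [H, abs_mul, abs_of_pos (hn n)]
    have := hlip (((n : ℝ) + 1)⁻¹ * s) 0
    rw [Real.sin_zero, sub_zero, sub_zero, abs_mul, abs_of_pos (inv_pos.2 (hn n))] at this
    rwa [← le_inv_mul_iff₀ (hn n)]
  have hHM : ∀ n s, |H n s| ≤ (n : ℝ) + 1 := by
    intro n s
    simp only [H, abs_mul, abs_of_pos (hn n)]
    exact mul_le_of_le_one_right (hn n).le (Real.abs_sin_le_one _)
  have hHlim : ∀ s, Tendsto (fun n => H n s) atTop (𝓝 s) := by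
    intro s
    have h1 := (Real.hasDerivAt_sin 0).hasFDerivAt.lim_real s
    have h2 : Tendsto (fun n : ℕ => (n : ℝ) + 1) atTop atTop :=
      tendsto_atTop_add_const_right _ _ tendsto_natCast_atTop_atTop
    simpa [H, Function.comp_def] using h1.comp h2
  have hTV : ∀ n, totalVariation Ω (fun x => H n (v x)) ≤ totalVariation Ω v := fun n =>
    totalVariation_comp_le hvi (hHs n) (fun s => by rw [hHd]; exact Real.abs_cos_le_one _)
      (by simp [H])
  have hHm : ∀ n, AEStronglyMeasurable (fun x => H n (v x)) (volume.restrict (Ω : Set (E d))) :=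
    fun n => (hHs n).continuous.comp_aestronglyMeasurable hvi.1
  have hbd : ∀ n, -∫ x in (Ω : Set (E d)), H n (v x) * p x ≤ (totalVariation Ω v).toReal := by
    intro n
    have hwi : IntegrableOn (fun x => H n (v x)) Ω :=
      hvi.norm.mono' (hHm n) (Eventually.of_forall fun x => hHv n _)
    have hTn : (totalVariation Ω fun x => H n (v x)).toReal ≤ (totalVariation Ω v).toReal :=
      ENNReal.toReal_mono hv.memBV.2.ne (hTV n)
    have hT0 : 0 ≤ (totalVariation Ω v).toReal := ENNReal.toReal_nonneg
    refine le_of_forall_pos_le_add fun ε hε => ?_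
    set η := ε / ((totalVariation Ω v).toReal + 1) with hη
    have hη0 : 0 < η := by positivity
    obtain ⟨φ, hφ1, -, hφ⟩ := exists_testFunction_approx_of_zeroTrace hd hΩ hΓ hΓμ hΓΩ hq hq1 hwi
      (hn n).le (fun x _ => hHM n _) (hv.zeroTrace.mono hvi fun x => hHv n _) hη0
    have h1 := neg_integral_le_totalVariation ((hTV n).trans_lt hv.memBV.2) φ (by positivity) hφ1
    have h2 : (1 + η) * (totalVariation Ω fun x => H n (v x)).toReal ≤
        (1 + η) * (totalVariation Ω v).toReal := by gcongr
    have h3 : η * ((totalVariation Ω v).toReal + 1) = ε := by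
      rw [hη]; field_simp
    rw [abs_le] at hφ
    nlinarith [hφ.1, hφ.2]
  have hvp : Integrable (fun x => v x * p x) (volume.restrict (Ω : Set (E d))) :=
    hv.memL2.integrable_mul hq.div_memL2
  refine le_of_tendsto' (f := fun n => -∫ x in (Ω : Set (E d)), H n (v x) * p x) (x := atTop)
    (Tendsto.neg ?_) hbd
  refine tendsto_integral_of_dominated_convergence (fun x => ‖v x * p x‖)
    (fun n => (hHm n).mul hq.div_memL2.1) hvp.norm
    (fun n => Eventually.of_forall fun x => ?_)
    (Eventually.of_forall fun x => (hHlim _).mul_const _)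
  calc ‖H n (v x) * p x‖ = |H n (v x)| * ‖p x‖ := norm_mul _ _
    _ ≤ |v x| * ‖p x‖ := mul_le_mul_of_nonneg_right (hHv n (v x)) (norm_nonneg (p x))
    _ = ‖v x * p x‖ := (norm_mul (v x) (p x)).symm

end ROF

namespace ROF

variable {d : ℕ} {Ω : Opens (E d)}

/-! ### Continuous piecewise affine functions -/

lemma exists_inner_add_eq (A : E d →ᵃ[ℝ] ℝ) : ∃ (a : E d) (c : ℝ), ∀ x, A x = ⟪a, x⟫ + c := by
  refine ⟨(InnerProductSpace.toDual ℝ (E d)).symm (LinearMap.toContinuousLinearMap A.linear), A 0,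
    fun x => ?_⟩
  rw [InnerProductSpace.toDual_symm_apply]
  simpa using congrFun A.decomp x

namespace Triangulation.MemP1

variable {𝒯 : Triangulation Ω} {ΓD : Set (E d)} {v : E d → ℝ}

/-- The elementwise gradients `a T` of a piecewise affine function, with a uniform bound. -/
lemma exists_elementwise_gradient (hv : 𝒯.MemP1 ΓD v) :
    ∃ (a : Finset (E d) → E d) (L : ℝ), 0 ≤ L ∧
      (∀ T ∈ 𝒯.elements, ∀ x ∈ interior (convexHull ℝ (T : Set (E d))), HasGradientAt v (a T) x) ∧
      (∀ T ∈ 𝒯.elements, ‖a T‖ ≤ L) ∧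
      ∀ T ∈ 𝒯.elements, ∀ x ∈ convexHull ℝ (T : Set (E d)), ∀ y ∈ convexHull ℝ (T : Set (E d)),
        |v x - v y| ≤ L * ‖x - y‖ := by
  have h : ∀ T ∈ 𝒯.elements, ∃ (a : E d) (c : ℝ),
      ∀ x ∈ convexHull ℝ (T : Set (E d)), v x = ⟪a, x⟫ + c := by
    intro T hT
    obtain ⟨A, hA⟩ := hv.affine T hT
    obtain ⟨a, c, h⟩ := exists_inner_add_eq A
    exact ⟨a, c, fun x hx => (hA hx).trans (h x)⟩
  choose! a c hac using h
  have hL : ∀ T ∈ 𝒯.elements, ‖a T‖ ≤ ∑ T ∈ 𝒯.elements, ‖a T‖ := fun T hT =>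
    Finset.single_le_sum (f := fun T => ‖a T‖) (fun _ _ => norm_nonneg _) hT
  refine ⟨a, ∑ T ∈ 𝒯.elements, ‖a T‖, Finset.sum_nonneg fun _ _ => norm_nonneg _,
    fun T hT x hx => ?_, hL, fun T hT x hx y hy => ?_⟩
  · have h1 : HasGradientAt (fun y => ⟪a T, y⟫ + c T) (a T) x := by
      rw [hasGradientAt_iff_hasFDerivAt]
      exact (InnerProductSpace.toDual ℝ (E d) (a T)).hasFDerivAt.add_const _
    refine h1.congr_of_eventuallyEq ?_
    filter_upwards [isOpen_interior.mem_nhds hx] with y hy using hac T hT y (interior_subset hy)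
  · rw [hac T hT x hx, hac T hT y hy, add_sub_add_right_eq_sub, ← inner_sub_right]
    exact (abs_real_inner_le_norm _ _).trans
      (mul_le_mul_of_nonneg_right (hL T hT) (norm_nonneg _))

/-- The parameters for which the bound holds form a closed set. It can be continued to the right,
because points just after `γ t` lie in an element that also contains `γ t`, where the elementwise
bound applies. -/
lemma abs_sub_le_of_segment (hv : 𝒯.MemP1 ΓD v) {L : ℝ}
    (hL : ∀ T ∈ 𝒯.elements, ∀ x ∈ convexHull ℝ (T : Set (E d)),
      ∀ y ∈ convexHull ℝ (T : Set (E d)), |v x - v y| ≤ L * ‖x - y‖) {x y : E d}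
    (hxy : segment ℝ x y ⊆ closure (Ω : Set (E d))) : |v x - v y| ≤ L * ‖x - y‖ := by
  set γ : ℝ → E d := ⇑(AffineMap.lineMap (k := ℝ) x y) with hγ
  have hγc : Continuous γ := AffineMap.lineMap_continuous
  have hγΩ : ∀ t ∈ Icc (0 : ℝ) 1, γ t ∈ closure (Ω : Set (E d)) := fun t ht =>
    hxy (segment_eq_image_lineMap ℝ x y ▸ mem_image_of_mem _ ht)
  have hγd : ∀ s t : ℝ, ‖γ s - γ t‖ = |s - t| * ‖x - y‖ := by
    intro s t
    rw [← dist_eq_norm, dist_lineMap_lineMap, Real.dist_eq, dist_eq_norm]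
  have hf : ContinuousOn (fun t => v (γ t)) (Icc 0 1) :=
    hv.continuousOn.comp hγc.continuousOn hγΩ
  set s : Set ℝ := {t | |v (γ t) - v (γ 0)| ≤ L * (t * ‖x - y‖)} with hs
  have hclosed : IsClosed (s ∩ Icc 0 1) := by
    have h1 : ContinuousOn (fun t => L * (t * ‖x - y‖) - |v (γ t) - v (γ 0)|) (Icc 0 1) :=
      (by fun_prop : Continuous fun t : ℝ => L * (t * ‖x - y‖)).continuousOn.sub
        (hf.sub continuousOn_const).abs
    have h2 := h1.preimage_isClosed_of_isClosed isClosed_Icc (isClosed_Ici (a := 0))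
    convert h2 using 1
    ext t
    simp [hs, and_comm]
  have hsub : Icc (0 : ℝ) 1 ⊆ s := by
    refine hclosed.Icc_subset_of_forall_exists_gt (by simp [hs]) fun t ht τ hτ => ?_
    -- The finitely many elements missing `γ t` form a closed set, which the path avoids for a
    -- while.
    set Z : Set (E d) := ⋃ T ∈ {T : Finset (E d) | T ∈ 𝒯.elements ∧
      γ t ∉ convexHull ℝ (T : Set (E d))}, convexHull ℝ (T : Set (E d))
    have hZc : IsClosed Z := by
      refine Set.Finite.isClosed_biUnion (𝒯.elements.finite_toSet.subset fun T hT => hT.1) fun T _ =>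
        (Triangulation.isCompact_convexHull T).isClosed
    have htZ : γ t ∉ Z := by
      intro h
      obtain ⟨T, hT, htT⟩ := mem_iUnion₂.1 h
      exact hT.2 htT
    have hev : ∀ᶠ r in 𝓝[>] t, γ r ∉ Z := Eventually.filter_mono nhdsWithin_le_nhds
      (hγc.continuousAt.eventually_mem (hZc.isOpen_compl.mem_nhds htZ))
    obtain ⟨r, hr, hrI⟩ := (hev.and (Ioo_mem_nhdsGT (lt_min hτ ht.2.2))).exists
    have hr1 : r ∈ Icc (0 : ℝ) 1 :=
      ⟨ht.2.1.trans hrI.1.le, (hrI.2.trans_le (min_le_right _ _)).le⟩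
    have hrΩ := hγΩ r hr1
    rw [𝒯.closure_eq_biUnion] at hrΩ
    obtain ⟨T, hT, hrT⟩ := mem_iUnion₂.1 hrΩ
    have htT : γ t ∈ convexHull ℝ (T : Set (E d)) := by
      by_contra h
      exact hr (mem_iUnion₂.2 ⟨T, ⟨hT, h⟩, hrT⟩)
    refine ⟨r, ?_, hrI.1, (hrI.2.trans_le (min_le_left _ _)).le⟩
    have h1 := hL T hT _ hrT _ htT
    rw [hγd, abs_of_pos (sub_pos.2 hrI.1)] at h1
    have h2 : |v (γ t) - v (γ 0)| ≤ L * (t * ‖x - y‖) := ht.1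
    change |v (γ r) - v (γ 0)| ≤ L * (r * ‖x - y‖)
    have h3 := abs_sub_le (v (γ r)) (v (γ t)) (v (γ 0))
    nlinarith
  have h1 := hsub (right_mem_Icc.2 zero_le_one)
  have h2 : |v (γ 1) - v (γ 0)| ≤ L * (1 * ‖x - y‖) := h1
  rw [one_mul, hγ, AffineMap.lineMap_apply_one, AffineMap.lineMap_apply_zero, abs_sub_comm] at h2
  exact h2

lemma exists_bound (hΩ : IsBoundedLipschitzDomain Ω) (hv : 𝒯.MemP1 ΓD v) :
    ∃ M, 0 ≤ M ∧ ∀ x ∈ closure (Ω : Set (E d)), |v x| ≤ M := by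
  obtain ⟨M, hM⟩ := hΩ.bounded.isCompact_closure.exists_bound_of_continuousOn hv.continuousOn
  exact ⟨max M 0, le_max_right _ _, fun x hx => (hM x hx).trans (le_max_left _ _)⟩

/-- `Ω` need not be convex, so `v` is compared only along segments inside a ball contained in `Ω`.
Points at distance at least `δ` are handled by boundedness, which produces the term `2 M N / δ`. Off
`tsupport f` the values of `v` do not matter. -/
lemma exists_lipschitzWith_mul (hΩ : IsBoundedLipschitzDomain Ω) (hv : 𝒯.MemP1 ΓD v)
    {f : E d → ℝ} (hf : ContDiff ℝ (⊤ : ℕ∞) f) (hfc : HasCompactSupport f)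
    (hfΩ : tsupport f ⊆ Ω) : ∃ C, LipschitzWith C fun x => v x * f x := by
  obtain ⟨a, L, hL0, -, -, hL⟩ := hv.exists_elementwise_gradient
  obtain ⟨M, hM0, hM⟩ := hv.exists_bound hΩ
  obtain ⟨N, hN⟩ := hf.continuous.bounded_above_of_compact_support hfc
  have hN0 : 0 ≤ N := (norm_nonneg _).trans (hN 0)
  obtain ⟨D, hD⟩ := ContDiff.lipschitzWith_of_hasCompactSupport hfc hf (by simp)
  obtain ⟨δ, hδ, hδΩ⟩ := hfc.isCompact.exists_thickening_subset_open Ω.isOpen hfΩ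
  have hg0 : ∀ x ∉ tsupport f, v x * f x = 0 := fun x hx => by
    rw [image_eq_zero_of_notMem_tsupport hx, mul_zero]
  have hgb : ∀ x, |v x * f x| ≤ M * N := by
    intro x
    by_cases hx : x ∈ tsupport f
    · rw [abs_mul]
      exact mul_le_mul (hM x (subset_closure (hfΩ hx))) (hN x) (abs_nonneg _) hM0
    · rw [hg0 x hx, abs_zero]
      positivity
  set C : ℝ := M * D + N * L + 2 * M * N / δ with hC
  have hC0 : 0 ≤ C := by positivity
  have key : ∀ x ∈ tsupport f, ∀ y, |v x * f x - v y * f y| ≤ C * ‖x - y‖ := by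
    intro x hx y
    rcases lt_or_ge ‖x - y‖ δ with h | h
    · have hball : ball x δ ⊆ (Ω : Set (E d)) := (ball_subset_thickening hx δ).trans hδΩ
      have hy : y ∈ ball x δ := by rwa [mem_ball, dist_comm, dist_eq_norm]
      have hseg : segment ℝ x y ⊆ closure (Ω : Set (E d)) :=
        ((convex_ball x δ).segment_subset (mem_ball_self hδ) hy).trans
          (hball.trans subset_closure)
      have h1 := hv.abs_sub_le_of_segment hL hseg
      have h2 : |f x - f y| ≤ D * ‖x - y‖ := by
        simpa [Real.dist_eq, dist_eq_norm] using hD.dist_le_mul x y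
      have h3 := hM x (subset_closure (hfΩ hx))
      have h4 : |f y| ≤ N := hN y
      have e : v x * f x - v y * f y = v x * (f x - f y) + f y * (v x - v y) := by ring
      calc |v x * f x - v y * f y| ≤ |v x| * |f x - f y| + |f y| * |v x - v y| := by
            rw [e, ← abs_mul, ← abs_mul]; exact abs_add_le _ _
        _ ≤ M * (D * ‖x - y‖) + N * (L * ‖x - y‖) := by gcongr
        _ = (M * D + N * L) * ‖x - y‖ := by ring
        _ ≤ C * ‖x - y‖ := by
            refine mul_le_mul_of_nonneg_right ?_ (norm_nonneg _)
            rw [hC]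
            have : 0 ≤ 2 * M * N / δ := by positivity
            linarith
    · calc |v x * f x - v y * f y| ≤ |v x * f x| + |v y * f y| := abs_sub _ _
        _ ≤ 2 * M * N / δ * δ := by
            rw [div_mul_cancel₀ _ hδ.ne']
            have := hgb x
            have := hgb y
            linarith
        _ ≤ C * ‖x - y‖ := by
            refine mul_le_mul ?_ h hδ.le hC0
            rw [hC]
            have : 0 ≤ M * D + N * L := by positivity
            linarith
  refine ⟨⟨C, hC0⟩, LipschitzWith.of_dist_le_mul fun x y => ?_⟩
  rw [Real.dist_eq, dist_eq_norm]
  change _ ≤ C * _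
  by_cases hx : x ∈ tsupport f
  · exact key x hx y
  · by_cases hy : y ∈ tsupport f
    · rw [abs_sub_comm, norm_sub_rev]
      exact key y hy x
    · rw [hg0 x hx, hg0 y hy, sub_self, abs_zero]
      positivity

lemma integrableOn (hΩ : IsBoundedLipschitzDomain Ω) (hv : 𝒯.MemP1 ΓD v) :
    IntegrableOn v Ω :=
  (hv.continuousOn.integrableOn_compact hΩ.bounded.isCompact_closure).mono_set subset_closure

lemma memLp (hΩ : IsBoundedLipschitzDomain Ω) (hv : 𝒯.MemP1 ΓD v) :
    MemLp v 2 (volume.restrict (Ω : Set (E d))) := by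
  have : IsFiniteMeasure (volume.restrict (Ω : Set (E d))) :=
    ⟨by rw [Measure.restrict_apply_univ]; exact hΩ.bounded.measure_lt_top⟩
  obtain ⟨M, -, hM⟩ := hv.exists_bound hΩ
  exact MemLp.of_bound (hv.integrableOn hΩ).1 M
    ((ae_restrict_mem Ω.isOpen.measurableSet).mono fun x hx => hM x (subset_closure hx))

/-- The gradient of a piecewise affine function is bounded and measurable. -/
lemma gradient_bound (hΩ : IsBoundedLipschitzDomain Ω) (hv : 𝒯.MemP1 ΓD v) :
    AEStronglyMeasurable (∇ v) (volume.restrict (Ω : Set (E d))) ∧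
      (∃ L, 0 ≤ L ∧ ∀ᵐ x ∂(volume.restrict (Ω : Set (E d))), ‖∇ v x‖ ≤ L) ∧
      ∀ᵐ x ∂(volume.restrict (Ω : Set (E d))), DifferentiableAt ℝ v x := by
  obtain ⟨a, L, hL0, ha, haL, -⟩ := hv.exists_elementwise_gradient
  refine ⟨?_, ⟨L, hL0, ?_⟩, ?_⟩
  · refine ⟨fun x => ∑ T ∈ 𝒯.elements,
      (interior (convexHull ℝ (T : Set (E d)))).indicator (fun _ => a T) x,
      Finset.stronglyMeasurable_fun_sum _ fun T _ =>
        stronglyMeasurable_const.indicator isOpen_interior.measurableSet, ?_⟩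
    filter_upwards [𝒯.ae_mem_interior hΩ] with x hx
    obtain ⟨T, hT, hxT⟩ := hx
    rw [(ha T hT x hxT).gradient, Finset.sum_eq_single_of_mem T hT, indicator_of_mem hxT]
    exact fun T' hT' hne => indicator_of_notMem
      (fun hx' => (𝒯.disjoint_interior hT' hT hne).ne_of_mem hx' hxT rfl) _
  · filter_upwards [𝒯.ae_mem_interior hΩ] with x hx
    obtain ⟨T, hT, hxT⟩ := hx
    rw [(ha T hT x hxT).gradient]
    exact haL T hT
  · filter_upwards [𝒯.ae_mem_interior hΩ] with x hx
    obtain ⟨T, hT, hxT⟩ := hx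
    exact (ha T hT x hxT).differentiableAt

/-- Each product `v * φ i` is Lipschitz with compact support, so its partial derivatives integrate
to zero; the product rule holds almost everywhere. No interelement jump terms have to be tracked. -/
theorem integral_mul_divergence (hΩ : IsBoundedLipschitzDomain Ω) (hv : 𝒯.MemP1 ΓD v)
    (φ : 𝓓(Ω, E d)) :
    -∫ x in (Ω : Set (E d)), v x * divergence φ x = ∫ x in (Ω : Set (E d)), ⟪∇ v x, φ x⟫ := by
  have hΩm : MeasurableSet (Ω : Set (E d)) := Ω.isOpen.measurableSet
  obtain ⟨hgm, ⟨L, hL0, hgL⟩, hdiff⟩ := hv.gradient_bound hΩ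
  obtain ⟨M, hM0, hM⟩ := hv.exists_bound hΩ
  have hφi : ∀ i : Fin d, ContDiff ℝ (⊤ : ℕ∞) fun x => φ x i := fun i =>
    (EuclideanSpace.proj (𝕜 := ℝ) i).contDiff.comp φ.contDiff
  have hφic : ∀ i : Fin d, HasCompactSupport fun x => φ x i := fun i =>
    φ.hasCompactSupport.comp_left (g := fun y : E d => y i) rfl
  have hφiΩ : ∀ i : Fin d, tsupport (fun x => φ x i) ⊆ Ω := fun i =>
    (closure_mono fun x (hx : φ x i ≠ 0) (h : φ x = 0) => hx (by simp [h])).trans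
      φ.tsupport_subset
  have hder : ∀ (i : Fin d) x u, fderiv ℝ (fun x => φ x i) x u = (fderiv ℝ φ x u) i := by
    intro i x u
    have h : HasFDerivAt (fun x => φ x i) _ x :=
      (EuclideanSpace.proj (𝕜 := ℝ) i).hasFDerivAt.comp x
        (φ.contDiff.differentiable (by simp) x).hasFDerivAt
    rw [h.fderiv]; rfl
  let G : Fin d → E d → ℝ := fun i x => (∇ v x) i * φ x i +
    v x * (fderiv ℝ φ x (EuclideanSpace.single i 1)) i
  have key : ∀ i : Fin d, ∫ x in (Ω : Set (E d)), G i x = 0 := by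
    intro i
    obtain ⟨C, hC⟩ := hv.exists_lipschitzWith_mul hΩ (hφi i) (hφic i) (hφiΩ i)
    -- Pairing with the constant `1` kills one side; the formula reverses the direction on the
    -- other, hence the minus sign.
    have h1 := LipschitzWith.integral_lineDeriv_mul_eq (μ := (volume : Measure (E d)))
      (LipschitzWith.const (1 : ℝ)) hC (hφic i).mul_left (-EuclideanSpace.single i (1 : ℝ))
    have h0 : ∀ x, lineDeriv ℝ (fun _ : E d => (1 : ℝ)) x (-EuclideanSpace.single i (1 : ℝ)) = 0 :=
      fun x => by simp [lineDeriv]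
    simp only [h0, zero_mul, integral_zero, neg_neg, mul_one] at h1
    rw [← setIntegral_eq_integral_of_forall_compl_eq_zero (s := (Ω : Set (E d)))
      fun x hx => ?_] at h1
    · rw [h1]
      refine integral_congr_ae (hdiff.mono fun x hx => ?_)
      have hfd : HasFDerivAt (fun x => v x * φ x i) _ x :=
        hx.hasFDerivAt.mul ((hφi i).differentiable (by simp) x).hasFDerivAt
      simp only
      rw [(hfd.hasLineDerivAt _).lineDeriv]
      simp only [G, gradient_apply, add_apply, smul_apply,
        hder, smul_eq_mul]
      ring
    · have hev : (fun x => v x * φ x i) =ᶠ[𝓝 x] fun _ => 0 := by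
        have hx' : x ∈ (tsupport fun x => φ x i)ᶜ := fun h => hx (hφiΩ i h)
        filter_upwards [(isClosed_tsupport _).isOpen_compl.mem_nhds hx'] with y hy
        rw [image_eq_zero_of_notMem_tsupport (f := fun x => φ x i) hy, mul_zero]
      rw [hev.lineDeriv_eq]
      simp [lineDeriv]
  have hvi := hv.integrableOn hΩ
  have hvm : AEStronglyMeasurable v (volume.restrict (Ω : Set (E d))) := hvi.1
  have hvM : ∀ᵐ x ∂(volume.restrict (Ω : Set (E d))), ‖v x‖ ≤ M :=
    (ae_restrict_mem hΩm).mono fun x hx => hM x (subset_closure hx)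
  have hGi : ∀ i : Fin d, IntegrableOn (G i) Ω := by
    intro i
    have h1 : IntegrableOn (fun x => φ x i) Ω :=
      ((hφi i).continuous.integrable_of_hasCompactSupport (hφic i)).integrableOn
    have h2 : IntegrableOn (fun x => (fderiv ℝ φ x (EuclideanSpace.single i 1)) i) Ω := by
      have hc : Continuous fun x => (fderiv ℝ φ x (EuclideanSpace.single i 1)) i :=
        (EuclideanSpace.proj (𝕜 := ℝ) i).continuous.comp
          ((φ.contDiff.continuous_fderiv (by simp)).clm_apply continuous_const)
      refine (hc.integrable_of_hasCompactSupport ?_).integrableOn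
      refine (φ.hasCompactSupport.fderiv (𝕜 := ℝ)).mono fun x hx h => hx ?_
      simp only [h]; rfl
    refine Integrable.add (h1.bdd_mul (c := L)
      ((EuclideanSpace.proj (𝕜 := ℝ) i).continuous.comp_aestronglyMeasurable hgm) ?_)
      (h2.bdd_mul (c := M) hvm hvM)
    filter_upwards [hgL] with x hx
    exact (PiLp.norm_apply_le _ i).trans hx
  have hsum : ∀ x, ∑ i, G i x = ⟪∇ v x, φ x⟫ + v x * divergence φ x := by
    intro x
    simp only [G, Finset.sum_add_distrib, divergence, Finset.mul_sum, PiLp.inner_apply]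
    congr 1
    exact Finset.sum_congr rfl fun i _ => by simp [mul_comm]
  have hdi : IntegrableOn (fun x => v x * divergence φ x) Ω :=
    (integrable_divergence φ.contDiff φ.hasCompactSupport).2.integrableOn.bdd_mul (c := M) hvm hvM
  have hgi : IntegrableOn (fun x => ⟪∇ v x, φ x⟫) Ω := by
    have := (integrable_finsetSum Finset.univ fun i _ => hGi i).sub hdi
    refine this.congr (Eventually.of_forall fun x => ?_)
    simp [hsum]
  have h0 : ∫ x in (Ω : Set (E d)), (⟪∇ v x, φ x⟫ + v x * divergence φ x) = 0 := by
    simp_rw [← hsum]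
    rw [integral_finsetSum _ fun i _ => hGi i]
    exact Finset.sum_eq_zero fun i _ => key i
  rw [integral_add hgi hdi] at h0
  linarith

end Triangulation.MemP1

end ROF

/-! ### P1 functions: boundary values, total variation and Green's formula -/

namespace ROF.Triangulation.MemP1

variable {d : ℕ} {Ω : Opens (E d)} {𝒯 : Triangulation Ω} {ΓD : Set (E d)} {v : E d → ℝ}

/-- A boundary side is a face of an element on which `v` is affine, so vanishing at the vertices
extends to the side. -/
lemma eq_zero_of_mem (hv : 𝒯.MemP1 ΓD v)
    (hΓD : ∃ 𝒮 ⊆ 𝒯.boundarySides, ΓD = ⋃ S ∈ 𝒮, convexHull ℝ (S : Set (E d))) {x : E d}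
    (hx : x ∈ ΓD) : v x = 0 := by
  obtain ⟨𝒮, h𝒮, hΓ⟩ := hΓD
  have hx' := hx
  rw [hΓ] at hx'
  obtain ⟨S, hS, hxS⟩ := mem_iUnion₂.1 hx'
  obtain ⟨t, ht, hSt, hcard⟩ := 𝒯.pure S (h𝒮 hS).1
  have hSt' : convexHull ℝ (S : Set (E d)) ⊆ convexHull ℝ (t : Set (E d)) :=
    convexHull_mono (Finset.coe_subset.2 hSt)
  obtain ⟨A, hA⟩ := hv.affine t (𝒯.mem_elements.2 ⟨ht, hcard⟩)
  have hsub : convexHull ℝ (S : Set (E d)) ⊆ A ⁻¹' {0} := by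
    refine convexHull_min (fun z hz => ?_) ((convex_singleton 0).affine_preimage A)
    have hzS : z ∈ convexHull ℝ (S : Set (E d)) := subset_convexHull ℝ _ hz
    have h1 : v z = 0 := by
      refine hv.dirichlet z ?_ (hΓ ▸ mem_biUnion hS hzS)
      rw [Geometry.SimplicialComplex.vertices_eq]
      exact mem_biUnion (h𝒮 hS).1 hz
    rw [mem_preimage, mem_singleton_iff, ← hA (hSt' hzS), h1]
  rw [hA (hSt' hxS)]
  exact hsub hxS

lemma hasZeroTraceOn (hd : 1 ≤ d) (hv : 𝒯.MemP1 ΓD v)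
    (hΓD : ∃ 𝒮 ⊆ 𝒯.boundarySides, ΓD = ⋃ S ∈ 𝒮, convexHull ℝ (S : Set (E d))) :
    HasZeroTraceOn Ω ΓD v := by
  have hΓ : ΓD ⊆ closure (Ω : Set (E d)) := by
    obtain ⟨𝒮, h𝒮, rfl⟩ := hΓD
    exact iUnion₂_subset fun S hS => (h𝒮 hS).2.2.trans frontier_subset_closure
  refine ae_restrict_of_forall_mem (𝒯.dirichlet_boundary hd hΓD).1.measurableSet fun x hx => ?_
  rw [Metric.tendsto_nhdsWithin_nhds]
  intro ε hε
  set V := volume.real (ball (0 : E d) 1)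
  have hV : 0 ≤ V := measureReal_nonneg
  obtain ⟨δ, hδ, hδv⟩ := Metric.continuousWithinAt_iff.1 (hv.continuousOn x (hΓ hx))
    (ε / (V + 1)) (by positivity)
  refine ⟨δ, hδ, fun r (hr : 0 < r) hrδ => ?_⟩
  rw [Real.dist_0_eq_abs, abs_of_pos hr] at hrδ
  have h1 := integral_ball_le_of_bound (Ω := Ω) hd (w := v) (M := ε / (V + 1)) (by positivity)
    (x := x) hr fun y hy => by
      have := hδv (subset_closure hy.2) ((mem_ball.1 hy.1).trans hrδ)
      rw [hv.eq_zero_of_mem hΓD hx, Real.dist_0_eq_abs] at this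
      exact this.le
  rw [Real.dist_0_eq_abs, abs_of_nonneg
    (mul_nonneg (by positivity) (integral_nonneg fun _ => abs_nonneg _))]
  calc (r ^ d)⁻¹ * ∫ y in ball x r ∩ (Ω : Set (E d)), |v y|
      ≤ (r ^ d)⁻¹ * (ε / (V + 1) * V * r ^ d) := by gcongr
    _ = ε * (V / (V + 1)) := by field_simp
    _ < ε * 1 := by
      gcongr
      rw [div_lt_one (by positivity)]
      linarith
    _ = ε := mul_one ε

lemma integrableOn_gradient (hΩ : IsBoundedLipschitzDomain Ω) (hv : 𝒯.MemP1 ΓD v) :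
    IntegrableOn (∇ v) Ω := by
  obtain ⟨hgm, ⟨L, -, hgL⟩, -⟩ := hv.gradient_bound hΩ
  exact IntegrableOn.of_bound hΩ.bounded.measure_lt_top hgm L hgL

/-- Test fields that approximate the direction of the gradient. -/
lemma exists_testFunction_tendsto (hΩ : IsBoundedLipschitzDomain Ω) (hv : 𝒯.MemP1 ΓD v) :
    ∃ φ : ℕ → 𝓓(Ω, E d), (∀ n x, ‖φ n x‖ ≤ 1) ∧ ∀ᵐ x ∂(volume.restrict (Ω : Set (E d))),
      Tendsto (fun n => ⟪∇ v x, φ n x⟫) atTop (𝓝 ‖∇ v x‖) := by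
  obtain ⟨a, -, -, ha, -, -⟩ := hv.exists_elementwise_gradient
  choose f hfs hf hf01 using fun T : Finset (E d) =>
    (isOpen_interior (s := convexHull ℝ (T : Set (E d)))).exists_contDiff_support_eq (n := (⊤ : ℕ∞))
  -- This vanishes where `n * f T x ≤ 1` and equals `1` where `n * f T x ≥ 2`. Its support is thus
  -- in a closed set inside the open element, while the plateaus exhaust that element.
  let χ : ℕ → Finset (E d) → E d → ℝ := fun n T x => Real.smoothTransition (n * f T x - 1)
  have hχs : ∀ n T, ContDiff ℝ (⊤ : ℕ∞) (χ n T) := fun n T =>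
    Real.smoothTransition.contDiff.comp ((contDiff_const.mul (hf T)).sub contDiff_const)
  have hχ0 : ∀ n T x, χ n T x ≠ 0 → 1 ≤ n * f T x := by
    intro n T x hx
    by_contra h
    exact hx (Real.smoothTransition.zero_of_nonpos (by linarith))
  have hfT : ∀ (n : ℕ) T x, 1 ≤ n * f T x → x ∈ interior (convexHull ℝ (T : Set (E d))) := by
    intro n T x hx
    rw [← hfs T, Function.mem_support]
    intro h
    rw [h, mul_zero] at hx
    linarith
  -- On an element with `a T = 0` the inverse norm is `0` and so is the field, which is consistent
  -- with `|∇v| = 0`.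
  let Φ : ℕ → E d → E d := fun n x => ∑ T ∈ 𝒯.elements, χ n T x • (‖a T‖⁻¹ • a T)
  have hΦs : ∀ n, ContDiff ℝ (⊤ : ℕ∞) (Φ n) := fun n =>
    ContDiff.sum fun T _ => (hχs n T).smul contDiff_const
  have hΦT : ∀ n, ∀ T ∈ 𝒯.elements, ∀ x ∈ interior (convexHull ℝ (T : Set (E d))),
      Φ n x = χ n T x • (‖a T‖⁻¹ • a T) := by
    intro n T hT x hx
    refine Finset.sum_eq_single_of_mem T hT fun T' hT' hne => ?_
    have : χ n T' x = 0 := by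
      by_contra h
      exact (𝒯.disjoint_interior hT' hT hne).ne_of_mem (hfT n T' x (hχ0 n T' x h)) hx rfl
    rw [this, zero_smul]
  let Z : ℕ → Set (E d) := fun n => ⋃ T ∈ 𝒯.elements, {x | 1 ≤ n * f T x}
  have hZΩ : ∀ n, Z n ⊆ Ω := fun n => iUnion₂_subset fun T hT x hx =>
    𝒯.interior_subset_domain hΩ hT (hfT n T x hx)
  have hZc : ∀ n, IsClosed (Z n) := fun n =>
    Set.Finite.isClosed_biUnion (Finset.finite_toSet _) fun T _ =>
      isClosed_le continuous_const (continuous_const.mul (hf T).continuous)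
  have hΦZ : ∀ n x, Φ n x ≠ 0 → x ∈ Z n := by
    intro n x hx
    obtain ⟨T, hT, h⟩ := Finset.exists_ne_zero_of_sum_ne_zero hx
    exact mem_biUnion hT (hχ0 n T x fun h0 => h (by rw [h0, zero_smul]))
  have hΦt : ∀ n, tsupport (Φ n) ⊆ Z n := fun n => closure_minimal (hΦZ n) (hZc n)
  have hu : ∀ T, ‖‖a T‖⁻¹ • a T‖ ≤ 1 := fun T => by
    rw [norm_smul, norm_inv, norm_norm]
    exact inv_mul_le_one
  have hχ1 : ∀ n T x, ‖χ n T x‖ ≤ 1 := fun n T x => by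
    rw [Real.norm_of_nonneg (Real.smoothTransition.nonneg _)]
    exact Real.smoothTransition.le_one _
  refine ⟨fun n =>
    { toFun := Φ n
      contDiff' := hΦs n
      hasCompactSupport' := hΩ.bounded.isCompact_closure.of_isClosed_subset (isClosed_tsupport _)
        ((hΦt n).trans ((hZΩ n).trans subset_closure))
      tsupport_subset' := (hΦt n).trans (hZΩ n) }, fun n x => ?_, ?_⟩
  · change ‖Φ n x‖ ≤ 1
    by_cases hx : Φ n x = 0
    · rw [hx, norm_zero]
      exact zero_le_one
    · obtain ⟨T, hT, hxT⟩ := mem_iUnion₂.1 (hΦZ n x hx)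
      rw [hΦT n T hT x (hfT n T x hxT), norm_smul]
      exact mul_le_one₀ (hχ1 n T x) (norm_nonneg _) (hu T)
  · filter_upwards [𝒯.ae_mem_interior hΩ] with x hx
    obtain ⟨T, hT, hxT⟩ := hx
    change Tendsto (fun n => ⟪∇ v x, Φ n x⟫) atTop (𝓝 ‖∇ v x‖)
    simp_rw [hΦT _ T hT x hxT, (ha T hT x hxT).gradient]
    have hpos : 0 < f T x := by
      refine lt_of_le_of_ne (hf01 T (mem_range_self x)).1 (Ne.symm ?_)
      rw [← Function.mem_support, hfs T]
      exact hxT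
    refine tendsto_const_nhds.congr' ?_
    have hlim : Tendsto (fun n : ℕ => n * f T x) atTop atTop :=
      tendsto_natCast_atTop_atTop.atTop_mul_const hpos
    filter_upwards [hlim.eventually_ge_atTop 2] with n hn
    have : χ n T x = 1 := Real.smoothTransition.one_of_one_le (by linarith)
    rw [this, one_smul, inner_smul_right, real_inner_self_eq_norm_sq]
    rcases eq_or_ne ‖a T‖ 0 with h | h
    · simp [h]
    · field_simp

/-- Integration by parts and Cauchy-Schwarz give the upper bound. The lower one comes from test
fields converging almost everywhere to the direction of `∇v`. -/
theorem totalVariation_eq (hΩ : IsBoundedLipschitzDomain Ω) (hv : 𝒯.MemP1 ΓD v) :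
    totalVariation Ω v = ENNReal.ofReal (∫ x in (Ω : Set (E d)), ‖∇ v x‖) := by
  have hgi := hv.integrableOn_gradient hΩ
  refine le_antisymm (totalVariation_le_ofReal fun φ hφ => ?_) ?_
  · rw [hv.integral_mul_divergence hΩ φ]
    refine (le_abs_self _).trans ?_
    rw [← Real.norm_eq_abs]
    refine norm_integral_le_of_norm_le hgi.norm (Eventually.of_forall fun x => ?_)
    exact (norm_inner_le_norm _ _).trans (mul_le_of_le_one_right (norm_nonneg _) (hφ x))
  · obtain ⟨φ, hφ1, hφ⟩ := hv.exists_testFunction_tendsto hΩ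
    have h1 : Tendsto (fun n => ∫ x in (Ω : Set (E d)), ⟪∇ v x, φ n x⟫) atTop
        (𝓝 (∫ x in (Ω : Set (E d)), ‖∇ v x‖)) := by
      refine tendsto_integral_of_dominated_convergence (fun x => ‖∇ v x‖)
        (fun n => hgi.1.inner (φ n).continuous.aestronglyMeasurable) hgi.norm
        (fun n => Eventually.of_forall fun x => ?_) hφ
      exact (norm_inner_le_norm _ _).trans (mul_le_of_le_one_right (norm_nonneg _) (hφ1 n x))
    refine le_of_tendsto' ((ENNReal.continuous_ofReal.tendsto _).comp h1) fun n => ?_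
    rw [Function.comp_apply, ← hv.integral_mul_divergence hΩ (φ n)]
    exact le_iSup₂ (f := fun (φ : 𝓓(Ω, E d)) (_ : ∀ x, ‖φ x‖ ≤ 1) =>
      ENNReal.ofReal (-∫ x in (Ω : Set (E d)), v x * divergence φ x)) (φ n) (hφ1 n)

lemma isAdmissible (hd : 1 ≤ d) (hΩ : IsBoundedLipschitzDomain Ω) (hv : 𝒯.MemP1 ΓD v)
    (hΓD : ∃ 𝒮 ⊆ 𝒯.boundarySides, ΓD = ⋃ S ∈ 𝒮, convexHull ℝ (S : Set (E d))) :
    IsAdmissible Ω ΓD v where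
  memBV := ⟨hv.integrableOn hΩ, by rw [hv.totalVariation_eq hΩ]; exact ENNReal.ofReal_lt_top⟩
  memL2 := hv.memLp hΩ
  zeroTrace := hv.hasZeroTraceOn hd hΓD

/-- The weak normal trace condition cannot be tested with `v`, which is neither smooth nor zero in a
neighbourhood of `ΓD`. Instead `q` is replaced by test fields, close to it in `L¹`; the boundedness
of `∇v` and the zero trace of `v` allow the passage to the limit. -/
theorem integral_inner_gradient (hd : 1 ≤ d) (hΩ : IsBoundedLipschitzDomain Ω)
    (hv : 𝒯.MemP1 ΓD v)
    (hΓD : ∃ 𝒮 ⊆ 𝒯.boundarySides, ΓD = ⋃ S ∈ 𝒮, convexHull ℝ (S : Set (E d)))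
    {q : E d → E d} {p : E d → ℝ} (hq : MemWDivN Ω ΓD q p)
    (hq1 : ∀ᵐ x ∂(volume.restrict (Ω : Set (E d))), ‖q x‖ ≤ 1) :
    ∫ x in (Ω : Set (E d)), ⟪∇ v x, q x⟫ = -∫ x in (Ω : Set (E d)), v x * p x := by
  obtain ⟨hΓ, hΓμ, hΓΩ⟩ := 𝒯.dirichlet_boundary hd hΓD
  obtain ⟨hgm, ⟨L, hL0, hgL⟩, -⟩ := hv.gradient_bound hΩ
  obtain ⟨M, hM0, hM⟩ := hv.exists_bound hΩ
  have hgi := hv.integrableOn_gradient hΩ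
  have : IsFiniteMeasure (volume.restrict (Ω : Set (E d))) :=
    ⟨by rw [Measure.restrict_apply_univ]; exact hΩ.bounded.measure_lt_top⟩
  have hqi : IntegrableOn q Ω := hq.memL2.integrable (by norm_num)
  have hgq : IntegrableOn (fun x => ⟪∇ v x, q x⟫) Ω := by
    refine hgi.norm.mono' (hgm.inner hqi.1) ?_
    filter_upwards [hq1] with x hx
    exact (norm_inner_le_norm _ _).trans (mul_le_of_le_one_right (norm_nonneg _) hx)
  rw [← sub_eq_zero, ← abs_eq_zero]
  refine le_antisymm (le_of_forall_pos_le_add fun ε hε => ?_) (abs_nonneg _)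
  obtain ⟨φ, -, hφ1, hφ2⟩ := exists_testFunction_approx_of_zeroTrace hd hΩ hΓ hΓμ hΓΩ hq hq1
    (hv.integrableOn hΩ) hM0 (fun x hx => hM x (subset_closure hx)) (hv.hasZeroTraceOn hd hΓD)
    (ε := ε / (L + 1)) (by positivity)
  have hφi : IntegrableOn φ Ω :=
    (φ.continuous.integrable_of_hasCompactSupport φ.hasCompactSupport).integrableOn
  have hgφ : IntegrableOn (fun x => ⟪∇ v x, φ x⟫) Ω := by
    refine (hφi.norm.const_mul L).mono' (hgm.inner hφi.1) ?_
    filter_upwards [hgL] with x hx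
    exact (norm_inner_le_norm _ _).trans (mul_le_mul_of_nonneg_right hx (norm_nonneg _))
  have h1 : |(∫ x in (Ω : Set (E d)), ⟪∇ v x, φ x⟫) - ∫ x in (Ω : Set (E d)), ⟪∇ v x, q x⟫| ≤
      L * (ε / (L + 1)) := by
    rw [← integral_sub hgφ hgq, ← Real.norm_eq_abs]
    refine (norm_integral_le_of_norm_le ((hφi.sub hqi).norm.const_mul L) ?_).trans ?_
    · filter_upwards [hgL] with x hx
      rw [← inner_sub_right]
      exact (norm_inner_le_norm _ _).trans (mul_le_mul_of_nonneg_right hx (norm_nonneg _))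
    · rw [integral_const_mul]
      exact mul_le_mul_of_nonneg_left hφ1 hL0
  rw [← hv.integral_mul_divergence hΩ φ] at h1
  have h2 : (L + 1) * (ε / (L + 1)) = ε := by field_simp
  rw [abs_le] at *
  constructor <;> linarith [h1.1, h1.2, hφ2.1, hφ2.2]

end ROF.Triangulation.MemP1

namespace ROF

variable {d : ℕ} {Ω : Opens (E d)}

/-! ### `L²` norms -/

lemma l2Norm_nonneg (f : E d → ℝ) : 0 ≤ l2Norm Ω f := lpNorm_nonneg

lemma l2Norm_sq {f : E d → ℝ} (hf : MemLp f 2 (volume.restrict (Ω : Set (E d)))) :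
    l2Norm Ω f ^ 2 = ∫ x in (Ω : Set (E d)), f x ^ 2 := by
  have h0 : 0 ≤ ∫ x in (Ω : Set (E d)), f x ^ 2 := integral_nonneg fun _ => sq_nonneg _
  have h1 : l2Norm Ω f = (∫ x in (Ω : Set (E d)), f x ^ 2) ^ (2⁻¹ : ℝ) := by
    rw [l2Norm, lpNorm_eq_integral_norm_rpow_toReal (by norm_num) (by norm_num) hf.1]
    simp
  rw [h1, ← Real.rpow_natCast, ← Real.rpow_mul h0]
  norm_num

lemma integral_add_mul_sq {f g : E d → ℝ} (hf : MemLp f 2 (volume.restrict (Ω : Set (E d))))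
    (hg : MemLp g 2 (volume.restrict (Ω : Set (E d)))) (s : ℝ) :
    ∫ x in (Ω : Set (E d)), (f x + s * g x) ^ 2 = (∫ x in (Ω : Set (E d)), f x ^ 2) +
      2 * s * (∫ x in (Ω : Set (E d)), f x * g x) + s ^ 2 * ∫ x in (Ω : Set (E d)), g x ^ 2 := by
  have h1 : IntegrableOn (fun x => f x ^ 2) Ω := hf.integrable_sq
  have h2 : IntegrableOn (fun x => 2 * s * (f x * g x)) Ω := (hf.integrable_mul hg).const_mul _
  have h3 : IntegrableOn (fun x => s ^ 2 * g x ^ 2) Ω := hg.integrable_sq.const_mul _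
  have h12 : IntegrableOn (fun x => f x ^ 2 + 2 * s * (f x * g x)) Ω := h1.add h2
  rw [← integral_const_mul, ← integral_const_mul, ← integral_add h1 h2, ← integral_add h12 h3]
  exact integral_congr_ae (Eventually.of_forall fun x => by ring)

/-- Cauchy-Schwarz, from the nonpositive discriminant of `s ↦ ‖f + s g‖²`. -/
lemma abs_integral_mul_le {f g : E d → ℝ} (hf : MemLp f 2 (volume.restrict (Ω : Set (E d))))
    (hg : MemLp g 2 (volume.restrict (Ω : Set (E d)))) :
    |∫ x in (Ω : Set (E d)), f x * g x| ≤ l2Norm Ω f * l2Norm Ω g := by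
  have h := discrim_le_zero (a := ∫ x in (Ω : Set (E d)), g x ^ 2)
    (b := 2 * ∫ x in (Ω : Set (E d)), f x * g x) (c := ∫ x in (Ω : Set (E d)), f x ^ 2) fun s => by
      have h1 := integral_add_mul_sq hf hg s
      have h2 : 0 ≤ ∫ x in (Ω : Set (E d)), (f x + s * g x) ^ 2 :=
        integral_nonneg fun _ => sq_nonneg _
      linarith
  rw [discrim, ← l2Norm_sq hf, ← l2Norm_sq hg] at h
  refine abs_le_of_sq_le_sq (by linarith) (mul_nonneg (l2Norm_nonneg f) (l2Norm_nonneg g))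

/-! ### Consequences of minimality -/

lemma rofEnergy_eq {α : ℝ} {f v : E d → ℝ} (hf : MemLp f 2 (volume.restrict (Ω : Set (E d))))
    (hv : MemLp v 2 (volume.restrict (Ω : Set (E d)))) (hTV : totalVariation Ω v < ∞) :
    rofEnergy Ω α f v = (((totalVariation Ω v).toReal +
      α / 2 * ∫ x in (Ω : Set (E d)), (f x - v x) ^ 2 : ℝ) : EReal) := by
  rw [rofEnergy, l2Norm_sq (f := fun x => f x - v x) (hf.sub hv), EReal.coe_add,
    EReal.coe_ennreal_toReal hTV.ne]

lemma integrableOn_mul_divergence {v : E d → ℝ} (hv : IntegrableOn v Ω) (φ : 𝓓(Ω, E d)) :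
    IntegrableOn (fun x => v x * divergence φ x) Ω := by
  have hc := continuous_divergence φ.contDiff
  obtain ⟨C, hC⟩ := hc.bounded_above_of_compact_support
    (integrable_divergence φ.contDiff φ.hasCompactSupport).1
  exact hv.mul_bdd hc.aestronglyMeasurable (Eventually.of_forall hC)

lemma totalVariation_convex_comb_le {u v : E d → ℝ} (hu : MemBV Ω u) (hv : MemBV Ω v) {t : ℝ}
    (ht0 : 0 ≤ t) (ht1 : t ≤ 1) :
    totalVariation Ω (fun x => u x + t * (v x - u x)) ≤
      ENNReal.ofReal ((1 - t) * (totalVariation Ω u).toReal + t * (totalVariation Ω v).toReal) := by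
  refine totalVariation_le_ofReal fun φ hφ => ?_
  have h1 := neg_integral_le_totalVariation hu.2 φ one_pos hφ
  have h2 := neg_integral_le_totalVariation hv.2 φ one_pos hφ
  have i1 : IntegrableOn (fun x => (1 - t) * (u x * divergence φ x)) Ω :=
    (integrableOn_mul_divergence hu.1 φ).const_mul _
  have i2 : IntegrableOn (fun x => t * (v x * divergence φ x)) Ω :=
    (integrableOn_mul_divergence hv.1 φ).const_mul _
  have h3 : ∫ x in (Ω : Set (E d)), (u x + t * (v x - u x)) * divergence φ x =
      (1 - t) * (∫ x in (Ω : Set (E d)), u x * divergence φ x) +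
        t * ∫ x in (Ω : Set (E d)), v x * divergence φ x := by
    rw [← integral_const_mul, ← integral_const_mul, ← integral_add i1 i2]
    exact integral_congr_ae (Eventually.of_forall fun x => by ring)
  rw [h3]
  nlinarith

lemma IsAdmissible.convex_comb {Γ : Set (E d)} {u v : E d → ℝ} (hu : IsAdmissible Ω Γ u)
    (hv : IsAdmissible Ω Γ v) {t : ℝ} (ht0 : 0 ≤ t) (ht1 : t ≤ 1) :
    IsAdmissible Ω Γ fun x => u x + t * (v x - u x) where
  memBV := ⟨hu.memBV.1.add ((hv.memBV.1.sub hu.memBV.1).const_mul t),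
    (totalVariation_convex_comb_le hu.memBV hv.memBV ht0 ht1).trans_lt ENNReal.ofReal_lt_top⟩
  memL2 := hu.memL2.add ((hv.memL2.sub hu.memL2).const_mul t)
  zeroTrace := by
    filter_upwards [hu.zeroTrace, hv.zeroTrace] with x hux hvx
    have h := hux.add hvx
    rw [add_zero] at h
    refine squeeze_zero' ?_ ?_ h
    · filter_upwards [self_mem_nhdsWithin] with r (hr : 0 < r)
      exact mul_nonneg (by positivity) (integral_nonneg fun _ => abs_nonneg _)
    · filter_upwards [self_mem_nhdsWithin] with r (hr : 0 < r)
      have i1 : IntegrableOn (fun y => |u y|) (ball x r ∩ (Ω : Set (E d))) :=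
        IntegrableOn.mono_set (show IntegrableOn (fun y => |u y|) Ω volume from hu.memBV.1.abs)
          inter_subset_right
      have i2 : IntegrableOn (fun y => |v y|) (ball x r ∩ (Ω : Set (E d))) :=
        IntegrableOn.mono_set (show IntegrableOn (fun y => |v y|) Ω volume from hv.memBV.1.abs)
          inter_subset_right
      rw [← mul_add, ← integral_add i1 i2]
      refine mul_le_mul_of_nonneg_left (integral_mono_of_nonneg
        (Eventually.of_forall fun _ => abs_nonneg _) (i1.add i2)
        (Eventually.of_forall fun y => ?_)) (by positivity)
      calc |u y + t * (v y - u y)| = |(1 - t) * u y + t * v y| := by ring_nf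
        _ ≤ |(1 - t) * u y| + |t * v y| := abs_add_le _ _
        _ = (1 - t) * |u y| + t * |v y| := by
          rw [abs_mul, abs_mul, abs_of_nonneg ht0, abs_of_nonneg (sub_nonneg.2 ht1)]
        _ ≤ 1 * |u y| + 1 * |v y| := by gcongr; linarith
        _ = |u y| + |v y| := by rw [one_mul, one_mul]

/-- The variational inequality for a minimizer of the ROF functional. -/
theorem IsROFMinimizer.variational_inequality {Γ : Set (E d)} {α : ℝ} {g u v : E d → ℝ}
    (hu : IsROFMinimizer Ω Γ α g u) (hg : MemLp g 2 (volume.restrict (Ω : Set (E d))))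
    (hv : IsAdmissible Ω Γ v) :
    α * ∫ x in (Ω : Set (E d)), (g x - u x) * (v x - u x) ≤
      (totalVariation Ω v).toReal - (totalVariation Ω u).toReal := by
  have hua := hu.admissible
  have hgu : MemLp (fun x => g x - u x) 2 (volume.restrict (Ω : Set (E d))) := hg.sub hua.memL2
  have he : MemLp (fun x => v x - u x) 2 (volume.restrict (Ω : Set (E d))) :=
    hv.memL2.sub hua.memL2
  set B := ∫ x in (Ω : Set (E d)), (g x - u x) * (v x - u x) with hB
  set F := ∫ x in (Ω : Set (E d)), (v x - u x) ^ 2 with hF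
  -- Minimality against the point `u + t (v - u)`, with convexity of the total variation, divided by
  -- `t`; the quadratic remainder disappears as `t → 0`.
  have key : ∀ t : ℝ, 0 < t → t ≤ 1 → α * B ≤
      (totalVariation Ω v).toReal - (totalVariation Ω u).toReal + t * (α / 2 * F) := by
    intro t ht ht1
    have hw := hua.convex_comb hv ht.le ht1
    have h := hu.le _ hw
    rw [rofEnergy_eq hg hua.memL2 hua.memBV.2, rofEnergy_eq hg hw.memL2 hw.memBV.2,
      EReal.coe_le_coe_iff] at h
    have h1 : ∫ x in (Ω : Set (E d)), (g x - (u x + t * (v x - u x))) ^ 2 =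
        (∫ x in (Ω : Set (E d)), (g x - u x) ^ 2) + 2 * (-t) * B + (-t) ^ 2 * F := by
      rw [hB, hF, ← integral_add_mul_sq hgu he (-t)]
      exact integral_congr_ae (Eventually.of_forall fun x => by ring)
    have h2 : (totalVariation Ω fun x => u x + t * (v x - u x)).toReal ≤
        (1 - t) * (totalVariation Ω u).toReal + t * (totalVariation Ω v).toReal := by
      refine ENNReal.toReal_le_of_le_ofReal ?_
        (totalVariation_convex_comb_le hua.memBV hv.memBV ht.le ht1)
      exact add_nonneg (mul_nonneg (sub_nonneg.2 ht1) ENNReal.toReal_nonneg)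
        (mul_nonneg ht.le ENNReal.toReal_nonneg)
    rw [h1] at h
    have h3 : t * (α * B) ≤ t * ((totalVariation Ω v).toReal - (totalVariation Ω u).toReal +
        t * (α / 2 * F)) := by linarith
    exact le_of_mul_le_mul_left h3 ht
  refine ge_of_tendsto (b := α * B) (x := 𝓝[>] (0 : ℝ)) (f := fun t =>
    (totalVariation Ω v).toReal - (totalVariation Ω u).toReal + t * (α / 2 * F)) ?_ ?_
  · refine Tendsto.mono_left ?_ nhdsWithin_le_nhds
    have : Continuous fun t : ℝ =>
      (totalVariation Ω v).toReal - (totalVariation Ω u).toReal + t * (α / 2 * F) := by fun_prop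
    simpa using this.tendsto 0
  · filter_upwards [Ioo_mem_nhdsGT (zero_lt_one' ℝ)] with t ht using key t ht.1 ht.2.le

end ROF

namespace ROF.Triangulation

variable {d : ℕ} {Ω : Opens (E d)} {𝒯 : Triangulation Ω} {ΓD : Set (E d)} {v : E d → ℝ}

/-! ### The error estimator -/

lemma memLp_proj {F : Type*} [NormedAddCommGroup F] [NormedSpace ℝ F]
    (hΩ : IsBoundedLipschitzDomain Ω) (f : E d → F) :
    MemLp (𝒯.proj f) 2 (volume.restrict (Ω : Set (E d))) := by
  have : IsFiniteMeasure (volume.restrict (Ω : Set (E d))) :=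
    ⟨by rw [Measure.restrict_apply_univ]; exact hΩ.bounded.measure_lt_top⟩
  refine memLp_finsetSum _ fun T _ => ?_
  exact (memLp_const _).indicator isOpen_interior.measurableSet

lemma restrict_convexHull (T : Finset (E d)) :
    (volume : Measure (E d)).restrict (convexHull ℝ (T : Set (E d))) =
      volume.restrict (interior (convexHull ℝ (T : Set (E d)))) :=
  Measure.restrict_congr_set (interior_ae_eq T).symm

lemma restrict_convexHull_le (hΩ : IsBoundedLipschitzDomain Ω) {T : Finset (E d)}
    (hT : T ∈ 𝒯.elements) :
    (volume : Measure (E d)).restrict (convexHull ℝ (T : Set (E d))) ≤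
      volume.restrict (Ω : Set (E d)) := by
  rw [restrict_convexHull]
  exact Measure.restrict_mono_set _ (𝒯.interior_subset_domain hΩ hT)

lemma norm_proj_le (hΩ : IsBoundedLipschitzDomain Ω) {F : Type*} [NormedAddCommGroup F]
    [NormedSpace ℝ F] {q : E d → F} (hq1 : ∀ᵐ x ∂(volume.restrict (Ω : Set (E d))), ‖q x‖ ≤ 1)
    {T : Finset (E d)} (hT : T ∈ 𝒯.elements) :
    ‖⨍ y in convexHull ℝ (T : Set (E d)), q y‖ ≤ 1 := by
  have : IsFiniteMeasure (volume.restrict (convexHull ℝ (T : Set (E d)))) :=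
    ⟨by rw [Measure.restrict_apply_univ]; exact (isCompact_convexHull T).measure_lt_top⟩
  have h := norm_integral_le_of_norm_le_const (ae_mono (restrict_convexHull_le hΩ hT) hq1)
  rw [one_mul, measureReal_restrict_apply_univ] at h
  rw [setAverage_eq, norm_smul, norm_inv, Real.norm_of_nonneg measureReal_nonneg]
  exact inv_mul_le_one_of_le₀ h measureReal_nonneg

namespace MemP1

lemma integrableOn_inner_gradient (hΩ : IsBoundedLipschitzDomain Ω) (hv : 𝒯.MemP1 ΓD v)
    {q : E d → E d} (hq : IntegrableOn q Ω) : IntegrableOn (fun x => ⟪∇ v x, q x⟫) Ω := by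
  obtain ⟨hgm, ⟨L, -, hgL⟩, -⟩ := hv.gradient_bound hΩ
  refine (hq.norm.const_mul L).mono' (hgm.inner hq.1) ?_
  filter_upwards [hgL] with x hx
  exact (norm_inner_le_norm _ _).trans (mul_le_mul_of_nonneg_right hx (norm_nonneg _))

/-- The elementwise constant gradient does not distinguish a field from its mean values. -/
lemma integral_inner_gradient_proj (hΩ : IsBoundedLipschitzDomain Ω) (hv : 𝒯.MemP1 ΓD v)
    {q : E d → E d} (hq : MemLp q 2 (volume.restrict (Ω : Set (E d)))) :
    ∫ x in (Ω : Set (E d)), ⟪∇ v x, 𝒯.proj q x⟫ = ∫ x in (Ω : Set (E d)), ⟪∇ v x, q x⟫ := by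
  have : IsFiniteMeasure (volume.restrict (Ω : Set (E d))) :=
    ⟨by rw [Measure.restrict_apply_univ]; exact hΩ.bounded.measure_lt_top⟩
  obtain ⟨a, -, -, ha, -, -⟩ := hv.exists_elementwise_gradient
  have hqi : IntegrableOn q Ω := hq.integrable (by norm_num)
  rw [𝒯.integral_eq_sum hΩ (hv.integrableOn_inner_gradient hΩ
      ((memLp_proj hΩ q).integrable (by norm_num))),
    𝒯.integral_eq_sum hΩ (hv.integrableOn_inner_gradient hΩ hqi)]
  refine Finset.sum_congr rfl fun T hT => ?_
  have hqT : Integrable q (volume.restrict (convexHull ℝ (T : Set (E d)))) :=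
    Integrable.mono_measure hqi (restrict_convexHull_le hΩ hT)
  have h1 : ∫ x in convexHull ℝ (T : Set (E d)), ⟪∇ v x, q x⟫ =
      ∫ x in convexHull ℝ (T : Set (E d)), ⟪a T, q x⟫ := by
    rw [restrict_convexHull]
    exact setIntegral_congr_fun isOpen_interior.measurableSet fun x hx => by
      simp only [(ha T hT x hx).gradient]
  have h2 : ∫ x in convexHull ℝ (T : Set (E d)), ⟪∇ v x, 𝒯.proj q x⟫ =
      ∫ x in convexHull ℝ (T : Set (E d)), ⟪a T, ⨍ y in convexHull ℝ (T : Set (E d)), q y⟫ := by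
    rw [restrict_convexHull]
    refine setIntegral_congr_fun isOpen_interior.measurableSet fun x hx => ?_
    simp only [(ha T hT x hx).gradient, 𝒯.proj_apply q hT hx, restrict_convexHull]
  rw [h1, h2, integral_inner hqT, setIntegral_const, smul_eq_mul, ← inner_smul_right,
    measure_smul_setAverage _ (isCompact_convexHull T).measure_lt_top.ne]

lemma estimator_integrableOn (hΩ : IsBoundedLipschitzDomain Ω) (hv : 𝒯.MemP1 ΓD v) (α : ℝ)
    (g : E d → ℝ) (q : E d → E d) {p : E d → ℝ}
    (hp : MemLp p 2 (volume.restrict (Ω : Set (E d)))) :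
    IntegrableOn (fun x => ‖∇ v x‖ - ⟪∇ v x, 𝒯.proj q x⟫) Ω ∧
      MemLp (fun x => p x - α * (v x - 𝒯.proj g x)) 2 (volume.restrict (Ω : Set (E d))) := by
  have : IsFiniteMeasure (volume.restrict (Ω : Set (E d))) :=
    ⟨by rw [Measure.restrict_apply_univ]; exact hΩ.bounded.measure_lt_top⟩
  exact ⟨(hv.integrableOn_gradient hΩ).norm.sub (hv.integrableOn_inner_gradient hΩ
      ((memLp_proj hΩ q).integrable (by norm_num))),
    hp.sub (((hv.memLp hΩ).sub (memLp_proj hΩ g)).const_mul α)⟩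

theorem etaSq_eq_sum (hΩ : IsBoundedLipschitzDomain Ω) (hv : 𝒯.MemP1 ΓD v) (α : ℝ)
    (g : E d → ℝ) (q : E d → E d) {p : E d → ℝ}
    (hp : MemLp p 2 (volume.restrict (Ω : Set (E d)))) :
    𝒯.etaSq α g v q p = ∑ T ∈ 𝒯.elements, 𝒯.etaSqElem T α g v q p := by
  obtain ⟨h1, h2⟩ := hv.estimator_integrableOn hΩ α g q hp
  simp only [etaSq, etaSqElem, estimatorSqOn]
  rw [Finset.sum_add_distrib, ← Finset.mul_sum, 𝒯.integral_eq_sum hΩ h1,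
    𝒯.integral_eq_sum hΩ h2.integrable_sq]

lemma integral_norm_sub_inner_nonneg (hΩ : IsBoundedLipschitzDomain Ω) {q : E d → E d}
    (hq1 : ∀ᵐ x ∂(volume.restrict (Ω : Set (E d))), ‖q x‖ ≤ 1) (v : E d → ℝ) {T : Finset (E d)}
    (hT : T ∈ 𝒯.elements) :
    0 ≤ ∫ x in convexHull ℝ (T : Set (E d)), (‖∇ v x‖ - ⟪∇ v x, 𝒯.proj q x⟫) := by
  rw [restrict_convexHull]
  refine setIntegral_nonneg isOpen_interior.measurableSet fun x hx => sub_nonneg.2 ?_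
  rw [𝒯.proj_apply q hT hx]
  exact (real_inner_le_norm _ _).trans
    (mul_le_of_le_one_right (norm_nonneg _) (norm_proj_le hΩ hq1 hT))

theorem etaSqElem_nonneg (hΩ : IsBoundedLipschitzDomain Ω) {α : ℝ} (hα : 0 < α) {q : E d → E d}
    (hq1 : ∀ᵐ x ∂(volume.restrict (Ω : Set (E d))), ‖q x‖ ≤ 1) (g v p : E d → ℝ)
    {T : Finset (E d)} (hT : T ∈ 𝒯.elements) : 0 ≤ 𝒯.etaSqElem T α g v q p :=
  add_nonneg (integral_norm_sub_inner_nonneg hΩ hq1 v hT)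
    (mul_nonneg (by positivity) (integral_nonneg fun _ => sq_nonneg _))

/-- The estimator in terms of the total variation and the divergence. -/
lemma integral_norm_sub_inner_eq (hd : 1 ≤ d) (hΩ : IsBoundedLipschitzDomain Ω)
    (hv : 𝒯.MemP1 ΓD v)
    (hΓD : ∃ 𝒮 ⊆ 𝒯.boundarySides, ΓD = ⋃ S ∈ 𝒮, convexHull ℝ (S : Set (E d)))
    {q : E d → E d} {p : E d → ℝ} (hq : MemWDivN Ω ΓD q p)
    (hq1 : ∀ᵐ x ∂(volume.restrict (Ω : Set (E d))), ‖q x‖ ≤ 1) :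
    ∫ x in (Ω : Set (E d)), (‖∇ v x‖ - ⟪∇ v x, 𝒯.proj q x⟫) =
      (totalVariation Ω v).toReal + ∫ x in (Ω : Set (E d)), v x * p x := by
  have : IsFiniteMeasure (volume.restrict (Ω : Set (E d))) :=
    ⟨by rw [Measure.restrict_apply_univ]; exact hΩ.bounded.measure_lt_top⟩
  rw [integral_sub (hv.integrableOn_gradient hΩ).norm (hv.integrableOn_inner_gradient hΩ
      ((memLp_proj hΩ q).integrable (by norm_num))), hv.integral_inner_gradient_proj hΩ hq.memL2,
    hv.integral_inner_gradient hd hΩ hΓD hq hq1, hv.totalVariation_eq hΩ,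
    ENNReal.toReal_ofReal (integral_nonneg fun _ => norm_nonneg _), sub_neg_eq_add]

/-- The estimator is the primal-dual gap. -/
theorem etaSq_eq_gap (hd : 1 ≤ d) (hΩ : IsBoundedLipschitzDomain Ω) (hv : 𝒯.MemP1 ΓD v)
    (hΓD : ∃ 𝒮 ⊆ 𝒯.boundarySides, ΓD = ⋃ S ∈ 𝒮, convexHull ℝ (S : Set (E d)))
    {α : ℝ} (hα : 0 < α) (g : E d → ℝ) {q : E d → E d} {p : E d → ℝ} (hq : MemWDivN Ω ΓD q p)
    (hq1 : ∀ᵐ x ∂(volume.restrict (Ω : Set (E d))), ‖q x‖ ≤ 1) :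
    ((𝒯.etaSq α g v q p : ℝ) : EReal) =
      rofEnergy Ω α (𝒯.proj g) v - rofDual Ω α (𝒯.proj g) q p := by
  have hvL := hv.memLp hΩ
  have hpL := hq.div_memL2
  have hgL : MemLp (𝒯.proj g) 2 (volume.restrict (Ω : Set (E d))) := memLp_proj hΩ g
  have hpg : MemLp (fun x => p x + α * 𝒯.proj g x) 2 (volume.restrict (Ω : Set (E d))) :=
    hpL.add (hgL.const_mul α)
  have hgv : MemLp (fun x => 𝒯.proj g x - v x) 2 (volume.restrict (Ω : Set (E d))) := hgL.sub hvL
  rw [rofEnergy_eq hgL hvL (hv.isAdmissible hd hΩ hΓD).memBV.2, rofDual, if_pos hq1,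
    ← EReal.coe_sub, EReal.coe_eq_coe_iff, etaSq, estimatorSqOn,
    hv.integral_norm_sub_inner_eq hd hΩ hΓD hq hq1, l2Norm_sq hpg, l2Norm_sq hgL]
  have i1 : IntegrableOn (fun x => α / 2 * (𝒯.proj g x - v x) ^ 2) Ω :=
    hgv.integrable_sq.const_mul _
  have i2 : IntegrableOn (fun x => 1 / (2 * α) * (p x + α * 𝒯.proj g x) ^ 2) Ω :=
    hpg.integrable_sq.const_mul _
  have i3 : IntegrableOn (fun x => α / 2 * 𝒯.proj g x ^ 2) Ω := hgL.integrable_sq.const_mul _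
  have i4 : IntegrableOn (fun x => v x * p x) Ω := hvL.integrable_mul hpL
  have i12 : IntegrableOn (fun x => α / 2 * (𝒯.proj g x - v x) ^ 2 +
    1 / (2 * α) * (p x + α * 𝒯.proj g x) ^ 2) Ω := i1.add i2
  have i123 : IntegrableOn (fun x => α / 2 * (𝒯.proj g x - v x) ^ 2 +
    1 / (2 * α) * (p x + α * 𝒯.proj g x) ^ 2 - α / 2 * 𝒯.proj g x ^ 2) Ω := i12.sub i3
  -- Expanding the squares pointwise; the mixed term left over is `v p`, which cancels the one from
  -- Green's formula.
  have key : 1 / (2 * α) * ∫ x in (Ω : Set (E d)), (p x - α * (v x - 𝒯.proj g x)) ^ 2 =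
      α / 2 * (∫ x in (Ω : Set (E d)), (𝒯.proj g x - v x) ^ 2) +
        1 / (2 * α) * (∫ x in (Ω : Set (E d)), (p x + α * 𝒯.proj g x) ^ 2) -
        α / 2 * (∫ x in (Ω : Set (E d)), 𝒯.proj g x ^ 2) -
        ∫ x in (Ω : Set (E d)), v x * p x := by
    rw [← integral_const_mul, ← integral_const_mul, ← integral_const_mul, ← integral_const_mul,
      ← integral_add i1 i2, ← integral_sub i12 i3, ← integral_sub i123 i4]
    refine integral_congr_ae (Eventually.of_forall fun x => ?_)
    simp only
    field_simp
    ring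
  rw [key]
  ring

end MemP1

/-- With `s² = 2/α` the claim reads `x ≤ s η + G`. Splitting `R x` by Young's inequality would spoil
the factor of `G`. Instead, if `x - G > s η`, then `α x (x - G) - R x > x (α s η - R) ≥ s η (α s η -
R)`, and the last quantity equals `a + (η - R s / 2)² ≥ a`, a contradiction. -/
lemma le_add_of_quadratic_le {α a R G x : ℝ} (hα : 0 < α) (ha : 0 ≤ a) (hG : 0 ≤ G)
    (h : α * x ^ 2 ≤ a + R * x + α * (G * x)) :
    x ≤ √(2 / α) * √(a + 1 / (2 * α) * R ^ 2) + G := by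
  by_contra! hlt
  set s := √(2 / α)
  set η := √(a + 1 / (2 * α) * R ^ 2)
  have hs : s ^ 2 = 2 / α := Real.sq_sqrt (by positivity)
  have hη : η ^ 2 = a + 1 / (2 * α) * R ^ 2 := Real.sq_sqrt (by positivity)
  have hs0 : 0 ≤ s := Real.sqrt_nonneg _
  have hη0 : 0 ≤ η := Real.sqrt_nonneg _
  have hs' : α * s ^ 2 = 2 := by rw [hs]; field_simp
  have hη' : 2 * α * η ^ 2 = 2 * α * a + R ^ 2 := by rw [hη]; field_simp
  have h1 : R ≤ α * s * η := by
    refine le_of_abs_le (abs_le_of_sq_le_sq ?_ (by positivity))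
    have : (α * s * η) ^ 2 = 2 * α * η ^ 2 := by linear_combination α * η ^ 2 * hs'
    have : 0 ≤ 2 * α * a := by positivity
    linarith
  have h2 : s * η * (α * s * η - R) = a + (η - R * s / 2) ^ 2 := by
    linear_combination η ^ 2 * hs' + hη - R ^ 2 / 4 * hs + R ^ 2 / 2 * (by field_simp :
      1 / α = 2 * (1 / (2 * α)))
  have h3 : s * η * (α * s * η - R) ≤ x * (α * s * η - R) :=
    mul_le_mul_of_nonneg_right (by linarith) (by linarith)
  have h4 : 0 < x * (α * (x - G - s * η)) :=
    mul_pos (by linarith [mul_nonneg hs0 hη0]) (mul_pos hα (by linarith))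
  linarith [sq_nonneg (η - R * s / 2)]

end ROF.Triangulation

/-! ### The error estimate -/

namespace ROF

variable {d : ℕ} {Ω : Opens (E d)} {𝒯 : Triangulation Ω} {ΓD : Set (E d)}

/-- The a posteriori error estimate. -/
theorem IsROFMinimizer.l2Norm_sub_le (hd : 1 ≤ d) (hΩ : IsBoundedLipschitzDomain Ω)
    (hΓD : ∃ 𝒮 ⊆ 𝒯.boundarySides, ΓD = ⋃ S ∈ 𝒮, convexHull ℝ (S : Set (E d)))
    {α : ℝ} (hα : 0 < α) {g u v : E d → ℝ}
    (hg : MemLp g 2 (volume.restrict (Ω : Set (E d)))) (hu : IsROFMinimizer Ω ΓD α g u)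
    (hv : 𝒯.MemP1 ΓD v) {q : E d → E d} {p : E d → ℝ} (hq : MemWDivN Ω ΓD q p)
    (hq1 : ∀ᵐ x ∂(volume.restrict (Ω : Set (E d))), ‖q x‖ ≤ 1) :
    l2Norm Ω (fun x => u x - v x) ≤
      √(2 / α) * 𝒯.eta α g v q p + l2Norm Ω fun x => g x - 𝒯.proj g x := by
  obtain ⟨hΓ, hΓμ, hΓΩ⟩ := 𝒯.dirichlet_boundary hd hΓD
  have hua := hu.admissible
  have huL := hua.memL2
  have hvL := hv.memLp hΩ
  have hpL := hq.div_memL2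
  have hgL : MemLp (𝒯.proj g) 2 (volume.restrict (Ω : Set (E d))) := Triangulation.memLp_proj hΩ g
  obtain ⟨-, hr⟩ := hv.estimator_integrableOn hΩ α g q hpL
  have he : MemLp (fun x => v x - u x) 2 (volume.restrict (Ω : Set (E d))) := hvL.sub huL
  have hgg : MemLp (fun x => g x - 𝒯.proj g x) 2 (volume.restrict (Ω : Set (E d))) := hg.sub hgL
  have hcomm : l2Norm Ω (fun x => u x - v x) = l2Norm Ω fun x => v x - u x :=
    lpNorm_sub_comm u v 2 _
  have h1 := hu.variational_inequality hg (hv.isAdmissible hd hΩ hΓD)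
  have h2 := neg_integral_mul_le_totalVariation hd hΩ hΓ hΓμ hΓΩ hq hq1 hua
  have h3 := hv.integral_norm_sub_inner_eq hd hΩ hΓD hq hq1
  have h4 := neg_le_of_abs_le (abs_integral_mul_le hr he)
  have h5 := neg_le_of_abs_le (abs_integral_mul_le hgg he)
  set a := ∫ x in (Ω : Set (E d)), (‖∇ v x‖ - ⟪∇ v x, 𝒯.proj q x⟫) with ha
  have ha0 : 0 ≤ a := by
    rw [ha, 𝒯.integral_eq_sum hΩ (hv.estimator_integrableOn hΩ α g q hpL).1]
    exact Finset.sum_nonneg fun T hT =>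
      Triangulation.MemP1.integral_norm_sub_inner_nonneg hΩ hq1 v hT
  have j1 : IntegrableOn (fun x => α * ((g x - u x) * (v x - u x))) Ω :=
    ((hg.sub huL).integrable_mul he).const_mul α
  have j2 : IntegrableOn (fun x => v x * p x) Ω := hvL.integrable_mul hpL
  have j3 : IntegrableOn (fun x => u x * p x) Ω := huL.integrable_mul hpL
  have j4 : IntegrableOn (fun x => (p x - α * (v x - 𝒯.proj g x)) * (v x - u x)) Ω :=
    hr.integrable_mul he
  have j5 : IntegrableOn (fun x => α * ((g x - 𝒯.proj g x) * (v x - u x))) Ω :=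
    (hgg.integrable_mul he).const_mul α
  have j12 : IntegrableOn (fun x => α * ((g x - u x) * (v x - u x)) + v x * p x) Ω := j1.add j2
  have j123 : IntegrableOn (fun x => α * ((g x - u x) * (v x - u x)) + v x * p x - u x * p x) Ω :=
    j12.sub j3
  have j1234 : IntegrableOn (fun x => α * ((g x - u x) * (v x - u x)) + v x * p x - u x * p x -
    (p x - α * (v x - 𝒯.proj g x)) * (v x - u x)) Ω := j123.sub j4
  -- Pointwise, `α (v - u)` equals `α (g - u) + p - p` minus the residual `p - α (v - g_h)` and
  -- minus `α (g - g_h)`, with one `p` absorbed in the residual. The terms are grouped so that the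
  -- variational inequality, duality and Cauchy-Schwarz apply one by one.
  have key : α * ∫ x in (Ω : Set (E d)), (v x - u x) ^ 2 =
      α * (∫ x in (Ω : Set (E d)), (g x - u x) * (v x - u x)) +
        (∫ x in (Ω : Set (E d)), v x * p x) - (∫ x in (Ω : Set (E d)), u x * p x) -
        (∫ x in (Ω : Set (E d)), (p x - α * (v x - 𝒯.proj g x)) * (v x - u x)) -
        α * ∫ x in (Ω : Set (E d)), (g x - 𝒯.proj g x) * (v x - u x) := by
    rw [← integral_const_mul, ← integral_const_mul, ← integral_const_mul, ← integral_add j1 j2,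
      ← integral_sub j12 j3, ← integral_sub j123 j4, ← integral_sub j1234 j5]
    exact integral_congr_ae (Eventually.of_forall fun x => by ring)
  rw [hcomm, Triangulation.eta, Triangulation.etaSq, Triangulation.estimatorSqOn, ← ha,
    ← l2Norm_sq hr]
  refine Triangulation.le_add_of_quadratic_le hα ha0 (l2Norm_nonneg _) ?_
  rw [l2Norm_sq he, key]
  nlinarith [mul_le_mul_of_nonneg_left h5 hα.le]

end ROF

theorem mainTheorem6 {d : ℕ} (hd : 1 ≤ d)
    (Ω : Opens (E d)) (hΩ : IsBoundedLipschitzDomain Ω)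
    (𝒯 : Triangulation Ω)
    (ΓD : Set (E d))
    (hΓD : ∃ 𝒮 ⊆ 𝒯.boundarySides, ΓD = ⋃ S ∈ 𝒮, convexHull ℝ (S : Set (E d)))
    (α : ℝ) (hα : 0 < α)
    (g : E d → ℝ) (hg : MemLp g 2 (volume.restrict (Ω : Set (E d))))
    (u : E d → ℝ) (hu : IsROFMinimizer Ω ΓD α g u)
    (uh : E d → ℝ) (huh : 𝒯.MemP1 ΓD uh)
    (q : E d → E d) (divq : E d → ℝ) (hq : MemWDivN Ω ΓD q divq)
    (hq1 : ∀ᵐ x ∂(volume.restrict (Ω : Set (E d))), ‖q x‖ ≤ 1) :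
    l2Norm Ω (fun x => u x - uh x)
        ≤ (2 / α) ^ (1 / 2 : ℝ) * 𝒯.eta α g uh q divq + l2Norm Ω (fun x => g x - 𝒯.proj g x) ∧
      ((𝒯.etaSq α g uh q divq : ℝ) : EReal)
        = rofEnergy Ω α (𝒯.proj g) uh - rofDual Ω α (𝒯.proj g) q divq ∧
      𝒯.etaSq α g uh q divq = ∑ T ∈ 𝒯.elements, 𝒯.etaSqElem T α g uh q divq ∧
      ∀ T ∈ 𝒯.elements, 0 ≤ 𝒯.etaSqElem T α g uh q divq := by
  refine ⟨?_, huh.etaSq_eq_gap hd hΩ hΓD hα g hq hq1, huh.etaSq_eq_sum hΩ α g q hq.div_memL2,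
    fun T hT => Triangulation.MemP1.etaSqElem_nonneg hΩ hα hq1 g uh divq hT⟩
  rw [← Real.sqrt_eq_rpow]
  exact hu.l2Norm_sub_le hd hΩ hΓD hα hg huh hq hq1
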